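/- Let $n,N\ge 2$ be integers, $t\in[1,2]$, $r=\frac{2t}{4-t}$ and $\eta\in(0,1)$. For $s>0$ and $x\in\mathbb R^N$ write $\|x\|_s=\big(\sum_{j=1}^N|x_j|^s\big)^{1/s}$ and $\|x\|_{\mathcal M,t}=\big(\sum_{j=2}^N|x_j|^t\big)^{1/t}$. For a family $(\mathbb P_q)_{q\in\Theta}$ of laws of the observations, indexed by $\Theta\subset\mathbb R^N$, a (semi)norm $d$ on $\mathbb R^N$ and $p\in\Theta$, the $\eta$-minimax separation radius for testing $q=p$ against $q\in\Theta,\ d(p-q)\ge\rho$ is $$\rho^*=\inf\Big\{\rho>0:\ \inf_{\psi}\Big[\mathbb P_p(\psi=1)+\sup_{q\in\Theta,\ d(p-q)\ge\rho}\mathbb P_q(\psi=0)\Big]\le\eta\Big\},$$ where $\psi$ ranges over the measurable $\{0,1\}$-valued functions of the observations and a supremum over the empty set is $0$. Let * $\rho^*_{Poi}(n,p,t,\eta)$ be this radius when $\Theta=\mathbb R_+^N$, $d=\|\cdot\|_t$, and one observes $n$ i.i.d. vectors with law $\bigotimes_{j=1}^N \mathrm{Poi}(q_j)$; * $\rho^*_{Mult}(n,p,t,\eta)$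 be this radius when $\Theta=\{q\in\mathbb R_+^N:\sum_j q_j=1\}$, $d=\|\cdot\|_{\mathcal M,t}$, and one observes $n$ i.i.d. draws from the distribution $q$ on $\{1,\dots,N\}$. For $p$ with $p_1\ge\dots\ge p_N\ge0$ and a constant $c_I>0$ let $$I=I(n,p)=\min\Big\{J\in\{0,\dots,N\}:\ \sum_{i>J}p_i^2\le\frac{c_I}{n^2}\Big\},$$ $p_{\le I}=(p_1,\dots,p_I,0,\dots,0)$, $p_{>I}=(0,\dots,0,p_{I+1},\dots,p_N)$, $p^{-\max}=(p_2,\dots,p_N)$, and $p^{-\max}_{\le I}=(p_2,\dots,p_I,0,\dots,0)$ (indices as in $p$; this is $0$ if $I\le1$). Then for every $\eta\in(0,1)$ there is $c_0>0$, depending only on $\eta$, such that for every $c_I\in(0,c_0]$ there are constants $0<c$, $0<C$, depending only on $\eta$ and $c_I$, such that for all $t\in[1,2]$, all $n,N\ge2$ and all $p$ with $p_1\ge\dots\ge p_N\ge0$: 1. (Poisson model) $c\,R\le\rho^*_{Poi}(n,p,t,\eta)\le C\,R$, where $$R=\sqrt{\frac{\|p_{\le I}\|_r}{n}}+\frac{\|p_{>I}\|_1^{(2-t)/t}}{n^{(2t-2)/t}}+\frac1n;$$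 2. (multinomial model) if moreover $\sum_j p_j=1$, then $c\,R'\le\rho^*_{Mult}(n,p,t,\eta)\le C\,R'$, where $$R'=\sqrt{\frac{\|p^{-\max}_{\le I}\|_r}{n}}+\frac{\|p_{>I}\|_1^{(2-t)/t}}{n^{(2t-2)/t}}+\frac1n.$$ (When $t=2$ the factor $\|p_{>I}\|_1^{0}$ is read as $1$.) -/

import Mathlib

open MeasureTheory ProbabilityTheory
open scoped ENNReal

noncomputable section

namespace GoodnessOfFit

/-! Coordinates are indexed by `Fin N`, so the coordinate called `i` in `1, …, N` has the
`Fin N`-index `j = i - 1`. -/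

/-- `‖x‖_s = (∑ j, |x_j| ^ s) ^ (1 / s)`, for any real `s > 0` (a quasi-norm if `s < 1`). -/
def lpNorm {N : ℕ} (s : ℝ) (x : Fin N → ℝ) : ℝ :=
  (∑ j, |x j| ^ s) ^ (1 / s)

/-- The vector `x` with its first coordinate replaced by zero. If `x` is sorted in decreasing
order this is `(x_2, …, x_N)`, padded with a zero so that the coordinates keep their indices. -/
def dropFirst {N : ℕ} (x : Fin N → ℝ) : Fin N → ℝ :=
  fun j => if (j : ℕ) = 0 then 0 else x j

/-- The multinomial norm `(∑_{i = 2}^N |x_i| ^ t) ^ (1 / t)`. -/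
def multNorm {N : ℕ} (t : ℝ) (x : Fin N → ℝ) : ℝ :=
  (∑ j : Fin N, if (j : ℕ) = 0 then 0 else |x j| ^ t) ^ (1 / t)

/-- `x_{≤ u} = (x_1, …, x_u, 0, …, 0)`. -/
def head {N : ℕ} (x : Fin N → ℝ) (u : ℕ) : Fin N → ℝ :=
  fun j => if (j : ℕ) + 1 ≤ u then x j else 0

/-- `x_{> u} = (0, …, 0, x_{u+1}, …, x_N)`. -/
def tail {N : ℕ} (x : Fin N → ℝ) (u : ℕ) : Fin N → ℝ :=
  fun j => if u < (j : ℕ) + 1 then x j else 0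

/-- `I = min {J : ∑_{i > J} p_i ^ 2 ≤ c_I / n ^ 2}`; the index `J = N` always qualifies if
`c_I ≥ 0`. -/
def cutoff {N : ℕ} (cI : ℝ) (n : ℕ) (p : Fin N → ℝ) : ℕ :=
  sInf {J : ℕ | ∑ j, tail p J j ^ 2 ≤ cI / (n : ℝ) ^ 2}

/-- The expression
`√(‖v‖_r / n) + ‖w‖_1 ^ ((2 - t) / t) / n ^ ((2 t - 2) / t) + 1 / n`, with `r = 2 t / (4 - t)`,
for a bulk vector `v` and a tail vector `w`. -/
def rate {N : ℕ} (t : ℝ) (n : ℕ) (v w : Fin N → ℝ) : ℝ :=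
  √(lpNorm (2 * t / (4 - t)) v / n)
    + lpNorm 1 w ^ ((2 - t) / t) / (n : ℝ) ^ ((2 * t - 2) / t) + 1 / n

/-! ### The testing problem

`P q` is the law of the data when the parameter is `q`, `Θ` the set of parameters, `d` the
(semi)norm which measures the separation. -/

section Testing

variable {Ω : Type*} [MeasurableSpace Ω] {N : ℕ}

/-- The maximum risk of a test `ψ` : type-I error plus worst case type-II error over
the parameters `q` in `Θ` with `d (p - q) ≥ ρ`. -/
def risk (P : (Fin N → ℝ) → Measure Ω) (Θ : Set (Fin N → ℝ)) (d : (Fin N → ℝ) → ℝ)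
    (p : Fin N → ℝ) (ρ : ℝ) (ψ : Ω → Fin 2) : ℝ≥0∞ :=
  P p {ω | ψ ω = 1} + ⨆ q ∈ {q | q ∈ Θ ∧ ρ ≤ d (p - q)}, P q {ω | ψ ω = 0}

/-- The minimax risk: the infimum of the risk over all measurable `{0, 1}`-valued tests. -/
def minimaxRisk (P : (Fin N → ℝ) → Measure Ω) (Θ : Set (Fin N → ℝ)) (d : (Fin N → ℝ) → ℝ)
    (p : Fin N → ℝ) (ρ : ℝ) : ℝ≥0∞ :=
  ⨅ ψ ∈ {ψ : Ω → Fin 2 | Measurable ψ}, risk P Θ d p ρ ψ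

/-- The `η`-minimax separation radius `inf {ρ > 0 : minimax risk at ρ is at most η}`. -/
def sepRadius (P : (Fin N → ℝ) → Measure Ω) (Θ : Set (Fin N → ℝ)) (d : (Fin N → ℝ) → ℝ)
    (p : Fin N → ℝ) (η : ℝ) : ℝ :=
  sInf {ρ : ℝ | 0 < ρ ∧ minimaxRisk P Θ d p ρ ≤ ENNReal.ofReal η}

end Testing

/-- The law of `n` i.i.d. observations of `⨂_j Poi(q_j)`. -/
def poissonLaw (n N : ℕ) (q : Fin N → ℝ) : Measure (Fin n → Fin N → ℕ) :=
  Measure.pi fun _ => Measure.pi fun j => poissonMeasure (q j).toNNReal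

/-- The law of `n` i.i.d. draws from `{1, …, N}`, each equal to `j` with probability `q_j`. -/
def multLaw (n N : ℕ) (q : Fin N → ℝ) : Measure (Fin n → Fin N) :=
  Measure.pi fun _ => ∑ j, ENNReal.ofReal (q j) • Measure.dirac j

/-- `ρ*_Poi(n, p, t, η)` : parameters in `ℝ_+^N`, separation in `‖·‖_t`. -/
def rhoPoi {N : ℕ} (n : ℕ) (p : Fin N → ℝ) (t η : ℝ) : ℝ :=
  sepRadius (poissonLaw n N) {q | ∀ j, 0 ≤ q j} (lpNorm t) p η

/-- `ρ*_Mult(n, p, t, η)` : parameters in the probability simplex, separation in the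
multinomial norm. -/
def rhoMult {N : ℕ} (n : ℕ) (p : Fin N → ℝ) (t η : ℝ) : ℝ :=
  sepRadius (multLaw n N) (stdSimplex ℝ (Fin N)) (multNorm t) p η

end GoodnessOfFit

end

namespace GoodnessOfFit

/-! ### Reduction of the separation radius to error bounds -/

section Testing

variable {Ω : Type*} [MeasurableSpace Ω] {N : ℕ}

/-! Put y = n p, let S be the sum of y_j^r over the bulk and T the sum of y_j over the tail.
Multiplied by n, the rate is S^((4-t)/(4t)) + T^((2-t)/t) + 1. Both models enter only through
`CountModel`: linear statistics have at most Poisson variance, the likelihood is a monomial up to a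
function of the total mass, and χ² cross moments are at most exp Σ (q-p)(q'-p)/p.

Upper bound. For two disjoint groups of observations of equal size, with centred counts A and B, Σ
w_j A_j B_j is unbiased for a multiple of Σ w_j (q_j - p_j)², and independence reduces its variance
to second moments of linear statistics (`bilinear_moments`); Chebyshev then gives
`CountModel.bilinear_test`. On the bulk the weights y_j^(-2(2-t)/(4-t)) give null standard deviation
of order √S, and Hölder compares the weighted distance with the t-norm (`bulk_detection`). On the
tail, w = 1 detects a large ℓ² distance and a plain count detects a large mass; interpolation
between ℓ¹ and ℓ² shows that a large t-norm forces one of the two (`tail_dichotomy`). Bulk and tail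
are linked by cI ≤ u (u + T), where u is the smallest bulk coordinate of y: this follows from
minimality of I and monotonicity of p, and controls the largest weight.

Lower bound. Each term of the rate has its own prior. For 1/n, a single alternative keeps a fraction
1 - O(1/n) of the null mass per observation. For the tail, small coordinates are grouped into blocks
of mass about κ/T, with κ a small constant, and each block is moved to one of its coordinates, drawn
in proportion to p; as long as no block is hit twice, mixture and null likelihoods coincide
(`CountModel.le_sepRadius_of_blocks`). For the bulk, coordinates are perturbed with random signs,
and the second moment method bounds the mixture (`CountModel.le_sepRadius_of_directions`); if the
perturbation would exceed some bulk coordinate, then cI ≤ u (u + T) shows that the bulk term is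
dominated by the other two.

In the multinomial model signs act on disjoint pairs of neighbouring coordinates, which preserves
total mass; since p is sorted, this loses only constants. -/

theorem sepRadius_le {P : (Fin N → ℝ) → Measure Ω} {Θ : Set (Fin N → ℝ)}
    {d : (Fin N → ℝ) → ℝ} {p : Fin N → ℝ} {η ρ : ℝ} (hρ : 0 < ρ)
    (h : minimaxRisk P Θ d p ρ ≤ ENNReal.ofReal η) : sepRadius P Θ d p η ≤ ρ :=
  csInf_le ⟨0, fun _ hx => hx.1.le⟩ ⟨hρ, h⟩

theorem minimaxRisk_anti (P : (Fin N → ℝ) → Measure Ω) (Θ : Set (Fin N → ℝ))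
    (d : (Fin N → ℝ) → ℝ) (p : Fin N → ℝ) {ρ ρ' : ℝ} (h : ρ ≤ ρ') :
    minimaxRisk P Θ d p ρ' ≤ minimaxRisk P Θ d p ρ := by
  refine iInf₂_mono fun ψ _ => ?_
  refine add_le_add le_rfl ?_
  exact biSup_mono fun q hq => ⟨hq.1, h.trans hq.2⟩

/-- The risk is nonincreasing in ρ, so a level with risk above η lies below every admissible one.
Nonemptiness is required because `sInf ∅ = 0` in `ℝ`; the upper bound will supply it. -/
theorem le_sepRadius {P : (Fin N → ℝ) → Measure Ω} {Θ : Set (Fin N → ℝ)}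
    {d : (Fin N → ℝ) → ℝ} {p : Fin N → ℝ} {η s : ℝ}
    (hne : ∃ ρ, 0 < ρ ∧ minimaxRisk P Θ d p ρ ≤ ENNReal.ofReal η)
    (h : ENNReal.ofReal η < minimaxRisk P Θ d p s) : s ≤ sepRadius P Θ d p η := by
  refine le_csInf hne fun ρ hρ => ?_
  by_contra! hlt
  exact absurd ((minimaxRisk_anti P Θ d p hlt.le).trans hρ.2) (not_le.mpr h)

/-- A finitely supported prior on the alternative whose mixture dominates the null law up to
`ε < 1 - η` on all events bounds the separation radius from below. -/
theorem le_sepRadius_of_prior {α : Type*} [Fintype α] {P : (Fin N → ℝ) → Measure Ω}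
    {Θ : Set (Fin N → ℝ)} {d : (Fin N → ℝ) → ℝ} {p : Fin N → ℝ} {η s ε : ℝ}
    (hne : ∃ ρ, 0 < ρ ∧ minimaxRisk P Θ d p ρ ≤ ENNReal.ofReal η)
    (hP : ∀ q ∈ Θ, IsProbabilityMeasure (P q)) (hp : p ∈ Θ) (hη : 0 < η)
    (w : α → ℝ) (hw : ∀ a, 0 ≤ w a) (hw1 : ∑ a, w a = 1) (q : α → Fin N → ℝ)
    (hq : ∀ a, q a ∈ Θ) (hd : ∀ a, s ≤ d (p - q a)) (hε : η < 1 - ε)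
    (hdom : ∀ A : Set Ω, MeasurableSet A →
      (P p).real A ≤ ∑ a, w a * (P (q a)).real A + ε) :
    s ≤ sepRadius P Θ d p η := by
  refine le_sepRadius hne ?_
  refine ((ENNReal.ofReal_lt_ofReal_iff (hη.trans hε)).2 hε).trans_le ?_
  refine le_iInf₂ fun ψ hψ => ?_
  have hψ' : Measurable ψ := hψ
  set A : Set Ω := {ω | ψ ω = 0} with hA
  have hAm : MeasurableSet A := hψ' (measurableSet_singleton 0)
  have hAc : {ω | ψ ω = 1} = Aᶜ := by
    ext ω; simp only [hA, Set.mem_ofPred_eq, Set.mem_compl_iff]; omega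
  have := hP p hp
  have key : ∀ a, P (q a) A ≤ ⨆ q ∈ {q | q ∈ Θ ∧ s ≤ d (p - q)}, P q {ω | ψ ω = 0} :=
    fun a => le_biSup (fun q => P q A) (⟨hq a, hd a⟩ : q a ∈ {q | q ∈ Θ ∧ s ≤ d (p - q)})
  unfold risk
  rw [hAc]
  set Sup := ⨆ q ∈ {q | q ∈ Θ ∧ s ≤ d (p - q)}, P q {ω | ψ ω = 0} with hS
  have hS1 : Sup ≤ 1 := iSup₂_le fun q hq => by
    have := hP q hq.1
    exact prob_le_one
  have hSt : Sup ≠ ∞ := (hS1.trans_lt ENNReal.one_lt_top).ne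
  have key' : ∀ a, (P (q a)).real A ≤ Sup.toReal := fun a =>
    ENNReal.toReal_mono hSt (key a)
  -- The worst-case type-II error dominates its average over the prior.
  have h1 : ∑ a, w a * (P (q a)).real A ≤ Sup.toReal := by
    calc _ ≤ ∑ a, w a * Sup.toReal :=
          Finset.sum_le_sum fun a _ => mul_le_mul_of_nonneg_left (key' a) (hw a)
      _ = Sup.toReal := by rw [← Finset.sum_mul, hw1, one_mul]
  have h2 := hdom A hAm
  have h3 : (P p).real Aᶜ = 1 - (P p).real A := probReal_compl_eq_one_sub hAm
  rw [← ENNReal.ofReal_toReal hSt, ← ENNReal.ofReal_toReal (measure_ne_top (P p) Aᶜ),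
    ← ENNReal.ofReal_add ENNReal.toReal_nonneg ENNReal.toReal_nonneg]
  refine ENNReal.ofReal_le_ofReal ?_
  change 1 - ε ≤ (P p).real Aᶜ + _
  linarith

end Testing

/-! ### Count models: a common interface for Poisson and multinomial data -/

/-- A family `ν` of laws on a space `E` with count vectors `X : E → Fin N → ℕ`, which behaves like
the Poisson or the multinomial family. -/
structure CountModel {N : ℕ} {E : Type*} [MeasurableSpace E] (ν : (Fin N → ℝ) → Measure E)
    (Θ : Set (Fin N → ℝ)) (X : E → Fin N → ℕ) : Prop where
  nonneg : ∀ q ∈ Θ, ∀ j, 0 ≤ q j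
  prob : ∀ q ∈ Θ, IsProbabilityMeasure (ν q)
  memLp : ∀ q ∈ Θ, ∀ j, MemLp (fun x => (X x j : ℝ)) 2 (ν q)
  mean : ∀ q ∈ Θ, ∀ j, ∫ x, (X x j : ℝ) ∂(ν q) = q j
  -- An equality for independent Poisson counts; for a categorical draw the squared mean is dropped.
  var : ∀ q ∈ Θ, ∀ v : Fin N → ℝ,
    Var[fun x => ∑ j, v j * (X x j : ℝ); ν q] ≤ ∑ j, v j ^ 2 * q j
  -- Comparing a mass-preserving prior with the null thus reduces to an identity between monomials.
  density : ∃ (c : E → ℝ) (z : ℝ → ℝ), (∀ x, 0 ≤ c x) ∧ (∀ s, 0 < z s) ∧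
    ∀ q ∈ Θ, ∀ x, ν q {x} = ENNReal.ofReal (z (∑ j, q j) * c x * ∏ j, q j ^ X x j)
  -- Pointwise likelihood ratios for the χ² method; the exponential form of the bound is stable
  -- under taking n observations.
  ratio : ∀ p ∈ Θ, ∃ ℓ : (Fin N → ℝ) → E → ℝ, ∀ q ∈ Θ, (∀ j, p j = 0 → q j = 0) →
    (∀ x, 0 ≤ ℓ q x) ∧ (∀ x, ν q {x} = ENNReal.ofReal (ℓ q x) * ν p {x}) ∧
    ∀ q' ∈ Θ, (∀ j, p j = 0 → q' j = 0) →
      Integrable (fun x => ℓ q x * ℓ q' x) (ν p) ∧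
      ∫ x, ℓ q x * ℓ q' x ∂(ν p) ≤ Real.exp (∑ j, (q j - p j) * (q' j - p j) / p j)

section CountModels

open scoped NNReal Nat

section PoissonMoments

/-- E[K f(K)] = r E[f(K+1)], from (k+1)/(k+1)! = 1/k!. The choices f = 1 and f(k) = k give the first
two moments. -/
theorem hasSum_poisson_shift (r : ℝ≥0) (f : ℕ → ℝ)
    (hf : Integrable (fun k : ℕ => f (k + 1)) (poissonMeasure r)) :
    Integrable (fun k : ℕ => k * f k) (poissonMeasure r) ∧
      ∫ k, (k : ℝ) * f k ∂(poissonMeasure r) = r * ∫ k, f (k + 1) ∂(poissonMeasure r) := by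
  have h1 := (hasSum_integral_poissonMeasure hf).mul_left (r : ℝ)
  have hterm : ∀ k : ℕ, Real.exp (-r) * (r : ℝ) ^ (k + 1) / ((k + 1)! : ℝ) * ((k + 1 : ℕ) : ℝ)
      = r * (Real.exp (-r) * (r : ℝ) ^ k / (k ! : ℝ)) := by
    intro k
    have : (k ! : ℝ) ≠ 0 := by positivity
    rw [Nat.factorial_succ]; push_cast; field_simp; ring
  have hint : Integrable (fun k : ℕ => (k : ℝ) * f k) (poissonMeasure r) := by
    rw [integrable_poissonMeasure_iff] at hf ⊢
    rw [← summable_nat_add_iff 1]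
    refine (hf.mul_left (r : ℝ)).congr fun k => ?_
    rw [norm_mul, Real.norm_natCast, ← mul_assoc, ← mul_assoc, hterm]
  refine ⟨hint, ?_⟩
  rw [(hasSum_integral_poissonMeasure hint).tsum_eq.symm, ← h1.tsum_eq,
    (hasSum_integral_poissonMeasure hint).summable.tsum_eq_zero_add]
  simp only [CharP.cast_eq_zero, zero_mul, smul_eq_mul, mul_zero, zero_add]
  refine tsum_congr fun k => ?_
  rw [← mul_assoc, ← mul_assoc, hterm]

theorem poisson_mean (r : ℝ≥0) : Integrable (fun k : ℕ => (k : ℝ)) (poissonMeasure r) ∧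
    ∫ k, (k : ℝ) ∂(poissonMeasure r) = r := by
  simpa using hasSum_poisson_shift r (fun _ => 1) (integrable_const _)

theorem poisson_sq (r : ℝ≥0) : Integrable (fun k : ℕ => (k : ℝ) ^ 2) (poissonMeasure r) ∧
    ∫ k, (k : ℝ) ^ 2 ∂(poissonMeasure r) = r * (r + 1) := by
  have h := hasSum_poisson_shift r (fun k => (k : ℝ))
    (by simpa using (poisson_mean r).1.add (integrable_const (1 : ℝ)))
  simp only [Nat.cast_add, Nat.cast_one] at h
  rw [integral_add (poisson_mean r).1 (integrable_const _), (poisson_mean r).2] at h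
  simpa [sq] using h

theorem memLp_poisson (r : ℝ≥0) : MemLp (fun k : ℕ => (k : ℝ)) 2 (poissonMeasure r) :=
  (memLp_two_iff_integrable_sq .of_discrete).2 (poisson_sq r).1

theorem variance_poisson (r : ℝ≥0) : Var[fun k : ℕ => (k : ℝ); poissonMeasure r] = r := by
  rw [variance_eq_sub (memLp_poisson r)]
  simp only [Pi.pow_apply]
  rw [(poisson_sq r).2, (poisson_mean r).2]; ring

theorem poisson_mgf (r : ℝ≥0) (a : ℝ) (ha : 0 ≤ a) :
    Integrable (fun k : ℕ => a ^ k) (poissonMeasure r) ∧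
      ∫ k, a ^ k ∂(poissonMeasure r) = Real.exp (r * (a - 1)) := by
  have h : HasSum (fun k : ℕ => Real.exp (-r) * (r : ℝ) ^ k / (k ! : ℝ) * a ^ k)
      (Real.exp (r * (a - 1))) := by
    have := (NormedSpace.expSeries_div_hasSum_exp (r * a : ℝ)).mul_left (Real.exp (-r))
    rw [← Real.exp_eq_exp_ℝ, ← Real.exp_add] at this
    convert! this using 1
    · ext k; rw [mul_pow]; ring
    · congr 1; ring
  have hi : Integrable (fun k : ℕ => a ^ k) (poissonMeasure r) := by
    rw [integrable_poissonMeasure_iff]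
    refine h.summable.congr fun k => ?_
    rw [Real.norm_of_nonneg (pow_nonneg ha k)]
  exact ⟨hi, (hasSum_integral_poissonMeasure hi).unique h⟩

end PoissonMoments

/-- The law of one vector of independent Poisson counts. -/
noncomputable def poissonVec {N : ℕ} (q : Fin N → ℝ) : Measure (Fin N → ℕ) :=
  Measure.pi fun j => poissonMeasure (q j).toNNReal

instance {N : ℕ} (q : Fin N → ℝ) : IsProbabilityMeasure (poissonVec q) := by
  unfold poissonVec; infer_instance

theorem poissonVec_singleton {N : ℕ} {q : Fin N → ℝ} (hq : ∀ j, 0 ≤ q j) (x : Fin N → ℕ) :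
    poissonVec q {x} = ENNReal.ofReal
      (Real.exp (-∑ j, q j) * (∏ j, (((x j)! : ℝ))⁻¹) * ∏ j, q j ^ x j) := by
  rw [poissonVec, Measure.pi_singleton]
  simp_rw [poissonMeasure_singleton]
  rw [← ENNReal.ofReal_prod_of_nonneg (fun j _ => by positivity)]
  congr 1
  rw [← Finset.sum_neg_distrib, Real.exp_sum, ← Finset.prod_mul_distrib, ← Finset.prod_mul_distrib]
  refine Finset.prod_congr rfl fun j _ => ?_
  rw [Real.coe_toNNReal _ (hq j)]
  ring

/-- The generating function at q q'/p² turns each coordinate of the cross moment into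
exp((q-p)(q'-p)/p), so the bound in `ratio` is attained. -/
theorem countModel_poissonVec (N : ℕ) :
    CountModel (N := N) poissonVec {q | ∀ j, 0 ≤ q j} (fun x => x) where
  nonneg q hq := hq
  prob q _ := inferInstance
  memLp q _ j := (memLp_poisson (q j).toNNReal).comp_measurePreserving
    (measurePreserving_eval (fun j => poissonMeasure (q j).toNNReal) j)
  mean q hq j := by
    have := (measurePreserving_eval (fun j => poissonMeasure (q j).toNNReal) j).map_eq
    have h2 := (poisson_mean (q j).toNNReal).2
    rw [Real.coe_toNNReal _ (hq j), ← this, integral_map (measurable_pi_apply j).aemeasurable .of_discrete] at h2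
    exact h2
  var q hq v := by
    have := variance_sum_pi (μ := fun j => poissonMeasure (q j).toNNReal)
      (X := fun j (k : ℕ) => v j * (k : ℝ))
      (fun j => (memLp_poisson _).const_mul (v j))
    rw [poissonVec]
    have hs : (fun x : Fin N → ℕ => ∑ j, v j * (x j : ℝ)) =
        ∑ j, fun x : Fin N → ℕ => v j * (x j : ℝ) := by ext x; simp
    rw [hs, this]
    refine le_of_eq (Finset.sum_congr rfl fun j _ => ?_)
    rw [variance_const_mul, variance_poisson, Real.coe_toNNReal _ (hq j)]
  density := by
    refine ⟨fun x => ∏ j, (((x j)! : ℝ))⁻¹, fun s => Real.exp (-s), fun x => by positivity,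
      fun s => Real.exp_pos _, fun q hq x => poissonVec_singleton hq x⟩
  ratio := by
    intro p hp
    refine ⟨fun q x => ∏ j, Real.exp (p j - q j) * (q j / p j) ^ x j, ?_⟩
    intro q hq hpq
    refine ⟨fun x => Finset.prod_nonneg fun j _ => mul_nonneg (Real.exp_pos _).le
      (pow_nonneg (div_nonneg (hq j) (hp j)) _), fun x => ?_, fun q' hq' hpq' => ?_⟩
    · rw [poissonVec_singleton hq, poissonVec_singleton hp, ← ENNReal.ofReal_mul
        (Finset.prod_nonneg fun j _ => mul_nonneg (Real.exp_pos _).le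
        (pow_nonneg (div_nonneg (hq j) (hp j)) _))]
      congr 1
      simp_rw [← Finset.sum_neg_distrib, Real.exp_sum, ← Finset.prod_mul_distrib]
      refine Finset.prod_congr rfl fun j _ => ?_
      rcases eq_or_ne (p j) 0 with h0 | h0
      · rw [hpq j h0, h0]; simp
        rcases Nat.eq_zero_or_pos (x j) with h | h
        · simp [h]
        · rw [zero_pow h.ne']; simp
      · rw [sub_eq_add_neg, Real.exp_add, Real.exp_neg (p j), div_pow]
        have := Real.exp_pos (p j)
        field_simp
    · have hre : ∀ x : Fin N → ℕ, (∏ j, Real.exp (p j - q j) * (q j / p j) ^ x j) *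
          (∏ j, Real.exp (p j - q' j) * (q' j / p j) ^ x j) =
          ∏ j, Real.exp (2 * p j - q j - q' j) * (q j / p j * (q' j / p j)) ^ x j := by
        intro x
        rw [← Finset.prod_mul_distrib]
        refine Finset.prod_congr rfl fun j _ => ?_
        rw [mul_pow, show 2 * p j - q j - q' j = (p j - q j) + (p j - q' j) by ring, Real.exp_add]
        ring
      simp_rw [hre]
      have hm := fun j => poisson_mgf (p j).toNNReal (q j / p j * (q' j / p j))
        (mul_nonneg (div_nonneg (hq j) (hp j)) (div_nonneg (hq' j) (hp j)))
      refine ⟨Integrable.fintype_prod (fun j => (hm j).1.const_mul _), le_of_eq ?_⟩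
      rw [poissonVec, integral_fintype_prod_eq_prod (μ := fun j => poissonMeasure (p j).toNNReal)
        (f := fun j (k : ℕ) => Real.exp (2 * p j - q j - q' j) * (q j / p j * (q' j / p j)) ^ k),
        Real.exp_sum]
      refine Finset.prod_congr rfl fun j _ => ?_
      rw [integral_const_mul, (hm j).2, Real.coe_toNNReal _ (hp j), ← Real.exp_add]
      congr 1
      rcases eq_or_ne (p j) 0 with h0 | h0
      · rw [hpq j h0, hpq' j h0, h0]; simp
      · field_simp; ring

/-- The law on `Fin N` with weights `q`. -/
noncomputable def drawLaw {N : ℕ} (q : Fin N → ℝ) : Measure (Fin N) :=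
  ∑ j, ENNReal.ofReal (q j) • Measure.dirac j

theorem drawLaw_singleton {N : ℕ} (q : Fin N → ℝ) (x : Fin N) :
    drawLaw q {x} = ENNReal.ofReal (q x) := by
  simp only [drawLaw, Measure.coe_finsetSum, Finset.sum_apply, Measure.smul_apply, smul_eq_mul]
  rw [Finset.sum_eq_single x]
  · simp
  · intro j _ hj; simp [hj]
  · simp

theorem isProbabilityMeasure_drawLaw {N : ℕ} {q : Fin N → ℝ} (hq : q ∈ stdSimplex ℝ (Fin N)) :
    IsProbabilityMeasure (drawLaw q) := by
  constructor
  simp only [drawLaw, Measure.coe_finsetSum, Finset.sum_apply, Measure.smul_apply, smul_eq_mul,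
    measure_univ, mul_one]
  rw [← ENNReal.ofReal_sum_of_nonneg (fun j _ => hq.1 j), hq.2, ENNReal.ofReal_one]

theorem integral_drawLaw {N : ℕ} {q : Fin N → ℝ} (hq : q ∈ stdSimplex ℝ (Fin N))
    (f : Fin N → ℝ) : ∫ x, f x ∂(drawLaw q) = ∑ j, q j * f j := by
  have := isProbabilityMeasure_drawLaw hq
  rw [integral_fintype .of_finite]
  refine Finset.sum_congr rfl fun j _ => ?_
  rw [measureReal_def, drawLaw_singleton, ENNReal.toReal_ofReal (hq.1 j), smul_eq_mul]

/-- The count vector is a unit vector, so (Σ v_j X_j)² = Σ v_j² X_j and the raw second moment bounds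
the variance. The cross moment is 1 + Σ (q-p)(q'-p)/p, and 1 + x ≤ exp x brings it to the Poisson
form. -/
theorem countModel_drawLaw (N : ℕ) :
    CountModel (N := N) drawLaw (stdSimplex ℝ (Fin N)) (fun x j => if x = j then 1 else 0) where
  nonneg q hq := hq.1
  prob q hq := isProbabilityMeasure_drawLaw hq
  memLp q hq j := by
    have := isProbabilityMeasure_drawLaw hq
    exact MemLp.of_discrete
  mean q hq j := by
    rw [integral_drawLaw hq]; simp
  var q hq v := by
    have := isProbabilityMeasure_drawLaw hq
    refine (variance_le_expectation_sq .of_discrete).trans ?_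
    simp only [Pi.pow_apply]
    rw [integral_drawLaw hq]
    refine le_of_eq (Finset.sum_congr rfl fun j _ => ?_)
    simp; ring
  density := by
    refine ⟨fun _ => 1, fun _ => 1, fun _ => zero_le_one, fun _ => one_pos, fun q _ x => ?_⟩
    rw [drawLaw_singleton]
    congr 1
    rw [Finset.prod_eq_single x] <;> simp
    intro j h h'
    exact absurd h'.symm h
  ratio := by
    intro p hp
    refine ⟨fun q x => q x / p x, fun q hq hpq => ⟨fun x => div_nonneg (hq.1 x) (hp.1 x),
      fun x => ?_, fun q' hq' hpq' => ?_⟩⟩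
    · rw [drawLaw_singleton, drawLaw_singleton,
        ← ENNReal.ofReal_mul (div_nonneg (hq.1 x) (hp.1 x))]
      congr 1
      rcases eq_or_ne (p x) 0 with h0 | h0
      · simp [hpq x h0, h0]
      · field_simp
    · have := isProbabilityMeasure_drawLaw hp
      refine ⟨.of_finite, ?_⟩
      rw [integral_drawLaw hp]
      have h1 : ∑ j, p j * (q j / p j * (q' j / p j)) =
          ∑ j, (q j - p j) * (q' j - p j) / p j + 1 := by
        -- Writing 1 as this sum makes the identity hold coordinate by coordinate, also where p
        -- vanishes.
        have : ∑ j, (q j + q' j - p j) = 1 := by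
          rw [Finset.sum_sub_distrib, Finset.sum_add_distrib, hp.2, hq.2, hq'.2]; ring
        rw [← this, ← Finset.sum_add_distrib]
        refine Finset.sum_congr rfl fun j _ => ?_
        rcases eq_or_ne (p j) 0 with h0 | h0
        · simp [hpq j h0, hpq' j h0, h0]
        · field_simp; ring
      rw [h1]
      exact Real.add_one_le_exp _

end CountModels

/-! ### Second moments of bilinear statistics -/

section Bilinear

variable {Ω : Type*} [MeasurableSpace Ω] {μ : Measure Ω} {N : ℕ}

/-- Second moment of a bilinear statistic of two independent vectors. -/
theorem bilinear_moments [IsProbabilityMeasure μ] {A B : Ω → Fin N → ℝ} (hAB : IndepFun A B μ)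
    (hA : ∀ j, MemLp (fun ω => A ω j) 2 μ) (hB : ∀ j, MemLp (fun ω => B ω j) 2 μ)
    {m : ℝ} (hm : 0 ≤ m) {Δ q : Fin N → ℝ} (hq : ∀ j, 0 ≤ q j)
    (hA1 : ∀ j, ∫ ω, A ω j ∂μ = m * Δ j) (hB1 : ∀ j, ∫ ω, B ω j ∂μ = m * Δ j)
    (hA2 : ∀ v : Fin N → ℝ, ∫ ω, (∑ j, v j * A ω j) ^ 2 ∂μ ≤
      m ^ 2 * (∑ j, v j * Δ j) ^ 2 + m * ∑ j, v j ^ 2 * q j)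
    (hB2 : ∀ v : Fin N → ℝ, ∫ ω, (∑ j, v j * B ω j) ^ 2 ∂μ ≤
      m ^ 2 * (∑ j, v j * Δ j) ^ 2 + m * ∑ j, v j ^ 2 * q j) (w : Fin N → ℝ) :
    MemLp (fun ω => ∑ j, w j * (A ω j * B ω j)) 2 μ ∧
    ∫ ω, (∑ j, w j * (A ω j * B ω j)) ∂μ = m ^ 2 * ∑ j, w j * Δ j ^ 2 ∧
    Var[fun ω => ∑ j, w j * (A ω j * B ω j); μ] ≤
      m ^ 2 * ∑ j, w j ^ 2 * q j ^ 2 + 2 * m ^ 3 * ∑ j, w j ^ 2 * Δ j ^ 2 * q j := by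
  have hind1 : ∀ j, IndepFun (fun ω => A ω j) (fun ω => B ω j) μ := fun j =>
    hAB.comp (measurable_pi_apply j) (measurable_pi_apply j)
  have hind2 : ∀ j k, IndepFun (fun ω => A ω j * A ω k) (fun ω => B ω j * B ω k) μ := fun j k =>
    hAB.comp (φ := fun x : Fin N → ℝ => x j * x k) (ψ := fun x : Fin N → ℝ => x j * x k)
      ((measurable_pi_apply j).mul (measurable_pi_apply k))
      ((measurable_pi_apply j).mul (measurable_pi_apply k))
  have hAA : ∀ j k, Integrable (fun ω => A ω j * A ω k) μ := fun j k => (hA j).integrable_mul (hA k)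
  have hBB : ∀ j k, Integrable (fun ω => B ω j * B ω k) μ := fun j k => (hB j).integrable_mul (hB k)
  have hABi : ∀ j, Integrable (fun ω => A ω j * B ω j) μ := fun j => (hA j).integrable_mul (hB j)
  have h4 : ∀ j k, Integrable (fun ω => (A ω j * A ω k) * (B ω j * B ω k)) μ := fun j k =>
    (hind2 j k).integrable_mul (hAA j k) (hBB j k)
  have hexp : ∀ ω, (∑ j, w j * (A ω j * B ω j)) ^ 2 =
      ∑ j, ∑ k, w j * w k * ((A ω j * A ω k) * (B ω j * B ω k)) := by
    intro ω
    rw [sq, Finset.sum_mul_sum]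
    refine Finset.sum_congr rfl fun j _ => Finset.sum_congr rfl fun k _ => by ring
  have hmeas : AEStronglyMeasurable (fun ω => ∑ j, w j * (A ω j * B ω j)) μ := by
    refine Finset.aestronglyMeasurable_fun_sum _ fun j _ => ?_
    exact ((hABi j).const_mul (w j)).aestronglyMeasurable
  have hsq : Integrable (fun ω => (∑ j, w j * (A ω j * B ω j)) ^ 2) μ := by
    simp_rw [hexp]
    exact integrable_finsetSum _ fun j _ => integrable_finsetSum _ fun k _ =>
      (h4 j k).const_mul _
  have hU : MemLp (fun ω => ∑ j, w j * (A ω j * B ω j)) 2 μ :=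
    (memLp_two_iff_integrable_sq hmeas).2 hsq
  have hmean : ∫ ω, (∑ j, w j * (A ω j * B ω j)) ∂μ = m ^ 2 * ∑ j, w j * Δ j ^ 2 := by
    rw [integral_finsetSum _ fun j _ => (hABi j).const_mul (w j), Finset.mul_sum]
    refine Finset.sum_congr rfl fun j _ => ?_
    rw [integral_const_mul]
    have := (hind1 j).integral_mul_eq_mul_integral (hA j).aestronglyMeasurable
      (hB j).aestronglyMeasurable
    simp only [Pi.mul_def] at this
    rw [this, hA1, hB1]; ring
  refine ⟨hU, hmean, ?_⟩
  rw [variance_eq_sub hU, hmean]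
  simp only [Pi.pow_apply]
  -- second moment, first averaging over `A`
  have hQ : ∀ v : Fin N → ℝ, ∑ j, ∑ k, v j * v k * ∫ ω, A ω j * A ω k ∂μ ≤
      m ^ 2 * (∑ j, v j * Δ j) ^ 2 + m * ∑ j, v j ^ 2 * q j := by
    intro v
    refine le_trans (le_of_eq ?_) (hA2 v)
    have : ∀ ω, (∑ j, v j * A ω j) ^ 2 = ∑ j, ∑ k, v j * v k * (A ω j * A ω k) := by
      intro ω
      rw [sq, Finset.sum_mul_sum]
      refine Finset.sum_congr rfl fun j _ => Finset.sum_congr rfl fun k _ => by ring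
    simp_rw [this]
    rw [integral_finsetSum _ fun j _ => integrable_finsetSum _ fun k _ => (hAA j k).const_mul _]
    refine Finset.sum_congr rfl fun j _ => ?_
    rw [integral_finsetSum _ fun k _ => (hAA j k).const_mul _]
    simp_rw [integral_const_mul]
  -- By independence the moments of A act as constants: given B, the square averages to a quadratic
  -- form in the vector w B, to which `hQ` applies.
  have hE2 : ∫ ω, (∑ j, w j * (A ω j * B ω j)) ^ 2 ∂μ =
      ∫ ω, ∑ j, ∑ k, (w j * B ω j) * (w k * B ω k) * ∫ ω', A ω' j * A ω' k ∂μ ∂μ := by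
    simp_rw [hexp]
    have hi : ∀ j k, Integrable (fun ω => (w j * B ω j) * (w k * B ω k) *
        ∫ ω', A ω' j * A ω' k ∂μ) μ := by
      intro j k
      refine (((hBB j k).const_mul (w j * w k)).mul_const (∫ ω', A ω' j * A ω' k ∂μ)).congr (.of_forall fun ω => ?_)
      ring
    rw [integral_finsetSum _ fun j _ => integrable_finsetSum _ fun k _ => (h4 j k).const_mul _,
      integral_finsetSum _ fun j _ => integrable_finsetSum _ fun k _ => hi j k]
    refine Finset.sum_congr rfl fun j _ => ?_
    rw [integral_finsetSum _ fun k _ => (h4 j k).const_mul _,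
      integral_finsetSum _ fun k _ => hi j k]
    refine Finset.sum_congr rfl fun k _ => ?_
    have := (hind2 j k).integral_mul_eq_mul_integral (hAA j k).aestronglyMeasurable
      (hBB j k).aestronglyMeasurable
    simp only [Pi.mul_def] at this
    rw [integral_const_mul, this, integral_mul_const]
    have h5 : ∀ ω, w j * B ω j * (w k * B ω k) = w j * w k * (B ω j * B ω k) := fun ω => by ring
    simp_rw [h5]
    rw [integral_const_mul]; ring
  have hBsum : ∀ v : Fin N → ℝ, MemLp (fun ω => ∑ j, v j * B ω j) 2 μ := fun v =>
    memLp_finsetSum _ fun j _ => (hB j).const_mul (v j)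
  have hI1 : Integrable (fun ω => (∑ j, w j * B ω j * Δ j) ^ 2) μ := by
    refine ((hBsum fun j => w j * Δ j).integrable_sq).congr (.of_forall fun ω => ?_)
    simp only
    congr 1
    exact Finset.sum_congr rfl fun j _ => by ring
  have hI2 : Integrable (fun ω => ∑ j, (w j * B ω j) ^ 2 * q j) μ := by
    refine integrable_finsetSum _ fun j _ => ?_
    refine (((hB j).integrable_sq.const_mul (w j ^ 2)).mul_const (q j)).congr
      (.of_forall fun ω => ?_)
    simp only; ring
  have hb1 : ∫ ω, (∑ j, w j * B ω j * Δ j) ^ 2 ∂μ ≤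
      m ^ 2 * (∑ j, w j * Δ j ^ 2) ^ 2 + m * ∑ j, w j ^ 2 * Δ j ^ 2 * q j := by
    refine le_trans (le_of_eq ?_) ((hB2 fun j => w j * Δ j).trans (le_of_eq ?_))
    · congr 1; ext ω; congr 1
      exact Finset.sum_congr rfl fun j _ => by ring
    · congr 3
      · exact Finset.sum_congr rfl fun j _ => by ring
      · ext j; ring
  have hBj : ∀ j, ∫ ω, (B ω j) ^ 2 ∂μ ≤ m ^ 2 * Δ j ^ 2 + m * q j := by
    intro j
    simpa [Pi.single_apply] using hB2 (Pi.single j 1)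
  have hb2 : ∫ ω, ∑ j, (w j * B ω j) ^ 2 * q j ∂μ ≤
      m ^ 2 * (∑ j, w j ^ 2 * Δ j ^ 2 * q j) + m * ∑ j, w j ^ 2 * q j ^ 2 := by
    have h6 : ∀ j ω, (w j * B ω j) ^ 2 * q j = w j ^ 2 * q j * B ω j ^ 2 := fun j ω => by ring
    simp_rw [h6]
    rw [integral_finsetSum _ fun j _ => (hB j).integrable_sq.const_mul _, Finset.mul_sum,
      Finset.mul_sum, ← Finset.sum_add_distrib]
    refine Finset.sum_le_sum fun j _ => ?_
    rw [integral_const_mul]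
    refine (mul_le_mul_of_nonneg_left (hBj j)
      (mul_nonneg (sq_nonneg _) (hq j))).trans (le_of_eq (by ring))
  have hE2' : ∫ ω, (∑ j, w j * (A ω j * B ω j)) ^ 2 ∂μ ≤
      m ^ 2 * ∫ ω, (∑ j, w j * B ω j * Δ j) ^ 2 ∂μ +
        m * ∫ ω, ∑ j, (w j * B ω j) ^ 2 * q j ∂μ := by
    rw [hE2, ← integral_const_mul, ← integral_const_mul,
      ← integral_add (hI1.const_mul _) (hI2.const_mul _)]
    refine integral_mono ?_ ((hI1.const_mul _).add (hI2.const_mul _)) fun ω => hQ _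
    refine integrable_finsetSum _ fun j _ => integrable_finsetSum _ fun k _ => ?_
    refine (((hBB j k).const_mul (w j * w k)).mul_const (∫ ω', A ω' j * A ω' k ∂μ)).congr
      (.of_forall fun ω => ?_)
    ring
  -- The term m⁴ (Σ w Δ²)² is the squared mean and cancels; the two mixed terms add up to the factor
  -- 2.
  have h7 := mul_le_mul_of_nonneg_left hb1 (sq_nonneg m)
  have h8 := mul_le_mul_of_nonneg_left hb2 hm
  nlinarith

end Bilinear

/-! ### Centred counts of groups of observations -/

section Counts

variable {E : Type*} [MeasurableSpace E] [Countable E] [MeasurableSingletonClass E]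
  {N n : ℕ} {ν : (Fin N → ℝ) → Measure E} {Θ : Set (Fin N → ℝ)} {X : E → Fin N → ℕ}

/-- Linear combinations of the counts of the observations with index in `s`, centred at `a`. -/
theorem CountModel.linear_moments (hM : CountModel ν Θ X) {q : Fin N → ℝ} (hq : q ∈ Θ)
    (s : Finset (Fin n)) (a v : Fin N → ℝ) :
    MemLp (fun ω : Fin n → E => ∑ j, v j * ∑ i ∈ s, ((X (ω i) j : ℝ) - a j)) 2
      (Measure.pi fun _ => ν q) ∧
    ∫ ω : Fin n → E, ∑ j, v j * ∑ i ∈ s, ((X (ω i) j : ℝ) - a j) ∂(Measure.pi fun _ => ν q) =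
      s.card * ∑ j, v j * (q j - a j) ∧
    Var[fun ω : Fin n → E => ∑ j, v j * ∑ i ∈ s, ((X (ω i) j : ℝ) - a j);
      Measure.pi fun _ => ν q] ≤ s.card * ∑ j, v j ^ 2 * q j := by
  have := hM.prob q hq
  set g : E → ℝ := fun x => ∑ j, v j * (X x j : ℝ) with hg
  set b : ℝ := ∑ j, v j * a j with hb
  have hgL : MemLp g 2 (ν q) := memLp_finsetSum _ fun j _ => (hM.memLp q hq j).const_mul (v j)
  have hgm : ∫ x, g x ∂(ν q) = ∑ j, v j * q j := by
    rw [hg, integral_finsetSum _ fun j _ =>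
      ((hM.memLp q hq j).integrable one_le_two).const_mul (v j)]
    exact Finset.sum_congr rfl fun j _ => by rw [integral_const_mul, hM.mean q hq j]
  have hmp := fun i : Fin n => measurePreserving_eval (fun _ : Fin n => ν q) i
  -- Observations outside s contribute the zero function, so the variance formula for sums over all
  -- of `Fin n` applies.
  set f : Fin n → E → ℝ := fun i x => if i ∈ s then g x - b else 0 with hf
  have hfL : ∀ i, MemLp (f i) 2 (ν q) := by
    intro i
    by_cases hi : i ∈ s
    · simp only [hf, hi, if_true]; exact hgL.sub (memLp_const b)
    · simp only [hf, hi, if_false]; exact memLp_const 0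
  have hre : (fun ω : Fin n → E => ∑ j, v j * ∑ i ∈ s, ((X (ω i) j : ℝ) - a j)) =
      ∑ i, fun ω : Fin n → E => f i (ω i) := by
    ext ω
    simp only [Finset.sum_apply, hf, Finset.sum_ite_mem, Finset.univ_inter, hg, hb,
      Finset.mul_sum]
    rw [Finset.sum_comm]
    refine Finset.sum_congr rfl fun i _ => ?_
    rw [← Finset.sum_sub_distrib]
    exact Finset.sum_congr rfl fun j _ => by ring
  have hfLω : ∀ i, MemLp (fun ω : Fin n → E => f i (ω i)) 2 (Measure.pi fun _ => ν q) :=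
    fun i => (hfL i).comp_measurePreserving (hmp i)
  rw [hre]
  refine ⟨?_, ?_, ?_⟩
  · exact memLp_finsetSum' _ fun i _ => hfLω i
  · have h1 : ∀ i, ∫ ω : Fin n → E, f i (ω i) ∂(Measure.pi fun _ => ν q) =
        if i ∈ s then ∑ j, v j * (q j - a j) else 0 := by
      intro i
      have h2 : ∫ ω : Fin n → E, f i (ω i) ∂(Measure.pi fun _ => ν q) = ∫ x, f i x ∂(ν q) := by
        have := integral_map (μ := Measure.pi fun _ : Fin n => ν q)
          (measurable_pi_apply i).aemeasurable (f := f i) .of_discrete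
        rw [← this]
        exact congrArg (fun κ => ∫ x, f i x ∂κ) (hmp i).map_eq
      rw [h2]
      by_cases hi : i ∈ s
      · simp only [hf, hi, if_true]
        rw [integral_sub (hgL.integrable one_le_two) (integrable_const b), hgm, integral_const]
        simp [hb, mul_sub]
      · simp [hf, hi]
    have h3 : ∀ ω, (∑ i, fun ω : Fin n → E => f i (ω i)) ω = ∑ i, f i (ω i) := fun ω =>
      Finset.sum_apply ω _ _
    rw [funext h3, integral_finsetSum _ fun i _ => (hfLω i).integrable one_le_two]
    simp_rw [h1]
    simp
  · rw [variance_sum_pi hfL]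
    have h1 : ∀ i, Var[f i; ν q] ≤ if i ∈ s then ∑ j, v j ^ 2 * q j else 0 := by
      intro i
      by_cases hi : i ∈ s
      · simp only [hf, hi, if_true]
        rw [variance_sub_const hgL.aestronglyMeasurable]
        exact hM.var q hq v
      · simp only [hf, hi, if_false]
        rw [← Pi.zero_def, variance_zero]
    refine (Finset.sum_le_sum fun i _ => h1 i).trans (le_of_eq ?_)
    simp

/-- Counts of the observations with index in `s`, centred at `a`. -/
def centredCount (X : E → Fin N → ℕ) (s : Finset (Fin n)) (a : Fin N → ℝ) (ω : Fin n → E) :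
    Fin N → ℝ :=
  fun j => ∑ i ∈ s, ((X (ω i) j : ℝ) - a j)

/-- The bilinear statistic `∑ j, w j * A j * B j`, where `A` and `B` are the centred counts of
two groups of observations. -/
def bilinearStat (X : E → Fin N → ℕ) (s t : Finset (Fin n)) (a w : Fin N → ℝ) (ω : Fin n → E) :
    ℝ :=
  ∑ j, w j * (centredCount X s a ω j * centredCount X t a ω j)

theorem CountModel.bilinearStat_moments (hM : CountModel ν Θ X) {q : Fin N → ℝ} (hq : q ∈ Θ)
    {s t : Finset (Fin n)} (hst : Disjoint s t) {m : ℕ} (hs : s.card = m) (ht : t.card = m)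
    (a w : Fin N → ℝ) :
    MemLp (bilinearStat X s t a w) 2 (Measure.pi fun _ => ν q) ∧
    ∫ ω, bilinearStat X s t a w ω ∂(Measure.pi fun _ => ν q) =
      (m : ℝ) ^ 2 * ∑ j, w j * (q j - a j) ^ 2 ∧
    Var[bilinearStat X s t a w; Measure.pi fun _ => ν q] ≤
      (m : ℝ) ^ 2 * ∑ j, w j ^ 2 * q j ^ 2 +
        2 * (m : ℝ) ^ 3 * ∑ j, w j ^ 2 * (q j - a j) ^ 2 * q j := by
  have := hM.prob q hq
  have hind : IndepFun (centredCount X s a) (centredCount X t a) (Measure.pi fun _ => ν q) := by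
    have h0 : iIndepFun (fun (i : Fin n) (ω : Fin n → E) => ω i) (Measure.pi fun _ => ν q) :=
      iIndepFun_pi (X := fun _ => id) (fun _ => aemeasurable_id)
    have h1 := h0.indepFun_finset s t hst fun i => measurable_pi_apply i
    refine h1.comp (φ := fun y j => ∑ i : s, ((X (y i) j : ℝ) - a j))
      (ψ := fun y j => ∑ i : t, ((X (y i) j : ℝ) - a j)) .of_discrete .of_discrete
      |>.congr (.of_forall fun ω => ?_) (.of_forall fun ω => ?_) <;>
    · ext j
      simp only [centredCount, Function.comp_apply]
      exact Finset.sum_coe_sort _ (fun i => (X (ω i) j : ℝ) - a j)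
  have key : ∀ u : Finset (Fin n), u.card = m →
      (∀ j, MemLp (fun ω => centredCount X u a ω j) 2 (Measure.pi fun _ => ν q)) ∧
      (∀ j, ∫ ω, centredCount X u a ω j ∂(Measure.pi fun _ => ν q) = m * (q j - a j)) ∧
      ∀ v : Fin N → ℝ, ∫ ω, (∑ j, v j * centredCount X u a ω j) ^ 2 ∂(Measure.pi fun _ => ν q) ≤
        (m : ℝ) ^ 2 * (∑ j, v j * (q j - a j)) ^ 2 + m * ∑ j, v j ^ 2 * q j := by
    intro u hu
    refine ⟨fun j => ?_, fun j => ?_, fun v => ?_⟩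
    · simpa [Pi.single_apply, centredCount] using (hM.linear_moments hq u a (Pi.single j 1)).1
    · simpa [Pi.single_apply, centredCount, hu] using
        (hM.linear_moments hq u a (Pi.single j 1)).2.1
    · obtain ⟨h1, h2, h3⟩ := hM.linear_moments hq u a v
      rw [variance_eq_sub h1, h2] at h3
      simp only [Pi.pow_apply, hu] at h3
      unfold centredCount
      nlinarith
  obtain ⟨a1, a2, a3⟩ := key s hs
  obtain ⟨b1, b2, b3⟩ := key t ht
  exact bilinear_moments hind a1 b1 (Nat.cast_nonneg m) (hM.nonneg q hq) a2 b2 a3 b3 w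

end Counts

/-! ### Chebyshev bounds and the basic tests -/

section Chebyshev

variable {Ω : Type*} [MeasurableSpace Ω] {μ : Measure Ω} [IsProbabilityMeasure μ]

theorem measureReal_le_variance_div_sq {U : Ω → ℝ} (hU : MemLp U 2 μ) {V c : ℝ} (hc : 0 < c)
    (hV : Var[U; μ] ≤ V) {A : Set Ω} (hA : ∀ ω ∈ A, c ≤ |U ω - ∫ x, U x ∂μ|) :
    μ.real A ≤ V / c ^ 2 := by
  have h1 := meas_ge_le_variance_div_sq hU hc
  have h2 : μ A ≤ ENNReal.ofReal (Var[U; μ] / c ^ 2) := (measure_mono hA).trans h1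
  have h3 := ENNReal.toReal_mono ENNReal.ofReal_ne_top h2
  rw [ENNReal.toReal_ofReal (div_nonneg (variance_nonneg _ _) (sq_nonneg _))] at h3
  exact h3.trans (div_le_div_of_nonneg_right hV (sq_nonneg c))

end Chebyshev

/-- With y = n p and y + δ = n q the left side bounds the variance of the bilinear statistic under
q. The hypotheses give w_j y_j ≤ s and w_j δ_j ≤ √(M D) with D = Σ w δ², which removes one factor
from the cubic sum. -/
theorem bilinear_variance_bound {ι : Type*} [Fintype ι] {w y δ : ι → ℝ} {s M : ℝ}
    (hw : ∀ j, 0 ≤ w j) (hwM : ∀ j, w j ≤ M) (hM : 0 ≤ M) (hs : 0 ≤ s)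
    (hws : ∑ j, w j ^ 2 * y j ^ 2 ≤ s ^ 2) :
    ∑ j, w j ^ 2 * (y j + δ j) ^ 2 + 2 * ∑ j, w j ^ 2 * δ j ^ 2 * (y j + δ j) ≤
      2 * s ^ 2 + 2 * M * (∑ j, w j * δ j ^ 2) +
        2 * (∑ j, w j * δ j ^ 2) * (s + √(M * ∑ j, w j * δ j ^ 2)) := by
  set D := ∑ j, w j * δ j ^ 2 with hD
  have hDj : ∀ j, w j * δ j ^ 2 ≤ D := fun j =>
    Finset.single_le_sum (f := fun j => w j * δ j ^ 2)
      (fun i _ => mul_nonneg (hw i) (sq_nonneg _)) (Finset.mem_univ j)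
  have hwy : ∀ j, w j * y j ≤ s := fun j => by
    refine abs_le_of_sq_le_sq' ?_ hs |>.2
    refine le_trans ?_ hws
    rw [mul_pow]
    exact Finset.single_le_sum (f := fun j => w j ^ 2 * y j ^ 2)
      (fun i _ => by positivity) (Finset.mem_univ j)
  have hwδ : ∀ j, w j * δ j ≤ √(M * D) := fun j => by
    refine Real.le_sqrt_of_sq_le ?_
    have : (w j * δ j) ^ 2 = w j * (w j * δ j ^ 2) := by ring
    rw [this]
    exact mul_le_mul (hwM j) (hDj j) (mul_nonneg (hw j) (sq_nonneg _)) hM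
  have h1 : ∑ j, w j ^ 2 * (y j + δ j) ^ 2 ≤ 2 * s ^ 2 + 2 * M * D := by
    have : ∑ j, w j ^ 2 * (y j + δ j) ^ 2 ≤
        ∑ j, (2 * (w j ^ 2 * y j ^ 2) + 2 * M * (w j * δ j ^ 2)) := by
      refine Finset.sum_le_sum fun j _ => ?_
      have h3 : w j * (w j * δ j ^ 2) ≤ M * (w j * δ j ^ 2) :=
        mul_le_mul_of_nonneg_right (hwM j) (mul_nonneg (hw j) (sq_nonneg _))
      nlinarith [mul_nonneg (sq_nonneg (w j)) (sq_nonneg (y j - δ j))]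
    rw [Finset.sum_add_distrib, ← Finset.mul_sum, ← Finset.mul_sum] at this
    linarith
  have h2 : ∑ j, w j ^ 2 * δ j ^ 2 * (y j + δ j) ≤ D * (s + √(M * D)) := by
    rw [hD, Finset.sum_mul]
    refine Finset.sum_le_sum fun j _ => ?_
    have h3 : w j ^ 2 * δ j ^ 2 * (y j + δ j) =
      (w j * δ j ^ 2) * (w j * y j + w j * δ j) := by ring
    rw [h3]
    exact mul_le_mul_of_nonneg_left (add_le_add (hwy j) (hwδ j))
      (mul_nonneg (hw j) (sq_nonneg _))
  linarith

/-- Each term is of order D²/c as soon as D exceeds c² times both the null standard deviation bound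
s and the largest weight M; the square c² is what makes √(M D) ≤ D/c. -/
theorem variance_bound_le_div {s M D c : ℝ} (hc1 : 1 ≤ c) (hs : 0 ≤ s)
    (hDpos : 0 < D) (hsD : c ^ 2 * s ≤ D) (hMD : c ^ 2 * M ≤ D) :
    2 * s ^ 2 + 2 * M * D + 2 * D * (s + √(M * D)) ≤ 8 * D ^ 2 / c := by
  have hcpos : 0 < c := by linarith
  have hsqrt : √(M * D) ≤ D / c := by
    rw [Real.sqrt_le_left (by positivity), div_pow, le_div_iff₀ (by positivity)]
    nlinarith
  have hs' : s ≤ D / c ^ 2 := by rw [le_div_iff₀ (by positivity)]; linarith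
  have hM' : M ≤ D / c ^ 2 := by rw [le_div_iff₀ (by positivity)]; linarith
  have hcc : D / c ^ 2 ≤ D / c := by
    apply div_le_div_of_nonneg_left hDpos.le hcpos; nlinarith
  have hDc : D / c ≤ D := div_le_self hDpos.le (by linarith)
  have hs2 : s ^ 2 ≤ D * (D / c) := by
    rw [sq]; exact mul_le_mul (by linarith) (by linarith) hs hDpos.le
  have h8 : 8 * D ^ 2 / c = 8 * (D * (D / c)) := by ring
  rw [h8]
  have h9 : M * D ≤ (D / c) * D := mul_le_mul_of_nonneg_right (by linarith) hDpos.le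
  have h10 : D * (s + √(M * D)) ≤ D * (D / c + D / c) :=
    mul_le_mul_of_nonneg_left (by linarith) hDpos.le
  nlinarith

section Tests

variable {E : Type*} [MeasurableSpace E] [Countable E] [MeasurableSingletonClass E]
  {N n : ℕ} {ν : (Fin N → ℝ) → Measure E} {Θ : Set (Fin N → ℝ)} {X : E → Fin N → ℕ}

theorem exists_disjoint_halves {n : ℕ} (hn : 2 ≤ n) : ∃ (s t : Finset (Fin n)) (m : ℕ),
    Disjoint s t ∧ s.card = m ∧ t.card = m ∧ n ≤ 3 * m ∧ m ≤ n := by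
  obtain ⟨s, _, hs⟩ := Finset.exists_subset_card_eq (s := (Finset.univ : Finset (Fin n)))
    (n := n / 2) (by simp; omega)
  obtain ⟨t, ht, ht'⟩ := Finset.exists_subset_card_eq (s := sᶜ) (n := n / 2)
    (by rw [Finset.card_compl, hs]; simp; omega)
  refine ⟨s, t, n / 2, ?_, hs, ht', by omega, by omega⟩
  exact Finset.disjoint_left.2 fun a ha hb => (Finset.mem_compl.1 (ht hb)) ha

/-- A test of level `α` with power `1 - α` as soon as the weighted squared distance is large. -/
theorem CountModel.bilinear_test (hM : CountModel ν Θ X) (hn : 2 ≤ n) {α : ℝ} (hα : 0 < α)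
    (hα1 : α < 1) {p : Fin N → ℝ} (hp : p ∈ Θ) {w : Fin N → ℝ} {s M : ℝ}
    (hw : ∀ j, 0 ≤ w j) (hwM : ∀ j, w j ≤ M) (hM0 : 0 ≤ M) (hs : 0 < s)
    (hws : ∑ j, w j ^ 2 * (n * p j) ^ 2 ≤ s ^ 2) :
    ∃ A : Set (Fin n → E), (Measure.pi fun _ => ν p).real A ≤ α ∧
      ∀ q ∈ Θ, (2592 / α) ^ 2 * max s M ≤ ∑ j, w j * (n * (q j - p j)) ^ 2 →
        (Measure.pi fun _ => ν q).real Aᶜ ≤ α := by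
  obtain ⟨a, b, m, hab, ha, hb, hm3, hmn⟩ := exists_disjoint_halves hn
  have hm3' : (n : ℝ) ≤ 3 * m := by exact_mod_cast hm3
  have hmn' : (m : ℝ) ≤ n := by exact_mod_cast hmn
  have hm0 : (0 : ℝ) ≤ m := Nat.cast_nonneg m
  have hsα : 0 < √α := Real.sqrt_pos.2 hα
  have hsα2 : √α ^ 2 = α := Real.sq_sqrt hα.le
  refine ⟨{ω | s / √α ≤ bilinearStat X a b p w ω}, ?_, fun q hq hD => ?_⟩
  · have := hM.prob p hp
    obtain ⟨h1, h2, h3⟩ := hM.bilinearStat_moments hp hab ha hb p w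
    simp only [sub_self, ne_eq, OfNat.ofNat_ne_zero, not_false_eq_true, zero_pow, mul_zero,
      zero_mul, Finset.sum_const_zero, add_zero] at h2 h3
    have hV : Var[bilinearStat X a b p w; Measure.pi fun _ => ν p] ≤ s ^ 2 := by
      refine h3.trans (le_trans ?_ hws)
      rw [Finset.mul_sum]
      refine Finset.sum_le_sum fun j _ => ?_
      have : (m : ℝ) ^ 2 ≤ n ^ 2 := pow_le_pow_left₀ hm0 hmn' 2
      have h4 : 0 ≤ w j ^ 2 * p j ^ 2 := by positivity
      nlinarith
    refine (measureReal_le_variance_div_sq h1 (div_pos hs hsα) hV fun ω hω => ?_).trans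
      (le_of_eq ?_)
    · rw [h2, sub_zero]; exact le_trans hω (le_abs_self _)
    · rw [div_pow, hsα2]; field_simp
  · have := hM.prob q hq
    obtain ⟨h1, h2, h3⟩ := hM.bilinearStat_moments hq hab ha hb p w
    set D := ∑ j, w j * (n * (q j - p j)) ^ 2 with hDdef
    -- 2592 = 8 · 18²: a variance of at most 8 D²/c against a deviation D/18 leaves error α.
    set c : ℝ := 2592 / α with hc
    have hc1 : 2592 ≤ c := by rw [hc, le_div_iff₀ hα]; nlinarith
    have hsD : c ^ 2 * s ≤ D := le_trans (by gcongr; exact le_max_left _ _) hD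
    have hMD : c ^ 2 * M ≤ D := le_trans (by gcongr; exact le_max_right _ _) hD
    have hDpos : 0 < D := lt_of_lt_of_le (by positivity) hsD
    -- The groups have size m ≥ n/3, which costs a factor 9 in the mean.
    have hE : D / 9 ≤ ∫ ω, bilinearStat X a b p w ω ∂(Measure.pi fun _ => ν q) := by
      rw [h2, hDdef, Finset.sum_div, Finset.mul_sum]
      refine Finset.sum_le_sum fun j _ => ?_
      have : (n : ℝ) ^ 2 ≤ (3 * m) ^ 2 := pow_le_pow_left₀ (Nat.cast_nonneg n) hm3' 2
      have h4 : 0 ≤ w j * (q j - p j) ^ 2 := mul_nonneg (hw j) (sq_nonneg _)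
      nlinarith
    have hnn : ∀ j, 0 ≤ q j := hM.nonneg q hq
    have hV : Var[bilinearStat X a b p w; Measure.pi fun _ => ν q] ≤ 8 * D ^ 2 / c := by
      have hb := bilinear_variance_bound (δ := fun j => n * (q j - p j)) hw hwM hM0 hs.le hws
      rw [← hDdef] at hb
      have hle : (m : ℝ) ^ 2 * ∑ j, w j ^ 2 * q j ^ 2 +
          2 * (m : ℝ) ^ 3 * ∑ j, w j ^ 2 * (q j - p j) ^ 2 * q j ≤
          ∑ j, w j ^ 2 * (n * p j + n * (q j - p j)) ^ 2 +
          2 * ∑ j, w j ^ 2 * (n * (q j - p j)) ^ 2 * (n * p j + n * (q j - p j)) := by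
        rw [mul_assoc]
        refine add_le_add ?_ (mul_le_mul_of_nonneg_left ?_ zero_le_two)
        · rw [Finset.mul_sum]
          refine Finset.sum_le_sum fun j _ => ?_
          have : (m : ℝ) ^ 2 ≤ n ^ 2 := pow_le_pow_left₀ hm0 hmn' 2
          have h4 : 0 ≤ w j ^ 2 * q j ^ 2 := by positivity
          refine (mul_le_mul_of_nonneg_right this h4).trans (le_of_eq (by ring))
        · rw [Finset.mul_sum]
          refine Finset.sum_le_sum fun j _ => ?_
          have : (m : ℝ) ^ 3 ≤ n ^ 3 := pow_le_pow_left₀ hm0 hmn' 3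
          have h4 : 0 ≤ w j ^ 2 * (q j - p j) ^ 2 * q j := mul_nonneg (by positivity) (hnn j)
          refine (mul_le_mul_of_nonneg_right this h4).trans (le_of_eq (by ring))
      refine (h3.trans hle).trans (hb.trans ?_)
      exact variance_bound_le_div (by linarith) hs.le hDpos hsD hMD
    refine (measureReal_le_variance_div_sq h1 (c := D / 18) (by positivity) hV
      fun ω hω => ?_).trans (le_of_eq ?_)
    · have hω' : bilinearStat X a b p w ω < s / √α := not_le.1 hω
      have hτ : s / √α ≤ D / 18 := by
        rw [div_le_iff₀ hsα]
        have h5 : α ≤ √α := Real.le_sqrt_of_sq_le (by nlinarith)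
        have h6 : c * α = 2592 := by rw [hc]; field_simp
        have h7 : 2592 * (c * s) ≤ D * α := by
          calc 2592 * (c * s) = c ^ 2 * s * α := by rw [← h6]; ring
            _ ≤ D * α := mul_le_mul_of_nonneg_right hsD hα.le
        have h8 : D * α ≤ D * √α := mul_le_mul_of_nonneg_left h5 hDpos.le
        have h9 : s ≤ c * s := le_mul_of_one_le_left hs.le (by linarith)
        linarith
      rw [abs_sub_comm]
      refine le_trans ?_ (le_abs_self _)
      linarith
    · rw [hc]; field_simp; norm_num

/-- A test based on the number of observations in a set of coordinates. -/
theorem CountModel.linear_test (hM : CountModel ν Θ X) {α : ℝ} (hα : 0 < α)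
    (hα1 : α < 1) {p : Fin N → ℝ} (hp : p ∈ Θ) (S : Finset (Fin N)) :
    ∃ A : Set (Fin n → E), (Measure.pi fun _ => ν p).real A ≤ α ∧
      ∀ q ∈ Θ, 9 / α * max (∑ j ∈ S, n * p j) 1 ≤ ∑ j ∈ S, n * q j →
        (Measure.pi fun _ => ν q).real Aᶜ ≤ α := by
  classical
  set v : Fin N → ℝ := fun j => if j ∈ S then 1 else 0 with hv
  have hsum : ∀ q : Fin N → ℝ, (n : ℝ) * ∑ j, v j * q j = ∑ j ∈ S, n * q j := by
    intro q; simp [hv, Finset.mul_sum]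
  have hsum2 : ∀ q : Fin N → ℝ, (n : ℝ) * ∑ j, v j ^ 2 * q j = ∑ j ∈ S, n * q j := by
    intro q; simp [hv, Finset.mul_sum]
  have hmom := fun q (hq : q ∈ Θ) =>
    hM.linear_moments hq (Finset.univ : Finset (Fin n)) (0 : Fin N → ℝ) v
  simp only [Finset.card_univ, Fintype.card_fin, Pi.zero_apply, sub_zero, hsum, hsum2] at hmom
  set U : (Fin n → E) → ℝ := fun ω => ∑ j, v j * ∑ i, (X (ω i) j : ℝ) with hU
  set T := ∑ j ∈ S, n * p j with hT
  have hT0 : 0 ≤ T := Finset.sum_nonneg fun j _ =>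
    mul_nonneg (Nat.cast_nonneg n) (hM.nonneg p hp j)
  have hK : 3 ≤ 3 / α := by rw [le_div_iff₀ hα]; nlinarith
  have hm1 : 1 ≤ max T 1 := le_max_right _ _
  have hmT : T ≤ max T 1 := le_max_left _ _
  set K := 3 / α with hKd
  -- Variances are at most the means. Under the null, the error is at most T / (K max(T,1))² ≤ α; a
  -- mean Λ ≥ 3 K max(T,1) exceeds the threshold by Λ/3, with error at most 9/Λ ≤ α.
  refine ⟨{ω | T + K * max T 1 ≤ U ω}, ?_, fun q hq hL => ?_⟩
  · have := hM.prob p hp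
    obtain ⟨h1, h2, h3⟩ := hmom p hp
    refine (measureReal_le_variance_div_sq h1 (c := K * max T 1) (by positivity) h3
      fun ω hω => ?_).trans ?_
    · rw [h2]
      refine le_trans ?_ (le_abs_self _)
      have : T + K * max T 1 ≤ U ω := hω
      change _ ≤ U ω - T
      linarith
    · rw [div_le_iff₀ (by positivity)]
      have h4 : α * K = 3 := by rw [hKd]; field_simp
      have : α * (K * max T 1) ^ 2 = 3 * K * (max T 1 * max T 1) := by
        rw [← h4]; ring
      rw [this]
      nlinarith
  · have := hM.prob q hq
    obtain ⟨h1, h2, h3⟩ := hmom q hq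
    set Λ := ∑ j ∈ S, n * q j with hΛ
    have h9 : 9 / α = 3 * K := by rw [hKd]; ring
    rw [h9] at hL
    have hΛpos : 0 < Λ := lt_of_lt_of_le (by positivity) hL
    refine (measureReal_le_variance_div_sq h1 (c := Λ / 3) (by positivity) h3
      fun ω hω => ?_).trans ?_
    · rw [h2, abs_sub_comm]
      refine le_trans ?_ (le_abs_self _)
      have : U ω < T + K * max T 1 := not_le.1 hω
      change _ ≤ Λ - U ω
      nlinarith
    · rw [div_le_iff₀ (by positivity)]
      have h4 : α * K = 3 := by rw [hKd]; field_simp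
      have h5 : 3 * K ≤ Λ := le_trans (by nlinarith) hL
      have h6 : 9 ≤ α * Λ := by nlinarith
      nlinarith

/-- Combination of three tests, one of which detects each alternative. -/
theorem minimaxRisk_le_of_tests {Ω : Type*} [MeasurableSpace Ω] [DiscreteMeasurableSpace Ω]
    {P : (Fin N → ℝ) → Measure Ω} {Θ : Set (Fin N → ℝ)} {d : (Fin N → ℝ) → ℝ} {p : Fin N → ℝ}
    {η ρ : ℝ} (hη : 0 < η) (hP : ∀ q ∈ Θ, IsProbabilityMeasure (P q)) (hp : p ∈ Θ)
    (A : Fin 3 → Set Ω) (hA : ∀ k, (P p).real (A k) ≤ η / 4)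
    (hq : ∀ q ∈ Θ, ρ ≤ d (p - q) → ∃ k, (P q).real (A k)ᶜ ≤ η / 4) :
    minimaxRisk P Θ d p ρ ≤ ENNReal.ofReal η := by
  classical
  refine (iInf₂_le (fun ω => if ∃ k, ω ∈ A k then (1 : Fin 2) else 0)
    (by exact Measurable.of_discrete)).trans ?_
  have e1 : {ω | (if ∃ k, ω ∈ A k then (1 : Fin 2) else 0) = 1} = ⋃ k, A k := by
    ext ω; simp [Set.mem_iUnion]
  have e0 : {ω | (if ∃ k, ω ∈ A k then (1 : Fin 2) else 0) = 0} = (⋃ k, A k)ᶜ := by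
    ext ω; simp
  unfold risk
  rw [e1, e0]
  -- Rejecting when any test rejects costs three type-I errors; the type-II error is that of the one
  -- test which detects q.
  have h34 : η = 3 * (η / 4) + η / 4 := by ring
  rw [h34, ENNReal.ofReal_add (by positivity) (by positivity)]
  refine add_le_add ?_ (iSup₂_le fun q hq' => ?_)
  · have := hP p hp
    rw [← ofReal_measureReal]
    refine ENNReal.ofReal_le_ofReal ((measureReal_iUnion_fintype_le _).trans ?_)
    refine (Finset.sum_le_sum fun k _ => hA k).trans (le_of_eq ?_)
    simp
  · have := hP q hq'.1
    obtain ⟨k, hk⟩ := hq q hq'.1 hq'.2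
    rw [← ofReal_measureReal]
    refine ENNReal.ofReal_le_ofReal (le_trans (measureReal_mono ?_) hk)
    exact Set.compl_subset_compl.2 (Set.subset_iUnion A k)

end Tests

/-! ### Hölder inequalities and detection on tail and bulk -/

section Analysis

variable {ι : Type*}

/-- Hölder with exponents 1/a and 1/b. The endpoints a = 0 and b = 0 are included because t = 1 and
t = 2 lead to them. -/
theorem sum_rpow_mul_rpow_le (s : Finset ι) {f g : ι → ℝ} (hf : ∀ i ∈ s, 0 ≤ f i)
    (hg : ∀ i ∈ s, 0 ≤ g i) {a b : ℝ} (ha : 0 ≤ a) (hb : 0 ≤ b) (hab : a + b = 1) :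
    ∑ i ∈ s, f i ^ a * g i ^ b ≤ (∑ i ∈ s, f i) ^ a * (∑ i ∈ s, g i) ^ b := by
  rcases ha.eq_or_lt with rfl | ha
  · obtain rfl : b = 1 := by linarith
    simp
  rcases hb.eq_or_lt with rfl | hb
  · obtain rfl : a = 1 := by linarith
    simp
  have hpq : (a⁻¹).HolderConjugate b⁻¹ := by
    rw [Real.holderConjugate_iff]
    exact ⟨(one_lt_inv₀ ha).2 (by linarith), by simpa using hab⟩
  have := Real.inner_le_Lp_mul_Lq_of_nonneg s hpq (f := fun i => f i ^ a) (g := fun i => g i ^ b)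
    (fun i hi => Real.rpow_nonneg (hf i hi) _) (fun i hi => Real.rpow_nonneg (hg i hi) _)
  simp only [one_div, inv_inv] at this
  refine this.trans (le_of_eq ?_)
  congr 2
  · exact Finset.sum_congr rfl fun i hi => Real.rpow_rpow_inv (hf i hi) ha.ne'
  · exact Finset.sum_congr rfl fun i hi => Real.rpow_rpow_inv (hg i hi) hb.ne'

theorem max_one_rpow_le {T x : ℝ} (hT : 0 ≤ T) : max T 1 ^ x ≤ T ^ x + 1 := by
  rcases le_total T 1 with h | h
  · rw [max_eq_right h, Real.one_rpow]
    linarith [Real.rpow_nonneg hT x]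
  · rw [max_eq_left h]; linarith

/-- Interpolation between ℓ¹ and ℓ², from |δ|^t = |δ|^(2-t) (δ²)^(t-1). -/
theorem sum_abs_rpow_le (s : Finset ι) (δ : ι → ℝ) {t : ℝ} (ht1 : 1 ≤ t) (ht2 : t ≤ 2) :
    ∑ j ∈ s, |δ j| ^ t ≤ (∑ j ∈ s, |δ j|) ^ (2 - t) * (∑ j ∈ s, δ j ^ 2) ^ (t - 1) := by
  have := sum_rpow_mul_rpow_le s (f := fun j => |δ j|) (g := fun j => δ j ^ 2)
    (fun j _ => abs_nonneg _) (fun j _ => sq_nonneg _) (a := 2 - t) (b := t - 1)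
    (by linarith) (by linarith) (by ring)
  refine le_trans (le_of_eq (Finset.sum_congr rfl fun j _ => ?_)) this
  rw [← sq_abs, ← Real.rpow_natCast, ← Real.rpow_mul (abs_nonneg _),
    ← Real.rpow_add_of_nonneg (abs_nonneg _) (by linarith) (by push_cast; linarith)]
  congr 1; push_cast; ring

/-- Dichotomy for the tail: a large `t`-norm forces a large Euclidean norm or a large mass. -/
theorem tail_dichotomy (s : Finset ι) {y δ : ι → ℝ} (hy : ∀ j, 0 ≤ y j)
    (hyδ : ∀ j, 0 ≤ y j + δ j) {t C K : ℝ} (ht1 : 1 ≤ t) (ht2 : t ≤ 2) (hC : 1 ≤ C) (hK : 1 ≤ K)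
    (h : 2 * (√C * (K + 1)) * ((∑ j ∈ s, y j) ^ ((2 - t) / t) + 1) ≤
      (∑ j ∈ s, |δ j| ^ t) ^ (1 / t)) :
    C ≤ ∑ j ∈ s, δ j ^ 2 ∨ K * max (∑ j ∈ s, y j) 1 ≤ ∑ j ∈ s, (y j + δ j) := by
  by_contra! hcon
  obtain ⟨h1, h2⟩ := hcon
  set T := ∑ j ∈ s, y j with hT
  have hT0 : 0 ≤ T := Finset.sum_nonneg fun j _ => hy j
  have ht0 : 0 < t := by linarith
  have hm : 1 ≤ max T 1 := le_max_right _ _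
  -- As y and y + δ are nonnegative, |δ| ≤ (y + δ) + y, so bounded masses bound the ℓ¹ norm.
  have habs : ∑ j ∈ s, |δ j| ≤ (K + 1) * max T 1 := by
    have h3 : ∑ j ∈ s, |δ j| ≤ ∑ j ∈ s, ((y j + δ j) + y j) := by
      refine Finset.sum_le_sum fun j _ => ?_
      rw [abs_le]; constructor <;> linarith [hy j, hyδ j]
    rw [Finset.sum_add_distrib] at h3
    linarith [le_max_left T 1]
  have hF0 : 0 ≤ ∑ j ∈ s, δ j ^ 2 := Finset.sum_nonneg fun j _ => sq_nonneg _
  have hA0 : 0 ≤ ∑ j ∈ s, |δ j| := Finset.sum_nonneg fun j _ => abs_nonneg _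
  have hbound : (∑ j ∈ s, |δ j| ^ t) ^ (1 / t) ≤ √C * (K + 1) * (T ^ ((2 - t) / t) + 1) := by
    calc (∑ j ∈ s, |δ j| ^ t) ^ (1 / t)
        ≤ (((K + 1) * max T 1) ^ (2 - t) * C ^ (t - 1)) ^ (1 / t) := by
          refine Real.rpow_le_rpow (Finset.sum_nonneg fun j _ => by positivity)
            ((sum_abs_rpow_le s δ ht1 ht2).trans ?_) (by positivity)
          exact mul_le_mul (Real.rpow_le_rpow hA0 habs (by linarith))
            (Real.rpow_le_rpow hF0 h1.le (by linarith)) (by positivity) (by positivity)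
      _ = (K + 1) ^ ((2 - t) / t) * max T 1 ^ ((2 - t) / t) * C ^ ((t - 1) / t) := by
          rw [Real.mul_rpow (by positivity) (by positivity), ← Real.rpow_mul (by positivity),
            ← Real.rpow_mul (by positivity), Real.mul_rpow (by positivity) (by positivity)]
          simp only [mul_one_div]
      _ ≤ (K + 1) * (T ^ ((2 - t) / t) + 1) * √C := by
          have e1 : (2 - t) / t ≤ 1 := by rw [div_le_one ht0]; linarith
          have e2 : (t - 1) / t ≤ 1 / 2 := by rw [div_le_div_iff₀ ht0 two_pos]; linarith
          have i1 : (K + 1) ^ ((2 - t) / t) ≤ K + 1 := by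
            simpa using Real.rpow_le_rpow_of_exponent_le (by linarith : 1 ≤ K + 1) e1
          have i2 : C ^ ((t - 1) / t) ≤ √C := by
            rw [Real.sqrt_eq_rpow]; exact Real.rpow_le_rpow_of_exponent_le hC e2
          have i3 := max_one_rpow_le (x := (2 - t) / t) hT0
          have : 0 ≤ max T 1 ^ ((2 - t) / t) := by positivity
          gcongr
      _ = _ := by ring
  have hpos : 0 < √C * (K + 1) * (T ^ ((2 - t) / t) + 1) := by
    have : 0 < √C := Real.sqrt_pos.2 (by linarith)
    positivity
  linarith

/-- The weighted squared distance controls the `t`-norm on the bulk. -/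
theorem sum_abs_rpow_le_weighted (s : Finset ι) {y δ : ι → ℝ} (hy : ∀ j ∈ s, 0 < y j) {t : ℝ}
    (ht1 : 1 ≤ t) (ht2 : t ≤ 2) :
    ((∑ j ∈ s, |δ j| ^ t) ^ (1 / t)) ^ 2 ≤
      (∑ j ∈ s, y j ^ (-(2 * (2 - t) / (4 - t))) * δ j ^ 2) *
        (∑ j ∈ s, y j ^ (2 * t / (4 - t))) ^ ((2 - t) / t) := by
  have ht0 : 0 < t := by linarith
  have h4 : 0 < 4 - t := by linarith
  have hw : ∀ j ∈ s, 0 ≤ y j ^ (-(2 * (2 - t) / (4 - t))) * δ j ^ 2 := fun j hj =>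
    mul_nonneg (Real.rpow_nonneg (hy j hj).le _) (sq_nonneg _)
  have hr : ∀ j ∈ s, 0 ≤ y j ^ (2 * t / (4 - t)) := fun j hj => Real.rpow_nonneg (hy j hj).le _
  -- With these exponents the powers of y in the weight and in y^r cancel, leaving |δ|^t.
  have h := sum_rpow_mul_rpow_le s hw hr (a := t / 2) (b := (2 - t) / 2)
    (by linarith) (by linarith) (by ring)
  have h' : ∑ j ∈ s, |δ j| ^ t ≤ _ := le_trans (le_of_eq (Finset.sum_congr rfl fun j hj => ?_)) h
  · rw [← Real.rpow_natCast, ← Real.rpow_mul (Finset.sum_nonneg fun j _ => by positivity)]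
    have hS1 := Finset.sum_nonneg hw
    have hS2 := Finset.sum_nonneg hr
    refine (Real.rpow_le_rpow (Finset.sum_nonneg fun j _ => by positivity) h'
      (by positivity)).trans (le_of_eq ?_)
    rw [Real.mul_rpow (by positivity) (by positivity), ← Real.rpow_mul hS1, ← Real.rpow_mul hS2]
    have e1 : t / 2 * (1 / t * ((2 : ℕ) : ℝ)) = 1 := by push_cast; field_simp
    have e2 : (2 - t) / 2 * (1 / t * ((2 : ℕ) : ℝ)) = (2 - t) / t := by push_cast; field_simp
    rw [e1, e2, Real.rpow_one]
  · have hyj := hy j hj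
    rw [Real.mul_rpow (by positivity) (sq_nonneg _), ← Real.rpow_mul hyj.le,
      ← Real.rpow_mul hyj.le, ← sq_abs, ← Real.rpow_natCast, ← Real.rpow_mul (abs_nonneg _)]
    have e1 : ((2 : ℕ) : ℝ) * (t / 2) = t := by push_cast; ring
    rw [e1, mul_right_comm, ← Real.rpow_add hyj]
    have e2 : -(2 * (2 - t) / (4 - t)) * (t / 2) + 2 * t / (4 - t) * ((2 - t) / 2) = 0 := by
      field_simp; ring
    rw [e2, Real.rpow_zero, one_mul]

/-- On the bulk, a large `t`-norm forces a large weighted squared distance. -/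
theorem bulk_detection (s : Finset ι) (hs : s.Nonempty) {y δ : ι → ℝ} {u T cI C C₂ t : ℝ}
    (hu : 0 < u) (hyu : ∀ j ∈ s, u ≤ y j) (hT : 0 ≤ T) (hcI : 0 < cI) (hcI1 : cI ≤ 1)
    (huT : cI ≤ u * (u + T)) (ht1 : 1 ≤ t) (ht2 : t ≤ 2) (hC : 0 ≤ C)
    (hC₂0 : 0 ≤ C₂) (hC₂ : C ≤ C₂ ^ 2 * (cI / 2))
    (h : C₂ * ((∑ j ∈ s, y j ^ (2 * t / (4 - t))) ^ ((4 - t) / (4 * t)) + T ^ ((2 - t) / t) + 1) ≤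
      (∑ j ∈ s, |δ j| ^ t) ^ (1 / t)) :
    C * max (√(∑ j ∈ s, y j ^ (2 * t / (4 - t)))) (u ^ (-(2 * (2 - t) / (4 - t)))) ≤
      ∑ j ∈ s, y j ^ (-(2 * (2 - t) / (4 - t))) * δ j ^ 2 := by
  have ht0 : 0 < t := by linarith
  have h4 : 0 < 4 - t := by linarith
  have hmain := sum_abs_rpow_le_weighted s (δ := δ) (fun j hj => hu.trans_le (hyu j hj)) ht1 ht2
  set S := ∑ j ∈ s, y j ^ (2 * t / (4 - t)) with hSd
  set D := ∑ j ∈ s, y j ^ (-(2 * (2 - t) / (4 - t))) * δ j ^ 2 with hDd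
  set L := (∑ j ∈ s, |δ j| ^ t) ^ (1 / t) with hLd
  set e := (2 - t) / t with he
  have he0 : 0 ≤ e := div_nonneg (by linarith) ht0.le
  have he1 : e ≤ 1 := by rw [he, div_le_one ht0]; linarith
  have hSu : u ^ (2 * t / (4 - t)) ≤ S := by
    obtain ⟨j, hj⟩ := hs
    refine (Real.rpow_le_rpow hu.le (hyu j hj) (by positivity)).trans ?_
    exact Finset.single_le_sum (f := fun j => y j ^ (2 * t / (4 - t)))
      (fun i hi => Real.rpow_nonneg (hu.le.trans (hyu i hi)) _) hj
  have hSpos : 0 < S := lt_of_lt_of_le (Real.rpow_pos_of_pos hu _) hSu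
  have hSe : 0 < S ^ e := Real.rpow_pos_of_pos hSpos _
  have hTe : 0 ≤ T ^ e := Real.rpow_nonneg hT _
  have hSg : 0 < S ^ ((4 - t) / (4 * t)) := Real.rpow_pos_of_pos hSpos _
  -- The bulk part of `h`, squared, is C₂² √S S^e, while the weighted Hölder inequality bounds it by
  -- D S^e.
  have h1 : C₂ ^ 2 * √S ≤ D := by
    have hL : C₂ * S ^ ((4 - t) / (4 * t)) ≤ L :=
      le_trans (mul_le_mul_of_nonneg_left (by linarith) hC₂0) h
    have hL2 : (C₂ * S ^ ((4 - t) / (4 * t))) ^ 2 ≤ L ^ 2 :=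
      pow_le_pow_left₀ (by positivity) hL 2
    have hsq : (S ^ ((4 - t) / (4 * t))) ^ 2 = √S * S ^ e := by
      rw [← Real.rpow_natCast, ← Real.rpow_mul hSpos.le, Real.sqrt_eq_rpow,
        ← Real.rpow_add hSpos, he]
      congr 1; push_cast; field_simp; ring
    rw [mul_pow, hsq, ← mul_assoc] at hL2
    exact le_of_mul_le_mul_right (hL2.trans hmain) hSe
  have hc2 : 0 < cI / 2 := by linarith
  have hc21 : cI / 2 ≤ 1 := by linarith
  rw [mul_max_of_nonneg _ _ hC]
  refine max_le (le_trans ?_ h1) ?_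
  · have : C ≤ C₂ ^ 2 := hC₂.trans (mul_le_of_le_one_right (sq_nonneg _) hc21)
    exact mul_le_mul_of_nonneg_right this (Real.sqrt_nonneg _)
  set b := 2 * (2 - t) / (4 - t) with hb
  have hub : 0 < u ^ (-b) := Real.rpow_pos_of_pos hu _
  refine (mul_le_mul_of_nonneg_right hC₂ hub.le).trans ?_
  rw [mul_assoc]
  -- Either √S dominates the largest weight u^(-b) up to a constant, or u² ≤ S u^(2b) ≤ cI/2. In the
  -- latter case `huT` leaves u T ≥ cI/2, and the tail term in `h` makes L large enough.
  rcases le_total (cI / 2) (S * u ^ (2 * b)) with hcase | hcase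
  · refine le_trans (mul_le_mul_of_nonneg_left ?_ (sq_nonneg _)) h1
    have h5 : cI / 2 * u ^ (-b) ≤ √S := by
      refine Real.le_sqrt_of_sq_le ?_
      have h6 : (u ^ (-b)) ^ 2 * u ^ (2 * b) = 1 := by
        rw [← Real.rpow_natCast, ← Real.rpow_mul hu.le, ← Real.rpow_add hu]
        have : -b * ((2 : ℕ) : ℝ) + 2 * b = 0 := by push_cast; ring
        rw [this, Real.rpow_zero]
      have h7 : (cI / 2) ^ 2 ≤ cI / 2 := by nlinarith
      calc (cI / 2 * u ^ (-b)) ^ 2 = (cI / 2) ^ 2 * (u ^ (-b)) ^ 2 := by ring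
        _ ≤ (S * u ^ (2 * b)) * (u ^ (-b)) ^ 2 :=
          mul_le_mul_of_nonneg_right (h7.trans hcase) (sq_nonneg _)
        _ = S * ((u ^ (-b)) ^ 2 * u ^ (2 * b)) := by ring
        _ = S := by rw [h6, mul_one]
    exact h5
  · have hu2 : u ^ 2 ≤ cI / 2 := by
      refine le_trans ?_ hcase
      calc u ^ 2 = u ^ (2 * t / (4 - t)) * u ^ (2 * b) := by
            rw [← Real.rpow_add hu, ← Real.rpow_natCast, hb]
            congr 1; push_cast; field_simp; ring
        _ ≤ S * u ^ (2 * b) := mul_le_mul_of_nonneg_right hSu (Real.rpow_nonneg hu.le _)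
    have hTu : cI / 2 / u ≤ T := by rw [div_le_iff₀ hu]; nlinarith
    have hL : C₂ * (cI / 2 / u) ^ e ≤ L := by
      refine le_trans (mul_le_mul_of_nonneg_left ?_ hC₂0) h
      have := Real.rpow_le_rpow (by positivity) hTu he0
      linarith
    have hL2 : (C₂ * (cI / 2 / u) ^ e) ^ 2 ≤ D * S ^ e :=
      (pow_le_pow_left₀ (by positivity) hL 2).trans hmain
    have hSle : S ≤ cI / 2 * u ^ (-(2 * b)) := by
      rw [Real.rpow_neg hu.le, ← div_eq_mul_inv, le_div_iff₀ (Real.rpow_pos_of_pos hu _)]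
      exact hcase
    have hSle' : S ^ e ≤ (cI / 2) ^ e * u ^ (-(2 * b) * e) := by
      rw [Real.rpow_mul hu.le, ← Real.mul_rpow hc2.le (Real.rpow_nonneg hu.le _)]
      exact Real.rpow_le_rpow hSpos.le hSle he0
    refine le_of_mul_le_mul_right (le_trans ?_ hL2) hSe
    refine (mul_le_mul_of_nonneg_left hSle' (by positivity)).trans ?_
    have hce : cI / 2 ≤ (cI / 2) ^ e := by
      simpa using Real.rpow_le_rpow_of_exponent_ge hc2 hc21 he1
    have hexp : u ^ (-b) * u ^ (-(2 * b) * e) = ((u ^ e) ^ 2)⁻¹ := by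
      rw [← Real.rpow_add hu, ← Real.rpow_natCast, ← Real.rpow_mul hu.le, ← Real.rpow_neg hu.le,
        hb, he]
      congr 1; push_cast; field_simp; ring
    calc C₂ ^ 2 * (cI / 2 * u ^ (-b)) * ((cI / 2) ^ e * u ^ (-(2 * b) * e))
        = C₂ ^ 2 * (cI / 2 * (cI / 2) ^ e) * (u ^ (-b) * u ^ (-(2 * b) * e)) := by ring
      _ ≤ C₂ ^ 2 * ((cI / 2) ^ e * (cI / 2) ^ e) * (u ^ (-b) * u ^ (-(2 * b) * e)) := by
          gcongr
      _ = (C₂ * (cI / 2 / u) ^ e) ^ 2 := by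
          rw [hexp, Real.div_rpow hc2.le hu.le]; field_simp

end Analysis

/-! ### The rate in rescaled coordinates -/

/-- The rate in terms of rescaled vectors. -/
theorem natCast_mul_rate {N n : ℕ} (hn : 0 < n) {t : ℝ} (ht1 : 1 ≤ t) (ht2 : t ≤ 2)
    (v w : Fin N → ℝ) :
    n * rate t n v w = (∑ j, (n * |v j|) ^ (2 * t / (4 - t))) ^ ((4 - t) / (4 * t)) +
      (∑ j, n * |w j|) ^ ((2 - t) / t) + 1 := by
  have hn' : (0 : ℝ) < n := by exact_mod_cast hn
  have ht0 : 0 < t := by linarith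
  have h4 : 0 < 4 - t := by linarith
  have hS : 0 ≤ ∑ j, |v j| ^ (2 * t / (4 - t)) := Finset.sum_nonneg fun j _ => by positivity
  have hW : 0 ≤ ∑ j, |w j| := Finset.sum_nonneg fun j _ => by positivity
  unfold rate lpNorm
  rw [mul_add, mul_add, mul_one_div_cancel hn'.ne']
  congr 2
  · have h1 : ∑ j, (n * |v j|) ^ (2 * t / (4 - t)) =
        (n : ℝ) ^ (2 * t / (4 - t)) * ∑ j, |v j| ^ (2 * t / (4 - t)) := by
      rw [Finset.mul_sum]
      exact Finset.sum_congr rfl fun j _ => Real.mul_rpow hn'.le (abs_nonneg _)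
    rw [h1, Real.mul_rpow (by positivity) hS, ← Real.rpow_mul hn'.le,
      Real.sqrt_div (by positivity), Real.sqrt_eq_rpow ((∑ j, _) ^ _), ← Real.rpow_mul hS]
    have e1 : 2 * t / (4 - t) * ((4 - t) / (4 * t)) = 1 / 2 := by field_simp; ring
    have e2 : 1 / (2 * t / (4 - t)) * (1 / 2) = (4 - t) / (4 * t) := by field_simp; ring
    rw [e1, e2, ← Real.sqrt_eq_rpow, mul_div_assoc', mul_comm, mul_div_assoc, mul_comm]
    congr 1
    rw [Real.div_sqrt]
  · rw [← Finset.mul_sum, Real.mul_rpow hn'.le hW]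
    simp only [Real.rpow_one, div_one]
    have e1 : (2 - t) / t = 1 - (2 * t - 2) / t := by field_simp; ring
    rw [e1, Real.rpow_sub hn', Real.rpow_one]
    ring

/-- The restriction of a vector to a set of coordinates, extended by zero. -/
def restrict {N : ℕ} (B : Finset (Fin N)) (p : Fin N → ℝ) : Fin N → ℝ :=
  fun j => if j ∈ B then p j else 0

theorem rpow_sum_smul {ι : Type*} (s : Finset ι) (δ : ι → ℝ) {t c : ℝ} (ht : 0 < t) (hc : 0 ≤ c) :
    (∑ j ∈ s, |c * δ j| ^ t) ^ (1 / t) = c * (∑ j ∈ s, |δ j| ^ t) ^ (1 / t) := by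
  have h : ∀ j, |c * δ j| ^ t = c ^ t * |δ j| ^ t := fun j => by
    rw [abs_mul, abs_of_nonneg hc, Real.mul_rpow hc (abs_nonneg _)]
  simp_rw [h, ← Finset.mul_sum]
  rw [Real.mul_rpow (by positivity) (Finset.sum_nonneg fun j _ => by positivity),
    ← Real.rpow_mul hc, mul_one_div_cancel ht.ne', Real.rpow_one]

theorem natCast_mul_rate_restrict {N n : ℕ} (hn : 0 < n) {t : ℝ} (ht1 : 1 ≤ t) (ht2 : t ≤ 2)
    {p : Fin N → ℝ} (hp : ∀ j, 0 ≤ p j) (B S : Finset (Fin N)) :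
    n * rate t n (restrict B p) (restrict S p) =
      (∑ j ∈ B, (n * p j) ^ (2 * t / (4 - t))) ^ ((4 - t) / (4 * t)) +
        (∑ j ∈ S, n * p j) ^ ((2 - t) / t) + 1 := by
  have hr : 2 * t / (4 - t) ≠ 0 := (div_pos (by linarith) (by linarith)).ne'
  rw [natCast_mul_rate hn ht1 ht2]
  congr 3
  · rw [← Finset.sum_subset (Finset.subset_univ B)]
    · exact Finset.sum_congr rfl fun j hj => by simp [restrict, hj, abs_of_nonneg (hp j)]
    · intro j _ hj; simp [restrict, hj, Real.zero_rpow hr]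
  · rw [← Finset.sum_subset (Finset.subset_univ S)]
    · exact Finset.sum_congr rfl fun j hj => by simp [restrict, hj, abs_of_nonneg (hp j)]
    · intro j _ hj; simp [restrict, hj]

/-! ### Upper bound for a general count model -/

section Upper

variable {E : Type*} [MeasurableSpace E] [Countable E] [MeasurableSingletonClass E]
  {N n : ℕ} {ν : (Fin N → ℝ) → Measure E} {Θ : Set (Fin N → ℝ)} {X : E → Fin N → ℕ}

/-- The constant of the upper bound on the separation radius. -/
noncomputable def upperConst (η cI : ℝ) : ℝ :=
  -- With α = η/4, the first summand is the C₂ of `bulk_detection` for C = (2592/α)², the constant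
  -- of `CountModel.bilinear_test`. The second is the constant of `tail_dichotomy` for the same C
  -- and K = 9/α.
  2 * (2592 / (η / 4) * √(2 / cI) + 2 * (2592 / (η / 4) * (9 / (η / 4) + 1)))

theorem upperConst_pos {η cI : ℝ} (hη : 0 < η) (hcI : 0 < cI) : 0 < upperConst η cI := by
  unfold upperConst; positivity

theorem CountModel.minimaxRisk_le (hM : CountModel ν Θ X) (hn : 2 ≤ n) {η cI t : ℝ} (hη : 0 < η)
    (hη1 : η < 1) (hcI : 0 < cI) (hcI1 : cI ≤ 1) (ht1 : 1 ≤ t) (ht2 : t ≤ 2)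
    {p : Fin N → ℝ} (hp : p ∈ Θ) (B S : Finset (Fin N)) {d : (Fin N → ℝ) → ℝ}
    (hd : ∀ x, d x ≤ (∑ j ∈ B, |x j| ^ t) ^ (1 / t) + (∑ j ∈ S, |x j| ^ t) ^ (1 / t))
    (hS : ∑ j ∈ S, (n * p j) ^ 2 ≤ cI)
    (hB : B.Nonempty → ∃ u, 0 < u ∧ (∀ j ∈ B, u ≤ n * p j) ∧ cI ≤ u * (u + ∑ j ∈ S, n * p j)) :
    minimaxRisk (fun q => Measure.pi fun _ : Fin n => ν q) Θ d p
      (upperConst η cI * rate t n (restrict B p) (restrict S p)) ≤ ENNReal.ofReal η := by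
  classical
  have hn0 : 0 < n := by omega
  have hnR : (0 : ℝ) < n := by exact_mod_cast hn0
  have ht0 : 0 < t := by linarith
  have h4t : 0 < 4 - t := by linarith
  have hnn := hM.nonneg p hp
  set α := η / 4 with hα
  have hα0 : 0 < α := by positivity
  have hα1 : α < 1 := by linarith
  set y : Fin N → ℝ := fun j => n * p j with hy
  have hy0 : ∀ j, 0 ≤ y j := fun j => mul_nonneg hnR.le (hnn j)
  set T := ∑ j ∈ S, y j with hT
  have hT0 : 0 ≤ T := Finset.sum_nonneg fun j _ => hy0 j
  have hC1 : (1 : ℝ) ≤ 2592 / α := by rw [le_div_iff₀ hα0]; linarith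
  have hK : (1 : ℝ) ≤ 9 / α := by rw [le_div_iff₀ hα0]; linarith
  have hrate := natCast_mul_rate_restrict hn0 ht1 ht2 hnn B S
  set R := (∑ j ∈ B, y j ^ (2 * t / (4 - t))) ^ ((4 - t) / (4 * t)) + T ^ ((2 - t) / t) + 1 with hR
  set C₂ := 2592 / α * √(2 / cI) with hC₂
  have hC₂0 : 0 < C₂ := by positivity
  have hbulk0 : 0 ≤ (∑ j ∈ B, y j ^ (2 * t / (4 - t))) ^ ((4 - t) / (4 * t)) :=
    Real.rpow_nonneg (Finset.sum_nonneg fun j _ => Real.rpow_nonneg (hy0 j) _) _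
  have hTe : 0 ≤ T ^ ((2 - t) / t) := Real.rpow_nonneg hT0 _
  have hR0 : 0 < R := by positivity
  -- the tail test
  obtain ⟨A₁, hA₁, hA₁'⟩ := hM.bilinear_test hn hα0 hα1 hp
    (w := fun j => if j ∈ S then 1 else 0) (s := 1) (M := 1)
    (fun j => by split_ifs <;> norm_num)
    (fun j => by split_ifs <;> norm_num) zero_le_one one_pos
    (by simpa using hS.trans hcI1)
  -- the linear test
  obtain ⟨A₂, hA₂, hA₂'⟩ := hM.linear_test (n := n) hα0 hα1 hp S
  -- the bulk test
  have hbulk : ∃ A : Set (Fin n → E), (Measure.pi fun _ => ν p).real A ≤ α ∧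
      ∀ q ∈ Θ, C₂ * R ≤ (∑ j ∈ B, |(n : ℝ) * (q j - p j)| ^ t) ^ (1 / t) →
        (Measure.pi fun _ => ν q).real Aᶜ ≤ α := by
    rcases B.eq_empty_or_nonempty with hBe | hBne
    -- An empty bulk has norm 0 < C₂ R, so there is nothing to detect.
    · refine ⟨∅, by simpa using hα0.le, fun q _ hq => ?_⟩
      rw [hBe, Finset.sum_empty, Real.zero_rpow (by positivity)] at hq
      exact absurd hq (not_le.2 (by positivity))
    obtain ⟨u, hu, hyu, huT⟩ := hB hBne
    have hb0 : 0 ≤ 2 * (2 - t) / (4 - t) := div_nonneg (by linarith) h4t.le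
    -- For these weights w² y² = y^r on the bulk, so s = √S; the exponent is nonpositive, so the
    -- largest weight is bounded by its value at u.
    obtain ⟨A, hA, hA'⟩ := hM.bilinear_test hn hα0 hα1 hp
      (w := fun j => if j ∈ B then y j ^ (-(2 * (2 - t) / (4 - t))) else 0)
      (s := √(∑ j ∈ B, y j ^ (2 * t / (4 - t)))) (M := u ^ (-(2 * (2 - t) / (4 - t))))
      (fun j => by
        split_ifs
        · exact Real.rpow_nonneg (hy0 j) _
        · exact le_rfl)
      (fun j => by
        split_ifs with hj
        · exact Real.rpow_le_rpow_of_nonpos hu (hyu j hj) (by linarith)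
        · exact Real.rpow_nonneg hu.le _)
      (Real.rpow_nonneg hu.le _)
      (Real.sqrt_pos.2 (Finset.sum_pos
        (fun j hj => Real.rpow_pos_of_pos (hu.trans_le (hyu j hj)) _) hBne))
      (by
        rw [Real.sq_sqrt (Finset.sum_nonneg fun j _ => Real.rpow_nonneg (hy0 j) _)]
        simp only [ite_pow, ite_mul, ne_eq, OfNat.ofNat_ne_zero, not_false_eq_true, zero_pow,
          zero_mul, Finset.sum_ite_mem, Finset.univ_inter]
        refine le_of_eq (Finset.sum_congr rfl fun j hj => ?_)
        have hyj : 0 < y j := hu.trans_le (hyu j hj)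
        change (y j ^ _) ^ 2 * y j ^ 2 = _
        rw [← Real.rpow_natCast, ← Real.rpow_natCast, ← Real.rpow_mul hyj.le,
          ← Real.rpow_add hyj]
        congr 1; push_cast; field_simp; ring)
    refine ⟨A, hA, fun q hq hL => hA' q hq ?_⟩
    have hdet := bulk_detection B hBne (δ := fun j => (n : ℝ) * (q j - p j)) hu hyu hT0 hcI hcI1
      huT ht1 ht2 (C := (2592 / α) ^ 2) (by positivity) hC₂0.le (by
        rw [hC₂, mul_pow, Real.sq_sqrt (by positivity)]
        refine le_of_eq ?_; field_simp) hL
    simpa only [ite_mul, zero_mul, Finset.sum_ite_mem, Finset.univ_inter] using hdet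
  obtain ⟨A₃, hA₃, hA₃'⟩ := hbulk
  have hprob : ∀ q ∈ Θ, IsProbabilityMeasure (Measure.pi fun _ : Fin n => ν q) := fun q hq => by
    have := hM.prob q hq
    infer_instance
  refine minimaxRisk_le_of_tests hη hprob hp ![A₁, A₂, A₃] ?_ ?_
  · intro k; fin_cases k
    · exact hA₁
    · exact hA₂
    · exact hA₃
  intro q hq hρ
  have hρ' := hρ.trans (hd (p - q))
  have hscale : ∀ U : Finset (Fin N), (∑ j ∈ U, |(n : ℝ) * (q j - p j)| ^ t) ^ (1 / t) =
      n * (∑ j ∈ U, |(p - q) j| ^ t) ^ (1 / t) := by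
    intro U
    rw [rpow_sum_smul U (fun j => q j - p j) ht0 hnR.le]
    simp only [Pi.sub_apply, abs_sub_comm]
  have hsum : upperConst η cI * R ≤ (∑ j ∈ B, |(n : ℝ) * (q j - p j)| ^ t) ^ (1 / t) +
      (∑ j ∈ S, |(n : ℝ) * (q j - p j)| ^ t) ^ (1 / t) := by
    rw [hscale, hscale, ← hrate]
    have := mul_le_mul_of_nonneg_left hρ' hnR.le
    calc _ = n * (upperConst η cI * rate t n (restrict B p) (restrict S p)) := by ring
      _ ≤ _ := this
      _ = _ := by ring
  -- If the bulk misses its share of the separation, the tail has to exceed its own.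
  by_cases hb : C₂ * R ≤ (∑ j ∈ B, |(n : ℝ) * (q j - p j)| ^ t) ^ (1 / t)
  · exact ⟨2, hA₃' q hq hb⟩
  have htail : 2 * (2592 / α * (9 / α + 1)) * R ≤
      (∑ j ∈ S, |(n : ℝ) * (q j - p j)| ^ t) ^ (1 / t) := by
    have h0 : 0 ≤ C₂ * R := by positivity
    have h0' : 0 ≤ 2 * (2592 / α * (9 / α + 1)) * R := by positivity
    have : upperConst η cI * R = 2 * (C₂ * R) + 2 * (2 * (2592 / α * (9 / α + 1)) * R) := by
      unfold upperConst; ring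
    linarith
  have hdich := tail_dichotomy S (y := y) (δ := fun j => (n : ℝ) * (q j - p j)) hy0
    (fun j => by
      have := hM.nonneg q hq j
      have h : y j + n * (q j - p j) = n * q j := by rw [hy]; ring
      rw [h]; positivity) ht1 ht2 (C := (2592 / α) ^ 2) (K := 9 / α) (one_le_pow₀ hC1) hK (by
      refine le_trans ?_ htail
      rw [Real.sqrt_sq (by positivity)]
      refine mul_le_mul_of_nonneg_left ?_ (by positivity)
      linarith)
  rcases hdich with h | h
  · refine ⟨0, hA₁' q hq ?_⟩
    simpa using h
  · refine ⟨1, hA₂' q hq ?_⟩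
    refine h.trans (le_of_eq (Finset.sum_congr rfl fun j _ => ?_))
    rw [hy]; ring

end Upper

/-! ### The cutoff between bulk and tail -/

section Cutoff

variable {N n : ℕ} {cI : ℝ} {p : Fin N → ℝ}

/-- The coordinates beyond `u`. -/
def tailSet (N u : ℕ) : Finset (Fin N) := Finset.univ.filter fun j => u < (j : ℕ) + 1

theorem tail_eq_restrict (p : Fin N → ℝ) (u : ℕ) : tail p u = restrict (tailSet N u) p := by
  ext j; simp [tail, restrict, tailSet]

theorem sum_tail_sq (p : Fin N → ℝ) (u : ℕ) :
    ∑ j, tail p u j ^ 2 = ∑ j ∈ tailSet N u, p j ^ 2 := by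
  simp [tail, tailSet, Finset.sum_filter]

/-- J = N always qualifies, its tail being empty, so the infimum in `ℕ` is attained rather than
being the default value 0. -/
theorem cutoff_mem (hcI : 0 ≤ cI) : ∑ j ∈ tailSet N (cutoff cI n p), p j ^ 2 ≤ cI / (n : ℝ) ^ 2 := by
  rw [← sum_tail_sq]
  refine Nat.sInf_mem (s := {J : ℕ | ∑ j, tail p J j ^ 2 ≤ cI / (n : ℝ) ^ 2}) ⟨N, ?_⟩
  have : ∀ j : Fin N, tail p N j = 0 := fun j => by
    simp only [tail]; rw [if_neg]; omega
  simp only [Set.mem_ofPred_eq, this]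
  simp; positivity

theorem cutoff_le (hcI : 0 ≤ cI) : cutoff cI n p ≤ N := by
  refine Nat.sInf_le ?_
  have : ∀ j : Fin N, tail p N j = 0 := fun j => by
    simp only [tail]; rw [if_neg]; omega
  simp only [Set.mem_ofPred_eq, this]
  simp; positivity

theorem sum_tail_scaled_sq_le (hn : 0 < n) (hcI : 0 ≤ cI) :
    ∑ j ∈ tailSet N (cutoff cI n p), (n * p j) ^ 2 ≤ cI := by
  have h := cutoff_mem (n := n) (p := p) hcI
  have hn' : (0 : ℝ) < n := by exact_mod_cast hn
  rw [le_div_iff₀ (by positivity)] at h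
  simp_rw [mul_pow, ← Finset.mul_sum]
  linarith

/-- The smallest bulk coordinate. -/
theorem exists_bulk_bound (hn : 0 < n) (hcI : 0 < cI) (hp : ∀ j, 0 ≤ p j) (hanti : Antitone p)
    (hI : cutoff cI n p ≠ 0) :
    ∃ u, 0 < u ∧ (∀ j : Fin N, (j : ℕ) + 1 ≤ cutoff cI n p → u ≤ n * p j) ∧
      cI ≤ u * (u + ∑ j ∈ tailSet N (cutoff cI n p), n * p j) := by
  set I := cutoff cI n p with hId
  have hIN : I ≤ N := cutoff_le hcI.le
  have hn' : (0 : ℝ) < n := by exact_mod_cast hn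
  -- The last bulk coordinate, number I when counting from 1. By minimality, adding it to the tail
  -- violates the defining inequality.
  let i : Fin N := ⟨I - 1, by omega⟩
  have hi : (i : ℕ) + 1 = I := by change I - 1 + 1 = I; omega
  have hnot : ¬ ∑ j, tail p (I - 1) j ^ 2 ≤ cI / (n : ℝ) ^ 2 :=
    Nat.notMem_of_lt_sInf (s := {J : ℕ | ∑ j, tail p J j ^ 2 ≤ cI / (n : ℝ) ^ 2})
      (show I - 1 < sInf _ by change I - 1 < I; omega)
  have hset : tailSet N (I - 1) = insert i (tailSet N I) := by
    ext j
    simp only [tailSet, Finset.mem_filter, Finset.mem_univ, true_and, Finset.mem_insert,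
      Fin.ext_iff]
    omega
  have hni : i ∉ tailSet N I := by simp [tailSet]; omega
  rw [sum_tail_sq, hset, Finset.sum_insert hni, not_le, div_lt_iff₀ (by positivity)] at hnot
  -- Monotonicity bounds the squared tail by p i times its mass, which turns the violated inequality
  -- into cI ≤ u (u + T).
  have hle : ∑ j ∈ tailSet N I, p j ^ 2 ≤ p i * ∑ j ∈ tailSet N I, p j := by
    rw [Finset.mul_sum]
    refine Finset.sum_le_sum fun j hj => ?_
    have : p j ≤ p i := hanti (Fin.le_def.2 (by simp [tailSet] at hj; omega))
    rw [sq]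
    exact mul_le_mul_of_nonneg_right this (hp j)
  have key : cI ≤ (n * p i) * (n * p i + ∑ j ∈ tailSet N I, n * p j) := by
    rw [← Finset.mul_sum]
    nlinarith [mul_le_mul_of_nonneg_right hle (sq_nonneg (n : ℝ))]
  refine ⟨n * p i, ?_, fun j hj => ?_, key⟩
  · refine (mul_nonneg hn'.le (hp i)).lt_of_ne fun h => ?_
    rw [← h] at key; linarith
  · exact mul_le_mul_of_nonneg_left (hanti (Fin.le_def.2 (by omega))) hn'.le

end Cutoff

/-! ### Comparison of discrete laws and the second moment method -/

section Discrete

variable {Ω : Type*} [MeasurableSpace Ω] [Countable Ω] [MeasurableSingletonClass Ω]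

theorem mul_measure_le_of_singleton {μ μ' : Measure Ω} {A : Set Ω} {c : ℝ≥0∞}
    (h : ∀ x ∈ A, c * μ {x} ≤ μ' {x}) : c * μ A ≤ μ' A := by
  have hA : MeasurableSet A := .of_discrete
  rw [← Measure.tsum_indicator_apply_singleton μ A hA,
    ← Measure.tsum_indicator_apply_singleton μ' A hA, ← ENNReal.tsum_mul_left]
  refine ENNReal.tsum_le_tsum fun x => ?_
  by_cases hx : x ∈ A
  · simpa [hx] using h x hx
  · simp [hx]

/-- If `μ'` has density `L` with respect to `μ` on singletons, then `μ'` is given by integrating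
`L`. -/
theorem measureReal_eq_setIntegral_of_singleton {μ μ' : Measure Ω} [IsFiniteMeasure μ']
    {L : Ω → ℝ} (hL : ∀ x, 0 ≤ L x) (h : ∀ x, μ' {x} = ENNReal.ofReal (L x) * μ {x}) :
    Integrable L μ ∧ ∀ A : Set Ω, μ'.real A = ∫ x in A, L x ∂μ := by
  have hμ : μ' = μ.withDensity fun x => ENNReal.ofReal (L x) := by
    refine Measure.ext_of_singleton fun x => ?_
    rw [withDensity_apply _ .of_discrete, lintegral_singleton, h]
  have hLm : AEStronglyMeasurable L μ := .of_discrete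
  refine ⟨⟨hLm, ?_⟩, fun A => ?_⟩
  · rw [hasFiniteIntegral_iff_ofReal (.of_forall hL)]
    have := measure_lt_top μ' Set.univ
    rwa [hμ, withDensity_apply _ .univ, setLIntegral_univ] at this
  · rw [integral_eq_lintegral_of_nonneg_ae (.of_forall hL) .of_discrete, measureReal_def, hμ,
      withDensity_apply _ .of_discrete]

/-- Second moment bound: the null law is dominated by a mixture up to the `χ²`-type quantity. -/
theorem measureReal_le_mixture_add {α : Type*} [Fintype α] {μ : Measure Ω}
    [IsProbabilityMeasure μ] {κ : α → Measure Ω} (hκ : ∀ a, IsProbabilityMeasure (κ a))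
    {L : α → Ω → ℝ} (hL : ∀ a x, 0 ≤ L a x)
    (h : ∀ a x, κ a {x} = ENNReal.ofReal (L a x) * μ {x})
    {H : α → α → ℝ} (hint : ∀ a b, Integrable (fun x => L a x * L b x) μ)
    (hH : ∀ a b, ∫ x, L a x * L b x ∂μ ≤ H a b)
    {w : α → ℝ} (hw : ∀ a, 0 ≤ w a) (hw1 : ∑ a, w a = 1) {τ : ℝ} (hτ : 0 < τ)
    (hHτ : ∑ a, ∑ b, w a * w b * H a b ≤ 1 + τ ^ 2) (A : Set Ω) :
    μ.real A ≤ ∑ a, w a * (κ a).real A + τ := by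
  have hd := fun a => measureReal_eq_setIntegral_of_singleton (hL a) (h a)
  set Lb : Ω → ℝ := fun x => ∑ a, w a * L a x with hLb
  have hLbi : Integrable Lb μ := integrable_finsetSum _ fun a _ => (hd a).1.const_mul _
  have hsq : ∀ x, Lb x ^ 2 = ∑ a, ∑ b, w a * w b * (L a x * L b x) := by
    intro x
    rw [hLb, sq, Finset.sum_mul_sum]
    exact Finset.sum_congr rfl fun a _ => Finset.sum_congr rfl fun b _ => by ring
  have hLbsq : Integrable (fun x => Lb x ^ 2) μ := by
    simp_rw [hsq]
    exact integrable_finsetSum _ fun a _ => integrable_finsetSum _ fun b _ =>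
      (hint a b).const_mul _
  have hI1 : ∀ B : Set Ω, ∫ x in B, Lb x ∂μ = ∑ a, w a * (κ a).real B := by
    intro B
    rw [hLb, integral_finsetSum _ fun a _ => ((hd a).1.const_mul _).integrableOn]
    refine Finset.sum_congr rfl fun a _ => ?_
    rw [integral_const_mul, (hd a).2 B]
  have hI1' : ∫ x, Lb x ∂μ = 1 := by
    have := hI1 Set.univ
    rw [setIntegral_univ] at this
    rw [this]
    simp [hw1]
  have hI2 : ∫ x, Lb x ^ 2 ∂μ ≤ 1 + τ ^ 2 := by
    refine le_trans ?_ hHτ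
    simp_rw [hsq]
    rw [integral_finsetSum _ fun a _ => integrable_finsetSum _ fun b _ => (hint a b).const_mul _]
    refine Finset.sum_le_sum fun a _ => ?_
    rw [integral_finsetSum _ fun b _ => (hint a b).const_mul _]
    refine Finset.sum_le_sum fun b _ => ?_
    rw [integral_const_mul]
    exact mul_le_mul_of_nonneg_left (hH a b) (mul_nonneg (hw a) (hw b))
  -- AM-GM in place of Cauchy-Schwarz: 1 - L ≤ τ/2 + (1-L)²/(2τ). Since E(1-L)² ≤ τ², both halves
  -- integrate to at most τ/2.
  have hpt : ∀ x, 1 - Lb x ≤ τ / 2 + (1 - 2 * Lb x + Lb x ^ 2) / (2 * τ) := by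
    intro x
    have : τ / 2 + (1 - 2 * Lb x + Lb x ^ 2) / (2 * τ) - (1 - Lb x) =
        (1 - Lb x - τ) ^ 2 / (2 * τ) := by field_simp; ring
    have h2 : 0 ≤ (1 - Lb x - τ) ^ 2 / (2 * τ) := by positivity
    linarith
  have hgi : Integrable (fun x => τ / 2 + (1 - 2 * Lb x + Lb x ^ 2) / (2 * τ)) μ :=
    (integrable_const _).add
      ((((integrable_const _).sub (hLbi.const_mul 2)).add hLbsq).div_const _)
  have h1 : ∫ x in A, (1 - Lb x) ∂μ = μ.real A - ∑ a, w a * (κ a).real A := by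
    rw [integral_sub (integrable_const _) hLbi.integrableOn, hI1]
    simp
  have h2 : ∫ x in A, (1 - Lb x) ∂μ ≤
      ∫ x in A, (τ / 2 + (1 - 2 * Lb x + Lb x ^ 2) / (2 * τ)) ∂μ :=
    integral_mono (((integrable_const _).sub hLbi).integrableOn) hgi.integrableOn hpt
  have h3 : ∫ x in A, (τ / 2 + (1 - 2 * Lb x + Lb x ^ 2) / (2 * τ)) ∂μ ≤
      ∫ x, (τ / 2 + (1 - 2 * Lb x + Lb x ^ 2) / (2 * τ)) ∂μ := by
    refine setIntegral_le_integral hgi (.of_forall fun x => ?_)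
    have : (0 : ℝ) ≤ 1 - 2 * Lb x + Lb x ^ 2 := by nlinarith [sq_nonneg (1 - Lb x)]
    change 0 ≤ _
    positivity
  have h4 : ∫ x, (τ / 2 + (1 - 2 * Lb x + Lb x ^ 2) / (2 * τ)) ∂μ =
      τ / 2 + (∫ x, Lb x ^ 2 ∂μ - 1) / (2 * τ) := by
    have i2 : Integrable (fun x => 1 - 2 * Lb x) μ := (integrable_const _).sub (hLbi.const_mul 2)
    have i3 : Integrable (fun x => 1 - 2 * Lb x + Lb x ^ 2) μ := i2.add hLbsq
    rw [integral_add (integrable_const _) (i3.div_const _), integral_div (2 * τ),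
      integral_add i2 hLbsq, integral_sub (integrable_const _) (hLbi.const_mul 2),
      integral_const_mul, hI1']
    simp; ring
  have h5 : (∫ x, Lb x ^ 2 ∂μ - 1) / (2 * τ) ≤ τ / 2 := by
    rw [div_le_div_iff₀ (by positivity) two_pos]
    nlinarith
  linarith

end Discrete

/-- Averages of exponentials of Rademacher products. -/
theorem sum_sign_exp_le {ι : Type*} [Fintype ι] [DecidableEq ι] (a : ι → ℝ) :
    ∑ ε : ι → Bool, ∑ ε' : ι → Bool, ((2 : ℝ) ^ Fintype.card ι)⁻¹ * ((2 : ℝ) ^ Fintype.card ι)⁻¹ *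
      Real.exp (∑ k, (if ε k then (1 : ℝ) else -1) * (if ε' k then (1 : ℝ) else -1) * a k) ≤
      Real.exp (∑ k, a k ^ 2 / 2) := by
  -- The inner sum factors over k, and evenness of cosh removes the dependence on ε.
  have h1 : ∀ ε : ι → Bool, ∑ ε' : ι → Bool,
      Real.exp (∑ k, (if ε k then (1 : ℝ) else -1) * (if ε' k then (1 : ℝ) else -1) * a k) =
      ∏ k, (2 * Real.cosh (a k)) := by
    intro ε
    simp_rw [Real.exp_sum]
    rw [← Fintype.piFinset_univ, ← Finset.prod_univ_sum (fun _ => Finset.univ)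
      (fun k (b : Bool) => Real.exp ((if ε k then (1 : ℝ) else -1) * (if b then (1 : ℝ) else -1)
        * a k))]
    refine Finset.prod_congr rfl fun k _ => ?_
    rw [Fintype.sum_bool, Real.cosh_eq]
    cases ε k <;> simp <;> ring
  have h2 : ∏ k, (2 * Real.cosh (a k)) ≤
      (2 : ℝ) ^ Fintype.card ι * Real.exp (∑ k, a k ^ 2 / 2) := by
    rw [Finset.prod_mul_distrib, Finset.prod_const, Finset.card_univ, Real.exp_sum]
    refine mul_le_mul_of_nonneg_left (Finset.prod_le_prod (fun k _ => (Real.cosh_pos _).le)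
      fun k _ => Real.cosh_le_exp_half_sq _) (by positivity)
  simp_rw [← Finset.mul_sum, h1]
  rw [Finset.sum_const, Finset.card_univ, Fintype.card_fun, Fintype.card_bool, nsmul_eq_mul]
  push_cast
  set c : ℝ := 2 ^ Fintype.card ι with hc
  have hc0 : 0 < c := by positivity
  calc c⁻¹ * c⁻¹ * (c * ∏ k, (2 * Real.cosh (a k))) = c⁻¹ * ∏ k, (2 * Real.cosh (a k)) := by
        field_simp
    _ ≤ c⁻¹ * (c * Real.exp (∑ k, a k ^ 2 / 2)) := by gcongr
    _ = _ := inv_mul_cancel_left₀ hc0.ne' _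

/-! ### Lower bounds from one alternative and from random signs -/

section Lower

variable {E : Type*} [MeasurableSpace E]
  {N n : ℕ} {ν : (Fin N → ℝ) → Measure E} {Θ : Set (Fin N → ℝ)} {X : E → Fin N → ℕ}

theorem CountModel.prob_pi (hM : CountModel ν Θ X) {q : Fin N → ℝ} (hq : q ∈ Θ) :
    IsProbabilityMeasure (Measure.pi fun _ : Fin n => ν q) := by
  have := hM.prob q hq
  infer_instance

variable [Countable E] [MeasurableSingletonClass E]

/-- Lower bound from a single alternative whose law dominates most of the null law. -/
theorem CountModel.le_sepRadius_of_dominated (hM : CountModel ν Θ X) {p q : Fin N → ℝ}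
    (hp : p ∈ Θ) (hq : q ∈ Θ) {d : (Fin N → ℝ) → ℝ} {η s δ : ℝ} (hη : 0 < η)
    (hne : ∃ ρ, 0 < ρ ∧ minimaxRisk (fun q => Measure.pi fun _ : Fin n => ν q) Θ d p ρ ≤
      ENNReal.ofReal η)
    (hδ0 : 0 ≤ δ) (hδ1 : δ ≤ 1) (hδ : n * δ < 1 - η) (hd : s ≤ d (p - q))
    (hdom : ∀ x, ENNReal.ofReal (1 - δ) * ν p {x} ≤ ν q {x}) :
    s ≤ sepRadius (fun q => Measure.pi fun _ : Fin n => ν q) Θ d p η := by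
  have := hM.prob p hp
  have := hM.prob q hq
  refine le_sepRadius_of_prior hne (fun q hq => hM.prob_pi hq) hp hη (α := Unit) (fun _ => 1)
    (fun _ => zero_le_one) (by simp) (fun _ => q) (fun _ => hq) (fun _ => hd) (ε := n * δ)
    (by linarith) fun A _ => ?_
  -- A fraction 1 - δ of the null mass survives at every point for one observation, hence (1 - δ)^n
  -- ≥ 1 - n δ for n of them.
  have h1 : ENNReal.ofReal (1 - δ) ^ n * (Measure.pi fun _ : Fin n => ν p) A ≤
      (Measure.pi fun _ : Fin n => ν q) A := by
    refine mul_measure_le_of_singleton fun x _ => ?_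
    rw [Measure.pi_singleton, Measure.pi_singleton]
    calc _ = ∏ i : Fin n, ENNReal.ofReal (1 - δ) * ν p {x i} := by
          rw [Finset.prod_mul_distrib]; simp
      _ ≤ _ := Finset.prod_le_prod' fun i _ => hdom _
  have h2 := ENNReal.toReal_mono (measure_ne_top _ _) h1
  rw [ENNReal.toReal_mul, ENNReal.toReal_pow, ENNReal.toReal_ofReal (by linarith)] at h2
  have h3 : 1 - n * δ ≤ (1 - δ) ^ n := by
    have := one_add_mul_le_pow (a := -δ) (by linarith) n
    simpa [sub_eq_add_neg] using this
  have h4 : (Measure.pi fun _ : Fin n => ν p).real A ≤ 1 := measureReal_le_one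
  have h5 : 0 ≤ (Measure.pi fun _ : Fin n => ν p).real A := measureReal_nonneg
  simp only [Finset.univ_unique, Finset.sum_singleton, one_mul]
  change (1 - δ) ^ n * (Measure.pi fun _ : Fin n => ν p).real A ≤
    (Measure.pi fun _ : Fin n => ν q).real A at h2
  have h6 : (Measure.pi fun _ : Fin n => ν p).real A ≤
      (1 - δ) ^ n * (Measure.pi fun _ : Fin n => ν p).real A + n * δ := by
    have : 0 ≤ n * δ := by positivity
    nlinarith
  linarith

/-- Lower bound from a family of orthogonal perturbations with random signs. -/
theorem CountModel.le_sepRadius_of_directions (hM : CountModel ν Θ X) {p : Fin N → ℝ}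
    (hp : p ∈ Θ) {d : (Fin N → ℝ) → ℝ} {η s τ : ℝ} (hη : 0 < η)
    (hne : ∃ ρ, 0 < ρ ∧ minimaxRisk (fun q => Measure.pi fun _ : Fin n => ν q) Θ d p ρ ≤
      ENNReal.ofReal η) (hτ : 0 < τ) (hτη : η < 1 - τ)
    (v : Fin N → Fin N → ℝ) (horth : ∀ j k, j ≠ k → ∀ l, v j l * v k l = 0)
    (hsupp : ∀ j l, p l = 0 → v j l = 0)
    (hq : ∀ σ : Fin N → ℝ, (∀ j, |σ j| = 1) → (fun l => p l + ∑ j, σ j * v j l) ∈ Θ ∧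
      s ≤ d (p - fun l => p l + ∑ j, σ j * v j l))
    (hchi : Real.exp (∑ j, (n * ∑ l, v j l ^ 2 / p l) ^ 2 / 2) ≤ 1 + τ ^ 2) :
    s ≤ sepRadius (fun q => Measure.pi fun _ : Fin n => ν q) Θ d p η := by
  classical
  set sg : (Fin N → Bool) → Fin N → ℝ := fun ε k => if ε k then 1 else -1 with hsg
  have hsg1 : ∀ ε j, |sg ε j| = 1 := fun ε j => by
    simp only [hsg]; split_ifs <;> simp
  set Q : (Fin N → Bool) → Fin N → ℝ := fun ε l => p l + ∑ j, sg ε j * v j l with hQ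
  have hQΘ : ∀ ε, Q ε ∈ Θ := fun ε => (hq (sg ε) (hsg1 ε)).1
  have hac : ∀ ε j, p j = 0 → Q ε j = 0 := fun ε l hl => by
    simp [hQ, hl, hsupp _ l hl]
  obtain ⟨ℓ, hℓ⟩ := hM.ratio p hp
  have hprobp := hM.prob p hp
  have hw1 : ∑ _ε : Fin N → Bool, ((2 : ℝ) ^ Fintype.card (Fin N))⁻¹ = 1 := by
    rw [Finset.sum_const, Finset.card_univ, Fintype.card_fun, Fintype.card_bool, nsmul_eq_mul]
    push_cast
    exact mul_inv_cancel₀ (by positivity)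
  refine le_sepRadius_of_prior hne (fun q hq => hM.prob_pi hq) hp hη
    (fun _ => ((2 : ℝ) ^ Fintype.card (Fin N))⁻¹) (fun _ => by positivity) hw1 Q hQΘ
    (fun ε => (hq (sg ε) (hsg1 ε)).2) hτη fun A _ => ?_
  -- The directions have disjoint supports, so only diagonal terms remain and the exponent becomes a
  -- Rademacher sum.
  have hexp : ∀ ε ε', ∑ l, (Q ε l - p l) * (Q ε' l - p l) / p l =
      ∑ k, sg ε k * sg ε' k * ∑ l, v k l ^ 2 / p l := by
    intro ε ε'
    simp only [hQ, add_sub_cancel_left]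
    have h1 : ∀ l, (∑ j, sg ε j * v j l) * (∑ j, sg ε' j * v j l) =
        ∑ k, sg ε k * sg ε' k * v k l ^ 2 := by
      intro l
      rw [Finset.sum_mul_sum]
      refine Finset.sum_congr rfl fun j _ => ?_
      rw [Finset.sum_eq_single j]
      · ring
      · intro k _ hk
        rw [mul_mul_mul_comm, horth j k hk.symm l, mul_zero]
      · simp
    simp_rw [h1, Finset.sum_div, Finset.mul_sum]
    rw [Finset.sum_comm]
    exact Finset.sum_congr rfl fun k _ => Finset.sum_congr rfl fun l _ => by ring
  refine measureReal_le_mixture_add (μ := Measure.pi fun _ : Fin n => ν p)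
    (κ := fun ε => Measure.pi fun _ : Fin n => ν (Q ε)) (fun ε => hM.prob_pi (hQΘ ε))
    (L := fun ε ω => ∏ i, ℓ (Q ε) (ω i))
    (fun ε ω => Finset.prod_nonneg fun i _ => (hℓ (Q ε) (hQΘ ε) (hac ε)).1 _)
    (fun ε ω => ?_)
    (H := fun ε ε' => Real.exp (∑ k, sg ε k * sg ε' k * (n * ∑ l, v k l ^ 2 / p l)))
    (fun ε ε' => ?_) (fun ε ε' => ?_)
    (fun _ => by positivity) hw1 hτ ?_ A
  · have := hM.prob _ (hQΘ ε)
    rw [Measure.pi_singleton, Measure.pi_singleton, ENNReal.ofReal_prod_of_nonneg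
      (fun i _ => (hℓ (Q ε) (hQΘ ε) (hac ε)).1 _), ← Finset.prod_mul_distrib]
    exact Finset.prod_congr rfl fun i _ => (hℓ (Q ε) (hQΘ ε) (hac ε)).2.1 _
  · simp_rw [← Finset.prod_mul_distrib]
    exact Integrable.fintype_prod (f := fun _ x => ℓ (Q ε) x * ℓ (Q ε') x) fun i =>
      ((hℓ (Q ε) (hQΘ ε) (hac ε)).2.2 (Q ε') (hQΘ ε') (hac ε')).1
  · simp_rw [← Finset.prod_mul_distrib]
    rw [integral_fintype_prod_eq_prod (μ := fun _ : Fin n => ν p)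
      (f := fun _ x => ℓ (Q ε) x * ℓ (Q ε') x), Finset.prod_const, Finset.card_univ,
      Fintype.card_fin]
    refine (pow_le_pow_left₀ (integral_nonneg fun x => mul_nonneg
      ((hℓ (Q ε) (hQΘ ε) (hac ε)).1 _) ((hℓ (Q ε') (hQΘ ε') (hac ε')).1 _))
      ((hℓ (Q ε) (hQΘ ε) (hac ε)).2.2 (Q ε') (hQΘ ε') (hac ε')).2 n).trans (le_of_eq ?_)
    rw [hexp, ← Real.exp_nat_mul, Finset.mul_sum]
    congr 1
    exact Finset.sum_congr rfl fun k _ => by ring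
  · exact (sum_sign_exp_le fun k => n * ∑ l, v k l ^ 2 / p l).trans hchi

end Lower

/-! ### Concentrating the mass of blocks on random coordinates -/

section Blocks

variable {N : ℕ} {ι : Type*} [Fintype ι]

open Classical in
/-- The vector obtained from `p` by moving the whole mass of each block to a single coordinate. -/
noncomputable def concentrate (p : Fin N → ℝ) (G : ι → Finset (Fin N)) (J : (b : ι) → G b) :
    Fin N → ℝ :=
  fun j => if h : ∃ b, j ∈ G b then
    (if (J h.choose : Fin N) = j then ∑ k ∈ G h.choose, p k else 0) else p j

theorem concentrate_of_mem {p : Fin N → ℝ} {G : ι → Finset (Fin N)}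
    (hG : Pairwise fun a b => Disjoint (G a) (G b)) (J : (b : ι) → G b) {b : ι} {j : Fin N}
    (hj : j ∈ G b) :
    concentrate p G J j = if (J b : Fin N) = j then ∑ k ∈ G b, p k else 0 := by
  have h : ∃ b, j ∈ G b := ⟨b, hj⟩
  have hb : h.choose = b := by
    by_contra hne
    exact Finset.disjoint_left.1 (hG hne) h.choose_spec hj
  unfold concentrate
  rw [dif_pos h, hb]

theorem concentrate_of_notMem {p : Fin N → ℝ} {G : ι → Finset (Fin N)} (J : (b : ι) → G b)
    {j : Fin N} (hj : ∀ b, j ∉ G b) : concentrate p G J j = p j := by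
  unfold concentrate
  rw [dif_neg (by simpa using hj)]

theorem sum_concentrate {p : Fin N → ℝ} {G : ι → Finset (Fin N)}
    (hG : Pairwise fun a b => Disjoint (G a) (G b)) (J : (b : ι) → G b) :
    ∑ j, concentrate p G J j = ∑ j, p j := by
  classical
  have hd : (↑(Finset.univ : Finset ι) : Set ι).PairwiseDisjoint G := fun a _ b _ hab => hG hab
  rw [← Finset.sum_add_sum_compl (Finset.univ.biUnion G),
    ← Finset.sum_add_sum_compl (Finset.univ.biUnion G) p, Finset.sum_biUnion hd,
    Finset.sum_biUnion hd]
  congr 1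
  · refine Finset.sum_congr rfl fun b _ => ?_
    rw [Finset.sum_congr rfl fun j hj => concentrate_of_mem (p := p) hG J hj]
    simp
  · refine Finset.sum_congr rfl fun j hj => concentrate_of_notMem J fun b hb => ?_
    simp only [Finset.mem_compl, Finset.mem_biUnion, Finset.mem_univ, true_and, not_exists] at hj
    exact hj b hb

theorem concentrate_nonneg {p : Fin N → ℝ} (hp : ∀ j, 0 ≤ p j) {G : ι → Finset (Fin N)}
    (J : (b : ι) → G b) (j : Fin N) : 0 ≤ concentrate p G J j := by
  unfold concentrate
  split_ifs
  · exact Finset.sum_nonneg fun k _ => hp k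
  · exact le_rfl
  · exact hp j

/-- Within one block, the mixture of the concentrated monomials is the original monomial if the
total degree is at most one. -/
theorem sum_block_monomial {p : Fin N → ℝ} {G : Finset (Fin N)} (hG : 0 < ∑ k ∈ G, p k)
    {S : Fin N → ℕ} (hS : ∑ j ∈ G, S j ≤ 1) :
    ∑ i : G, (p i / ∑ k ∈ G, p k) *
      ∏ j ∈ G, (if (i : Fin N) = j then ∑ k ∈ G, p k else 0) ^ S j = ∏ j ∈ G, p j ^ S j := by
  classical
  set P := ∑ k ∈ G, p k with hP
  -- In degree 0 the weights sum to 1; in degree 1 the block mass P sits at j₀ with weight p_{j₀}/P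
  -- and averages to p_{j₀}. Degree 2 would give p_{j₀} P instead of p_{j₀}².
  rcases Nat.le_one_iff_eq_zero_or_eq_one.1 hS with h0 | h1
  · have hz : ∀ j ∈ G, S j = 0 := fun j hj => by
      exact (Finset.sum_eq_zero_iff.1 h0) j hj
    have : ∀ f : Fin N → ℝ, ∏ j ∈ G, f j ^ S j = 1 := fun f =>
      Finset.prod_eq_one fun j hj => by rw [hz j hj, pow_zero]
    rw [this p]
    simp_rw [this (fun j => if _ = j then P else 0), mul_one]
    rw [← Finset.sum_div, Finset.sum_coe_sort G p, div_self hG.ne']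
  · obtain ⟨j₀, hj₀, hne⟩ : ∃ j ∈ G, S j ≠ 0 := by
      by_contra! hcon
      rw [Finset.sum_eq_zero hcon] at h1; omega
    have hsplit := Finset.add_sum_erase G S hj₀
    have hj1 : S j₀ = 1 := by omega
    have hz : ∀ j ∈ G, j ≠ j₀ → S j = 0 := fun j hj hjne => by
      have h2 : ∑ k ∈ G.erase j₀, S k = 0 := by omega
      exact (Finset.sum_eq_zero_iff.1 h2) j (Finset.mem_erase.2 ⟨hjne, hj⟩)
    have : ∀ f : Fin N → ℝ, ∏ j ∈ G, f j ^ S j = f j₀ := fun f => by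
      rw [Finset.prod_eq_single j₀]
      · rw [hj1, pow_one]
      · intro j hj hjne; rw [hz j hj hjne, pow_zero]
      · intro h; exact absurd hj₀ h
    rw [this p]
    simp_rw [this (fun j => if _ = j then P else 0)]
    rw [Finset.sum_coe_sort G (fun i => p i / P * if i = j₀ then P else 0),
      Finset.sum_eq_single j₀]
    · rw [if_pos rfl, div_mul_cancel₀ _ hG.ne']
    · intro j _ hj; rw [if_neg hj, mul_zero]
    · intro h; exact absurd hj₀ h

/-- The weight of J is a product over blocks, as for independent draws. The sum therefore factors,
`sum_block_monomial` treats each block, and the other coordinates are unchanged. -/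
theorem sum_concentrate_monomial [DecidableEq ι] {p : Fin N → ℝ} {G : ι → Finset (Fin N)}
    (hG : Pairwise fun a b => Disjoint (G a) (G b)) (hpos : ∀ b, 0 < ∑ k ∈ G b, p k)
    {S : Fin N → ℕ} (hS : ∀ b, ∑ j ∈ G b, S j ≤ 1) :
    ∑ J : (b : ι) → G b, (∏ b, (p (J b) / ∑ k ∈ G b, p k)) *
      ∏ j, concentrate p G J j ^ S j = ∏ j, p j ^ S j := by
  classical
  have hd : (↑(Finset.univ : Finset ι) : Set ι).PairwiseDisjoint G := fun a _ b _ hab => hG hab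
  have hsplit : ∀ f : Fin N → ℝ, ∏ j, f j =
      (∏ b, ∏ j ∈ G b, f j) * ∏ j ∈ (Finset.univ.biUnion G)ᶜ, f j := fun f => by
    rw [← Finset.prod_mul_prod_compl (Finset.univ.biUnion G), Finset.prod_biUnion hd]
  rw [hsplit fun j => p j ^ S j]
  have h1 : ∀ J : (b : ι) → G b, (∏ b, (p (J b) / ∑ k ∈ G b, p k)) *
      ∏ j, concentrate p G J j ^ S j =
      (∏ b, ((p (J b) / ∑ k ∈ G b, p k) *
        ∏ j ∈ G b, (if (J b : Fin N) = j then ∑ k ∈ G b, p k else 0) ^ S j)) *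
        ∏ j ∈ (Finset.univ.biUnion G)ᶜ, p j ^ S j := by
    intro J
    rw [hsplit, Finset.prod_mul_distrib, mul_assoc]
    congr 2
    · refine Finset.prod_congr rfl fun b _ => Finset.prod_congr rfl fun j hj => ?_
      rw [concentrate_of_mem hG J hj]
    · refine Finset.prod_congr rfl fun j hj => ?_
      rw [concentrate_of_notMem J fun b hb => ?_]
      simp only [Finset.mem_compl, Finset.mem_biUnion, Finset.mem_univ, true_and,
        not_exists] at hj
      exact hj b hb
  simp_rw [h1, ← Finset.sum_mul]
  congr 1
  rw [← Fintype.piFinset_univ, ← Finset.prod_univ_sum (fun _ => Finset.univ)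
    (fun b (i : G b) => (p i / ∑ k ∈ G b, p k) *
      ∏ j ∈ G b, (if (i : Fin N) = j then ∑ k ∈ G b, p k else 0) ^ S j)]
  exact Finset.prod_congr rfl fun b _ => sum_block_monomial (hpos b) (hS b)

end Blocks

/-! ### Lower bound from the block prior -/

section Lower

variable {E : Type*} [MeasurableSpace E] [Countable E] [MeasurableSingletonClass E]
  {N n : ℕ} {ν : (Fin N → ℝ) → Measure E} {Θ : Set (Fin N → ℝ)} {X : E → Fin N → ℕ}

/-- The probability of at least two observations in a set of coordinates. -/
theorem CountModel.prob_two_le (hM : CountModel ν Θ X) {p : Fin N → ℝ} (hp : p ∈ Θ)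
    (G : Finset (Fin N)) :
    (Measure.pi fun _ : Fin n => ν p).real {ω | 2 ≤ ∑ j ∈ G, ∑ i, X (ω i) j} ≤
      (n * ∑ j ∈ G, p j) ^ 2 := by
  classical
  have := hM.prob_pi (n := n) hp
  obtain ⟨h1, h2, h3⟩ := hM.linear_moments hp (Finset.univ : Finset (Fin n)) (0 : Fin N → ℝ)
    (fun j => if j ∈ G then 1 else 0)
  simp only [Finset.card_univ, Fintype.card_fin, Pi.zero_apply, sub_zero, ite_mul, one_mul,
    zero_mul, Finset.sum_ite_mem, Finset.univ_inter, ite_pow, one_pow, ne_eq, OfNat.ofNat_ne_zero,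
    not_false_eq_true, zero_pow] at h1 h2 h3
  set m : ℝ := n * ∑ j ∈ G, p j with hm
  set Y : (Fin n → E) → ℝ := fun ω => ∑ j ∈ G, ∑ i, (X (ω i) j : ℝ) with hY
  have hYnat : ∀ ω, Y ω = ((∑ j ∈ G, ∑ i, X (ω i) j : ℕ) : ℝ) := fun ω => by
    simp [hY]
  rw [variance_eq_sub h1, h2] at h3
  simp only [Pi.pow_apply] at h3
  have hYi : Integrable Y (Measure.pi fun _ : Fin n => ν p) := h1.integrable one_le_two
  have hYsq : Integrable (fun ω => Y ω ^ 2) (Measure.pi fun _ : Fin n => ν p) := h1.integrable_sq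
  -- Markov for Y² - Y: it is nonnegative on integers, at least 2 when Y ≥ 2, and has mean at most
  -- m² because the variance is at most the mean.
  have hmk := mul_meas_ge_le_integral_of_nonneg (μ := Measure.pi fun _ : Fin n => ν p)
    (f := fun ω => Y ω ^ 2 - Y ω) (.of_forall fun ω => by
      simp only [hYnat, Pi.zero_apply]
      rcases Nat.eq_zero_or_pos (∑ j ∈ G, ∑ i, X (ω i) j) with h | h
      · rw [h]; simp
      · have : (1 : ℝ) ≤ ((∑ j ∈ G, ∑ i, X (ω i) j : ℕ) : ℝ) := by exact_mod_cast h
        nlinarith) (hYsq.sub hYi) 2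
  rw [integral_sub hYsq hYi, h2] at hmk
  have hsub : {ω : Fin n → E | 2 ≤ ∑ j ∈ G, ∑ i, X (ω i) j} ⊆ {ω | 2 ≤ Y ω ^ 2 - Y ω} := by
    intro ω hω
    have : (2 : ℝ) ≤ Y ω := by rw [hYnat]; exact_mod_cast hω
    change 2 ≤ Y ω ^ 2 - Y ω
    nlinarith
  have hle := measureReal_mono (μ := Measure.pi fun _ : Fin n => ν p) hsub
  nlinarith [sq_nonneg m]

/-- Lower bound from the prior which moves the mass of each block to a random coordinate. -/
theorem CountModel.le_sepRadius_of_blocks (hM : CountModel ν Θ X) {p : Fin N → ℝ}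
    (hp : p ∈ Θ) {d : (Fin N → ℝ) → ℝ} {η s ε : ℝ} (hη : 0 < η)
    (hne : ∃ ρ, 0 < ρ ∧ minimaxRisk (fun q => Measure.pi fun _ : Fin n => ν q) Θ d p ρ ≤
      ENNReal.ofReal η) {ι : Type*} [Fintype ι] {G : ι → Finset (Fin N)}
    (hG : Pairwise fun a b => Disjoint (G a) (G b)) (hpos : ∀ b, 0 < ∑ k ∈ G b, p k)
    (hq : ∀ J : (b : ι) → G b, concentrate p G J ∈ Θ ∧ s ≤ d (p - concentrate p G J))
    (hε : ∑ b, (n * ∑ k ∈ G b, p k) ^ 2 ≤ ε) (hεη : η < 1 - ε) :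
    s ≤ sepRadius (fun q => Measure.pi fun _ : Fin n => ν q) Θ d p η := by
  classical
  have hnn := hM.nonneg p hp
  have hprobp := hM.prob_pi (n := n) hp
  have hprob := fun J => hM.prob_pi (n := n) (hq J).1
  set w : ((b : ι) → G b) → ℝ := fun J => ∏ b, (p (J b) / ∑ k ∈ G b, p k) with hw
  have hw0 : ∀ J, 0 ≤ w J := fun J =>
    Finset.prod_nonneg fun b _ => div_nonneg (hnn _) (hpos b).le
  have hw1 : ∑ J, w J = 1 := by
    have := sum_concentrate_monomial hG hpos (S := 0) (fun b => by simp)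
    simp only [Pi.zero_apply, pow_zero, Finset.prod_const_one, mul_one] at this
    exact this
  refine le_sepRadius_of_prior hne (fun q hq => hM.prob_pi hq) hp hη w hw0 hw1
    (fun J => concentrate p G J) (fun J => (hq J).1) (fun J => (hq J).2) hεη fun A _ => ?_
  obtain ⟨c, z, hc, hz, hdens⟩ := hM.density
  have hsing : ∀ q ∈ Θ, ∀ ω : Fin n → E, (Measure.pi fun _ : Fin n => ν q) {ω} =
      ENNReal.ofReal ((z (∑ j, q j) ^ n * ∏ i, c (ω i)) * ∏ j, q j ^ ∑ i, X (ω i) j) := by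
    intro q hq ω
    have := hM.prob q hq
    rw [Measure.pi_singleton]
    simp_rw [hdens q hq]
    rw [← ENNReal.ofReal_prod_of_nonneg fun i _ => mul_nonneg (mul_nonneg (hz _).le (hc _))
      (Finset.prod_nonneg fun j _ => pow_nonneg (hM.nonneg q hq j) _)]
    congr 1
    rw [Finset.prod_mul_distrib, Finset.prod_mul_distrib, Finset.prod_comm]
    simp [Finset.prod_pow_eq_pow_sum]
  set good : Set (Fin n → E) := {ω | ∀ b, ∑ j ∈ G b, ∑ i, X (ω i) j ≤ 1} with hgood
  set mix : Measure (Fin n → E) :=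
    ∑ J, ENNReal.ofReal (w J) • Measure.pi fun _ : Fin n => ν (concentrate p G J) with hmix
  have hmixA : ∀ B : Set (Fin n → E), mix B =
      ENNReal.ofReal (∑ J, w J * (Measure.pi fun _ : Fin n => ν (concentrate p G J)).real B) := by
    intro B
    simp only [hmix, Measure.coe_finsetSum, Finset.sum_apply, Measure.smul_apply, smul_eq_mul]
    rw [ENNReal.ofReal_sum_of_nonneg fun J _ => mul_nonneg (hw0 J) measureReal_nonneg]
    refine Finset.sum_congr rfl fun J _ => ?_
    have := hprob J
    rw [ENNReal.ofReal_mul (hw0 J), ofReal_measureReal]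
  -- On `good` every block is hit at most once, so mixture and null agree point by point;
  -- conservation of mass makes the factors z equal.
  have hgoodle : (Measure.pi fun _ : Fin n => ν p) (A ∩ good) ≤ mix (A ∩ good) := by
    rw [← one_mul ((Measure.pi fun _ : Fin n => ν p) (A ∩ good))]
    refine mul_measure_le_of_singleton fun ω hω => ?_
    rw [one_mul]
    have hrw : ∀ J, (Measure.pi fun _ : Fin n => ν (concentrate p G J)).real {ω} =
        (z (∑ j, p j) ^ n * ∏ i, c (ω i)) * ∏ j, concentrate p G J j ^ ∑ i, X (ω i) j := by
      intro J
      rw [measureReal_def, hsing _ (hq J).1, sum_concentrate hG, ENNReal.toReal_ofReal]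
      exact mul_nonneg (mul_nonneg (pow_nonneg (hz _).le _)
        (Finset.prod_nonneg fun i _ => hc _))
        (Finset.prod_nonneg fun j _ => pow_nonneg (concentrate_nonneg hnn J j) _)
    rw [hmixA, hsing p hp]
    refine ENNReal.ofReal_le_ofReal (le_of_eq ?_)
    rw [← sum_concentrate_monomial hG hpos hω.2, Finset.mul_sum]
    refine Finset.sum_congr rfl fun J _ => ?_
    rw [hrw]; ring
  have hmixle : (Measure.pi fun _ : Fin n => ν p).real (A ∩ good) ≤
      ∑ J, w J * (Measure.pi fun _ : Fin n => ν (concentrate p G J)).real A := by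
    rw [hmixA] at hgoodle
    have h1 := ENNReal.toReal_mono ENNReal.ofReal_ne_top hgoodle
    rw [ENNReal.toReal_ofReal (Finset.sum_nonneg fun J _ =>
      mul_nonneg (hw0 J) measureReal_nonneg)] at h1
    refine h1.trans (Finset.sum_le_sum fun J _ => ?_)
    have := hprob J
    exact mul_le_mul_of_nonneg_left (measureReal_mono Set.inter_subset_left) (hw0 J)
  have hbad : (Measure.pi fun _ : Fin n => ν p).real goodᶜ ≤ ε := by
    have hsub : goodᶜ = ⋃ b, {ω : Fin n → E | 2 ≤ ∑ j ∈ G b, ∑ i, X (ω i) j} := by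
      ext ω
      simp only [hgood, Set.mem_compl_iff, Set.mem_ofPred_eq, not_forall, not_le, Set.mem_iUnion]
      rfl
    rw [hsub]
    exact (measureReal_iUnion_fintype_le _).trans
      ((Finset.sum_le_sum fun b _ => hM.prob_two_le hp (G b)).trans hε)
  have hsplit : (Measure.pi fun _ : Fin n => ν p).real A ≤
      (Measure.pi fun _ : Fin n => ν p).real (A ∩ good) +
        (Measure.pi fun _ : Fin n => ν p).real goodᶜ := by
    refine (measureReal_mono fun ω hω => ?_).trans (measureReal_union_le _ _)
    by_cases h : ω ∈ good
    · exact Or.inl ⟨hω, h⟩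
    · exact Or.inr h
  linarith

end Lower

/-- Partition of small weights into blocks of comparable mass. -/
theorem exists_blocks {α : Type*} [DecidableEq α] {y : α → ℝ} {h : ℝ} (hh : 0 < h) :
    ∀ S : Finset α, (∀ j ∈ S, 0 ≤ y j) → (∀ j ∈ S, y j ≤ h) →
    ∃ 𝒢 : Finset (Finset α), (∀ G ∈ 𝒢, G ⊆ S ∧ h ≤ ∑ j ∈ G, y j ∧ ∑ j ∈ G, y j ≤ 2 * h) ∧
      (∀ G ∈ 𝒢, ∀ G' ∈ 𝒢, G ≠ G' → Disjoint G G') ∧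
      ∑ j ∈ S, y j ≤ 𝒢.card * (2 * h) + h := by
  intro S
  induction S using Finset.strongInduction with
  | H S ih =>
    intro hy hyh
    by_cases hS : ∑ j ∈ S, y j < h
    · exact ⟨∅, by simp, by simp, by simpa using hS.le⟩
    push Not at hS
    -- a minimal subset of mass at least `h`
    obtain ⟨G, hG, hmin⟩ : ∃ G : Finset α, (G ⊆ S ∧ h ≤ ∑ j ∈ G, y j) ∧
        ∀ G' : Finset α, (G' ⊆ S ∧ h ≤ ∑ j ∈ G', y j) → G.card ≤ G'.card := by
      have hne : (S.powerset.filter fun G => h ≤ ∑ j ∈ G, y j).Nonempty :=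
        ⟨S, by simp [hS]⟩
      obtain ⟨G, hG, hmin⟩ := Finset.exists_min_image _ Finset.card hne
      simp only [Finset.mem_filter, Finset.mem_powerset] at hG hmin
      exact ⟨G, hG, hmin⟩
    have hGne : G.Nonempty := by
      by_contra hcon
      rw [Finset.not_nonempty_iff_eq_empty] at hcon
      have := hG.2
      rw [hcon, Finset.sum_empty] at this
      linarith
    obtain ⟨j₀, hj₀⟩ := hGne
    -- By minimality, removing one element leaves mass below h, and that element weighs at most h.
    have hG2 : ∑ j ∈ G, y j ≤ 2 * h := by
      have hlt : ∑ j ∈ G.erase j₀, y j < h := by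
        by_contra! hcon
        have := hmin (G.erase j₀) ⟨(Finset.erase_subset _ _).trans hG.1, hcon⟩
        have h2 := Finset.card_erase_lt_of_mem hj₀
        omega
      have h3 := Finset.add_sum_erase G y hj₀
      have h4 := hyh j₀ (hG.1 hj₀)
      linarith
    have hss : S \ G ⊂ S := Finset.sdiff_ssubset hG.1 ⟨j₀, hj₀⟩
    obtain ⟨𝒢, h1, h2, h3⟩ := ih (S \ G) hss (fun j hj => hy j (Finset.sdiff_subset hj))
      (fun j hj => hyh j (Finset.sdiff_subset hj))
    have hdis : ∀ G' ∈ 𝒢, Disjoint G G' := fun G' hG' =>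
      Finset.disjoint_of_subset_right (h1 G' hG').1 Finset.disjoint_sdiff
    have hnot : G ∉ 𝒢 := fun hmem => by
      have := hdis G hmem
      rw [disjoint_self] at this
      rw [this] at hj₀
      exact absurd hj₀ (by simp)
    refine ⟨insert G 𝒢, ?_, ?_, ?_⟩
    · intro G' hG'
      rcases Finset.mem_insert.1 hG' with rfl | hG'
      · exact ⟨hG.1, hG.2, hG2⟩
      · exact ⟨(h1 G' hG').1.trans Finset.sdiff_subset, (h1 G' hG').2⟩
    · intro G₁ hG₁ G₂ hG₂ hne
      rcases Finset.mem_insert.1 hG₁ with h₁ | h₁ <;>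
        rcases Finset.mem_insert.1 hG₂ with h₂ | h₂
      · exact absurd (h₁.trans h₂.symm) hne
      · exact h₁ ▸ hdis _ h₂
      · exact h₂ ▸ (hdis _ h₁).symm
      · exact h2 _ h₁ _ h₂ hne
    · rw [Finset.card_insert_of_notMem hnot, ← Finset.sum_sdiff hG.1]
      push_cast
      linarith

/-! ### Tail and bulk terms as lower bounds -/

section Lower

variable {E : Type*} [MeasurableSpace E] [Countable E] [MeasurableSingletonClass E]
  {N n : ℕ} {ν : (Fin N → ℝ) → Measure E} {Θ : Set (Fin N → ℝ)} {X : E → Fin N → ℕ}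

/-- The tail term as a lower bound on the separation radius. -/
theorem CountModel.le_sepRadius_tail (hM : CountModel ν Θ X) (hn : 0 < n) {p : Fin N → ℝ}
    (hp : p ∈ Θ) {d : (Fin N → ℝ) → ℝ} {η t cI : ℝ} (hη : 0 < η) (hη1 : η < 1)
    (ht1 : 1 ≤ t) (hcI : cI ≤ (1 - η) / 32)
    (hne : ∃ ρ, 0 < ρ ∧ minimaxRisk (fun q => Measure.pi fun _ : Fin n => ν q) Θ d p ρ ≤
      ENNReal.ofReal η) (S : Finset (Fin N)) {T : ℝ} (hT : 1 ≤ T)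
    (hTS : T ≤ ∑ j ∈ S, n * p j + 1 / 4) (hTS' : ∑ j ∈ S, n * p j ≤ T)
    (hS2 : ∑ j ∈ S, (n * p j) ^ 2 ≤ cI)
    (hΘ : ∀ q : Fin N → ℝ, (∀ j, 0 ≤ q j) → ∑ j, q j = ∑ j, p j → q ∈ Θ)
    (hd : ∀ x, (∑ j ∈ S, |x j| ^ t) ^ (1 / t) ≤ d x) :
    (1 - η) / 16 * T ^ ((2 - t) / t) ≤
      n * sepRadius (fun q => Measure.pi fun _ : Fin n => ν q) Θ d p η := by
  classical
  have hnR : (0 : ℝ) < n := by exact_mod_cast hn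
  have ht0 : 0 < t := by linarith
  have hnn := hM.nonneg p hp
  set y : Fin N → ℝ := fun j => n * p j with hy
  have hy0 : ∀ j, 0 ≤ y j := fun j => mul_nonneg hnR.le (hnn j)
  set κ := (1 - η) / 4 with hκ
  have hκ0 : 0 < κ := by rw [hκ]; linarith
  have hκ1 : κ ≤ 1 / 4 := by rw [hκ]; linarith
  have hcκ : cI ≤ κ / 8 := by rw [hκ]; linarith
  have hT0 : 0 < T := by linarith
  -- Blocks of mass between h and 2h have total collision probability at most 2 h T = 2 κ = (1 -
  -- η)/2.
  set h := κ / T with hh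
  have hh0 : 0 < h := div_pos hκ0 hT0
  have hhT : h * T = κ := by rw [hh]; field_simp
  have hhκ : h ≤ κ := div_le_self hκ0.le hT
  -- By the ℓ² bound, coordinates above h/2 carry mass at most 2 cI/h ≤ T/4. Without them, a chosen
  -- coordinate gains at least h - h/2.
  set S' := S.filter fun j => y j ≤ h / 2 with hS'
  have hS'sum : T / 2 ≤ ∑ j ∈ S', y j := by
    have hsplit := Finset.sum_filter_add_sum_filter_not S (fun j => y j ≤ h / 2) y
    have hbad : ∑ j ∈ S.filter (fun j => ¬ y j ≤ h / 2), y j ≤ T / 4 := by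
      have h1 : h / 2 * ∑ j ∈ S.filter (fun j => ¬ y j ≤ h / 2), y j ≤ cI := by
        refine le_trans ?_ hS2
        rw [Finset.mul_sum]
        refine (Finset.sum_le_sum (f := fun j => h / 2 * y j) (g := fun j => y j ^ 2)
          fun j hj => ?_).trans
          (Finset.sum_le_sum_of_subset_of_nonneg (Finset.filter_subset _ _)
            fun j _ _ => sq_nonneg _)
        have : h / 2 < y j := not_le.1 (Finset.mem_filter.1 hj).2
        nlinarith [hy0 j]
      have h2 : h / 2 * (T / 4) = κ / 8 := by rw [← hhT]; ring
      have h3 : 0 < h / 2 := by positivity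
      exact le_of_mul_le_mul_left (by linarith) h3
    change T ≤ ∑ j ∈ S, y j + 1 / 4 at hTS
    linarith
  obtain ⟨𝒢, hG1, hG2, hG3⟩ := exists_blocks (y := y) hh0 S' (fun j _ => hy0 j)
    (fun j hj => ((Finset.mem_filter.1 hj).2).trans (by linarith))
  -- The mass left outside the blocks is at most h ≤ κ ≤ 1/4 ≤ T/4, so the blocks still cover T/4.
  have hcard : T ^ 2 / (8 * κ) ≤ 𝒢.card := by
    have h1 : T / 4 ≤ 𝒢.card * (2 * h) := by linarith
    have h2 : T / 4 * T ≤ 𝒢.card * (2 * h) * T := mul_le_mul_of_nonneg_right h1 hT0.le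
    have h3 : (𝒢.card : ℝ) * (2 * h) * T = 𝒢.card * (2 * κ) := by rw [← hhT]; ring
    rw [div_le_iff₀ (by positivity)]
    nlinarith
  have hsumG : ∀ G : Finset (Fin N), ∑ k ∈ G, y k = n * ∑ k ∈ G, p k := fun G => by
    rw [Finset.mul_sum]
  have hdis : Pairwise fun a b : 𝒢 => Disjoint (a : Finset (Fin N)) b := fun a b hab =>
    hG2 a a.2 b b.2 fun h => hab (Subtype.ext h)
  have hpos : ∀ b : 𝒢, 0 < ∑ k ∈ (b : Finset (Fin N)), p k := fun b => by
    have := (hG1 b b.2).2.1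
    rw [hsumG] at this
    exact pos_of_mul_pos_right (hh0.trans_le this) hnR.le
  have key := hM.le_sepRadius_of_blocks hp hη hne (G := fun b : 𝒢 => (b : Finset (Fin N))) hdis
    hpos (s := (1 - η) / 16 * T ^ ((2 - t) / t) / n) (ε := 2 * κ) (fun J => ⟨?_, ?_⟩) ?_
    (by rw [hκ]; linarith)
  · rwa [div_le_iff₀' hnR] at key
  · exact hΘ _ (concentrate_nonneg hnn J) (sum_concentrate hdis J)
  · refine le_trans ?_ (hd _)
    set f : Fin N → ℝ := fun j => |(p - concentrate p (fun b : 𝒢 => (b : Finset (Fin N))) J) j| ^ t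
    have hJinj : Function.Injective fun b : 𝒢 => (J b : Fin N) := fun a b hab => by
      by_contra hne
      have hab' : (J a : Fin N) = J b := hab
      exact Finset.disjoint_left.1 (hdis hne) (J a).2 (hab' ▸ (J b).2)
    have hfJ : ∀ b : 𝒢, (h / (2 * n)) ^ t ≤ f (J b) := fun b => by
      refine Real.rpow_le_rpow (by positivity) ?_ ht0.le
      rw [Pi.sub_apply, concentrate_of_mem hdis J (J b).2, if_pos rfl, abs_sub_comm]
      refine le_trans ?_ (le_abs_self _)
      have h1 := (hG1 b b.2).2.1
      have h2 : y (J b) ≤ h / 2 := (Finset.mem_filter.1 ((hG1 b b.2).1 (J b).2)).2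
      rw [hsumG] at h1
      rw [div_le_iff₀ (by positivity)]
      change n * p (J b) ≤ h / 2 at h2
      nlinarith
    have hsum : (𝒢.card : ℝ) * (h / (2 * n)) ^ t ≤ ∑ j ∈ S, f j := by
      calc (𝒢.card : ℝ) * (h / (2 * n)) ^ t = ∑ _b : 𝒢, (h / (2 * n)) ^ t := by simp
        _ ≤ ∑ b : 𝒢, f (J b) := Finset.sum_le_sum fun b _ => hfJ b
        _ = ∑ j ∈ Finset.univ.image (fun b : 𝒢 => (J b : Fin N)), f j := by
          rw [Finset.sum_image fun a _ b _ hab => hJinj hab]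
        _ ≤ ∑ j ∈ S, f j := by
          refine Finset.sum_le_sum_of_subset_of_nonneg ?_ fun j _ _ =>
            Real.rpow_nonneg (abs_nonneg _) _
          intro j hj
          obtain ⟨b, _, rfl⟩ := Finset.mem_image.1 hj
          exact Finset.filter_subset _ _ ((hG1 b b.2).1 (J b).2)
    refine le_trans ?_ (Real.rpow_le_rpow (by positivity)
      ((mul_le_mul_of_nonneg_right hcard (by positivity)).trans hsum) (by positivity))
    rw [Real.mul_rpow (by positivity) (by positivity), ← Real.rpow_mul (by positivity),
      mul_one_div_cancel ht0.ne', Real.rpow_one, Real.div_rpow (by positivity) (by positivity),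
      ← Real.rpow_natCast, ← Real.rpow_mul hT0.le]
    have e1 : ((2 : ℕ) : ℝ) * (1 / t) = (2 - t) / t + 1 := by push_cast; field_simp; ring
    rw [e1, Real.rpow_add hT0, Real.rpow_one, hh]
    have h8 : (8 * κ) ^ (1 / t) ≤ 2 := by
      calc (8 * κ) ^ (1 / t) ≤ 2 ^ (1 / t) :=
            Real.rpow_le_rpow (by positivity) (by linarith) (by positivity)
        _ ≤ (2 : ℝ) ^ (1 : ℝ) := Real.rpow_le_rpow_of_exponent_le one_le_two
            (by rw [div_le_one ht0]; exact ht1)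
        _ = 2 := Real.rpow_one 2
    have h80 : 0 < (8 * κ) ^ (1 / t) := by positivity
    have hκ16 : (1 - η) / 16 = κ / 4 := by rw [hκ]; ring
    rw [hκ16]
    have hTe : 0 < T ^ ((2 - t) / t) := by positivity
    calc κ / 4 * T ^ ((2 - t) / t) / n = T ^ ((2 - t) / t) * T / 2 * (κ / T / (2 * n)) := by
          field_simp; ring
      _ ≤ T ^ ((2 - t) / t) * T / (8 * κ) ^ (1 / t) * (κ / T / (2 * n)) := by gcongr
  · have h1 : ∀ b : 𝒢, (n * ∑ k ∈ (b : Finset (Fin N)), p k) ^ 2 ≤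
        2 * h * ∑ k ∈ (b : Finset (Fin N)), y k := fun b => by
      rw [← hsumG, sq]
      exact mul_le_mul_of_nonneg_right (hG1 b b.2).2.2 (Finset.sum_nonneg fun j _ => hy0 j)
    refine (Finset.sum_le_sum fun b _ => h1 b).trans ?_
    rw [← Finset.mul_sum]
    have h2 : ∑ b : 𝒢, ∑ k ∈ (b : Finset (Fin N)), y k ≤ T := by
      rw [← Finset.sum_biUnion fun a _ b _ hab => hdis hab]
      refine le_trans ?_ hTS'
      refine Finset.sum_le_sum_of_subset_of_nonneg ?_ fun j _ _ => hy0 j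
      intro j hj
      obtain ⟨b, _, hb⟩ := Finset.mem_biUnion.1 hj
      exact Finset.filter_subset _ _ ((hG1 b b.2).1 hb)
    calc 2 * h * ∑ b : 𝒢, ∑ k ∈ (b : Finset (Fin N)), y k ≤ 2 * h * T := by gcongr
      _ = 2 * κ := by rw [← hhT]; ring

/-- The bulk term as a lower bound on the separation radius, unless it is dominated by the other
terms. -/
theorem CountModel.le_sepRadius_bulk (hM : CountModel ν Θ X) (hn : 0 < n) {p : Fin N → ℝ}
    (hp : p ∈ Θ) {d : (Fin N → ℝ) → ℝ} {η t cI u T : ℝ} (hη : 0 < η) (hη1 : η < 1)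
    (ht1 : 1 ≤ t) (ht2 : t ≤ 2) (hcI : 0 < cI) (hcI1 : cI ≤ 1)
    (hne : ∃ ρ, 0 < ρ ∧ minimaxRisk (fun q => Measure.pi fun _ : Fin n => ν q) Θ d p ρ ≤
      ENNReal.ofReal η) (K : Finset (Fin N)) (hK : K.Nonempty) (hu : 0 < u)
    (hyu : ∀ j ∈ K, u ≤ n * p j) (hT : 0 ≤ T) (huT : cI ≤ u * (u + T))
    (e : Fin N → Fin N → ℝ) (horth : ∀ j ∈ K, ∀ k ∈ K, j ≠ k → ∀ l, e j l * e k l = 0)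
    (hsupp : ∀ j ∈ K, ∀ l, p l = 0 → e j l = 0) (hsq : ∀ j ∈ K, ∑ l, e j l ^ 2 / p l ≤ 2 / p j)
    (hΘ : ∀ g : Fin N → ℝ, (∀ j ∈ K, |g j| ≤ p j) → (fun l => p l + ∑ j ∈ K, g j * e j l) ∈ Θ ∧
      (∑ j ∈ K, |g j| ^ t) ^ (1 / t) ≤ d (p - fun l => p l + ∑ j ∈ K, g j * e j l)) :
    (1 - η) / 4 * (∑ j ∈ K, (n * p j) ^ (2 * t / (4 - t))) ^ ((4 - t) / (4 * t)) ≤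
      n * sepRadius (fun q => Measure.pi fun _ : Fin n => ν q) Θ d p η ∨
    cI * (∑ j ∈ K, (n * p j) ^ (2 * t / (4 - t))) ^ ((4 - t) / (4 * t)) ≤
      1 + T ^ ((2 - t) / t) := by
  classical
  have hnR : (0 : ℝ) < n := by exact_mod_cast hn
  have ht0 : 0 < t := by linarith
  have h4t : 0 < 4 - t := by linarith
  set y : Fin N → ℝ := fun j => n * p j with hy
  have hypos : ∀ j ∈ K, 0 < y j := fun j hj => hu.trans_le (hyu j hj)
  have hppos : ∀ j ∈ K, 0 < p j := fun j hj => pos_of_mul_pos_right (hypos j hj) hnR.le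
  set S := ∑ j ∈ K, y j ^ (2 * t / (4 - t)) with hS
  have hSpos : 0 < S := Finset.sum_pos (fun j hj => Real.rpow_pos_of_pos (hypos j hj) _) hK
  set τ := (1 - η) / 2 with hτ
  have hτ0 : 0 < τ := by rw [hτ]; linarith
  have hτ1 : τ ≤ 1 / 2 := by rw [hτ]; linarith
  -- The χ² exponent will be at most 2c, and exp(2c) ≤ 1 + 4c = 1 + τ².
  set c := τ ^ 2 / 4 with hc
  have hc0 : 0 < c := by positivity
  have hc1 : c ≤ 1 / 16 := by rw [hc]; nlinarith
  set a := (c / S) ^ (1 / 4 : ℝ) with ha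
  have ha0 : 0 < a := Real.rpow_pos_of_pos (div_pos hc0 hSpos) _
  have ha4 : a ^ 4 = c / S := by
    rw [ha, ← Real.rpow_natCast, ← Real.rpow_mul (div_pos hc0 hSpos).le]; norm_num
  -- This condition says that the perturbation a y_j^(2/(4-t)) does not exceed y_j.
  by_cases hall : ∀ j ∈ K, a ≤ y j ^ ((2 - t) / (4 - t))
  · left
    -- The exponent 2/(4-t) maximises Σ γ^t for a given χ² cost Σ γ⁴/y².
    set γ : Fin N → ℝ := fun j => if j ∈ K then a * y j ^ (2 / (4 - t)) / n else 0 with hγ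
    have hγK : ∀ j ∈ K, γ j = a * y j ^ (2 / (4 - t)) / n := fun j hj => by simp [hγ, hj]
    have hγ0 : ∀ j, 0 ≤ γ j := fun j => by
      simp only [hγ]; split_ifs with hj
      · have := hypos j hj; positivity
      · exact le_rfl
    have hγp : ∀ j ∈ K, γ j ≤ p j := fun j hj => by
      rw [hγK j hj, div_le_iff₀ hnR]
      calc a * y j ^ (2 / (4 - t)) ≤ y j ^ ((2 - t) / (4 - t)) * y j ^ (2 / (4 - t)) :=
            mul_le_mul_of_nonneg_right (hall j hj) (Real.rpow_nonneg (hypos j hj).le _)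
        _ = y j := by
            rw [← Real.rpow_add (hypos j hj)]
            have : (2 - t) / (4 - t) + 2 / (4 - t) = 1 := by field_simp; ring
            rw [this, Real.rpow_one]
        _ = p j * n := by rw [hy]; ring
    have hsum : ∀ (σ : Fin N → ℝ) l, ∑ j, σ j * (γ j * e j l) =
        ∑ j ∈ K, (σ j * γ j) * e j l := fun σ l => by
      rw [← Finset.sum_subset (Finset.subset_univ K)]
      · exact Finset.sum_congr rfl fun j _ => by ring
      · intro j _ hj; simp [hγ, hj]
    have hsep : (1 - η) / 4 * S ^ ((4 - t) / (4 * t)) / n ≤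
        (∑ j ∈ K, γ j ^ t) ^ (1 / t) := by
      have h1 : ∑ j ∈ K, γ j ^ t = (a / n) ^ t * S := by
        rw [hS, Finset.mul_sum]
        refine Finset.sum_congr rfl fun j hj => ?_
        have hyj := hypos j hj
        rw [hγK j hj, mul_div_right_comm, Real.mul_rpow (by positivity) (by positivity),
          ← Real.rpow_mul hyj.le]
        congr 2; ring
      rw [h1, Real.mul_rpow (by positivity) hSpos.le, ← Real.rpow_mul (by positivity),
        mul_one_div_cancel ht0.ne', Real.rpow_one, ha, Real.div_rpow hc0.le hSpos.le]
      have h2 : S ^ (1 / t) = S ^ ((4 - t) / (4 * t)) * S ^ (1 / 4 : ℝ) := by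
        rw [← Real.rpow_add hSpos]; congr 1; field_simp; ring
      have h3 : (1 - η) / 4 ≤ c ^ (1 / 4 : ℝ) := by
        have h5 : c = (τ / 2) ^ (2 : ℝ) := by rw [hc, Real.rpow_two]; ring
        rw [h5, ← Real.rpow_mul (by positivity)]
        have h6 : (1 - η) / 4 = τ / 2 := by rw [hτ]; ring
        rw [h6]
        have := Real.rpow_le_rpow_of_exponent_ge (by positivity : 0 < τ / 2) (by linarith)
          (by norm_num : (2 * (1 / 4) : ℝ) ≤ 1)
        rwa [Real.rpow_one] at this
      have hS4 : 0 < S ^ (1 / 4 : ℝ) := Real.rpow_pos_of_pos hSpos _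
      have hSg : 0 < S ^ ((4 - t) / (4 * t)) := Real.rpow_pos_of_pos hSpos _
      rw [h2]
      calc (1 - η) / 4 * S ^ ((4 - t) / (4 * t)) / n
          ≤ c ^ (1 / 4 : ℝ) * S ^ ((4 - t) / (4 * t)) / n := by gcongr
        _ = _ := by field_simp
    have key := hM.le_sepRadius_of_directions hp hη hne hτ0 (by rw [hτ]; linarith)
      (s := (1 - η) / 4 * S ^ ((4 - t) / (4 * t)) / n) (fun j l => γ j * e j l) ?_ ?_
      (fun σ hσ => ?_) ?_
    · rwa [div_le_iff₀' hnR] at key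
    · intro j k hjk l
      by_cases hj : j ∈ K
      · by_cases hk : k ∈ K
        · rw [mul_mul_mul_comm, horth j hj k hk hjk l, mul_zero]
        · simp [hγ, hk]
      · simp [hγ, hj]
    · intro j l hl
      by_cases hj : j ∈ K
      · simp only [hsupp j hj l hl, mul_zero]
      · simp [hγ, hj]
    · have habs : ∀ j, |σ j * γ j| = γ j := fun j => by
        rw [abs_mul, hσ, one_mul, abs_of_nonneg (hγ0 j)]
      have h1 := hΘ (fun j => σ j * γ j) fun j hj => by rw [habs]; exact hγp j hj
      simp_rw [habs] at h1
      simp_rw [hsum]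
      exact ⟨h1.1, hsep.trans h1.2⟩
    · have hterm : ∀ j, (n * ∑ l, (γ j * e j l) ^ 2 / p l) ^ 2 / 2 ≤
          if j ∈ K then 2 * a ^ 4 * y j ^ (2 * t / (4 - t)) else 0 := fun j => by
        split_ifs with hj
        · have hyj := hypos j hj
          have hpj := hppos j hj
          have h1 : ∑ l, (γ j * e j l) ^ 2 / p l = γ j ^ 2 * ∑ l, e j l ^ 2 / p l := by
            rw [Finset.mul_sum]
            exact Finset.sum_congr rfl fun l _ => by ring
          have h2 : 0 ≤ ∑ l, e j l ^ 2 / p l :=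
            Finset.sum_nonneg fun l _ => div_nonneg (sq_nonneg _) (hM.nonneg p hp l)
          have h3 : n * (γ j ^ 2 * ∑ l, e j l ^ 2 / p l) ≤
              2 * (a * y j ^ (2 / (4 - t))) ^ 2 / y j := by
            calc n * (γ j ^ 2 * ∑ l, e j l ^ 2 / p l) ≤ n * (γ j ^ 2 * (2 / p j)) := by
                  gcongr; exact hsq j hj
              _ = _ := by
                  rw [hγK j hj]
                  change _ = 2 * (a * y j ^ (2 / (4 - t))) ^ 2 / (n * p j)
                  field_simp
          rw [h1]
          calc (n * (γ j ^ 2 * ∑ l, e j l ^ 2 / p l)) ^ 2 / 2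
              ≤ (2 * (a * y j ^ (2 / (4 - t))) ^ 2 / y j) ^ 2 / 2 := by
                gcongr
            _ = 2 * a ^ 4 * ((y j ^ (2 / (4 - t))) ^ 4 / y j ^ 2) := by field_simp
            _ = _ := by
                congr 1
                rw [← Real.rpow_natCast, ← Real.rpow_natCast, ← Real.rpow_mul hyj.le,
                  ← Real.rpow_sub hyj]
                congr 1; push_cast; field_simp; ring
        · simp [hγ, hj]
      have h1 : ∑ j, (n * ∑ l, (γ j * e j l) ^ 2 / p l) ^ 2 / 2 ≤ 2 * c := by
        refine (Finset.sum_le_sum fun j _ => hterm j).trans (le_of_eq ?_)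
        rw [Finset.sum_ite_mem, Finset.univ_inter, ← Finset.mul_sum, ha4]
        change 2 * (c / S) * S = 2 * c
        field_simp
      refine (Real.exp_le_exp.2 h1).trans ?_
      have h2 := Real.abs_exp_sub_one_le (x := 2 * c) (by rw [abs_of_pos (by positivity)]; linarith)
      rw [abs_of_pos (by positivity : 0 < 2 * c)] at h2
      have h3 := (abs_le.1 h2).2
      have h4 : τ ^ 2 = 4 * c := by rw [hc]; ring
      linarith
  -- Some bulk coordinate is too small. Then u^((2-t)/(4-t)) ≤ a bounds S by a power of 1/u and
  -- forces u ≤ 1, so cI ≤ u (u + T) gives 1/u ≤ (1 + T)/cI.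
  · right
    push Not at hall
    obtain ⟨j, hj, hlt⟩ := hall
    have he0 : 0 ≤ (2 - t) / t := div_nonneg (by linarith) ht0.le
    have he1 : (2 - t) / t ≤ 1 := by rw [div_le_one ht0]; linarith
    have hub : u ^ ((2 - t) / (4 - t)) ≤ a :=
      (Real.rpow_le_rpow hu.le (hyu j hj) (div_nonneg (by linarith) h4t.le)).trans hlt.le
    have hSu : S * u ^ (4 * ((2 - t) / (4 - t))) ≤ 1 := by
      have h1 : u ^ (4 * ((2 - t) / (4 - t))) ≤ c / S := by
        rw [← ha4, mul_comm, Real.rpow_mul hu.le]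
        have := pow_le_pow_left₀ (Real.rpow_nonneg hu.le _) hub 4
        exact_mod_cast this
      calc S * u ^ (4 * ((2 - t) / (4 - t))) ≤ S * (c / S) := by gcongr
        _ = c := by field_simp
        _ ≤ 1 := by linarith
    have hSu' : u ^ (2 * t / (4 - t)) ≤ S :=
      (Real.rpow_le_rpow hu.le (hyu j hj) (by positivity)).trans
        (Finset.single_le_sum (f := fun j => y j ^ (2 * t / (4 - t)))
          (fun i hi => Real.rpow_nonneg (hypos i hi).le _) hj)
    have hu1 : u ≤ 1 := by
      have h1 : u ^ 2 ≤ 1 := by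
        refine le_trans ?_ hSu
        calc u ^ 2 = u ^ (2 * t / (4 - t)) * u ^ (4 * ((2 - t) / (4 - t))) := by
              rw [← Real.rpow_add hu, ← Real.rpow_natCast]
              congr 1; push_cast; field_simp; ring
          _ ≤ _ := mul_le_mul_of_nonneg_right hSu' (Real.rpow_nonneg hu.le _)
      nlinarith
    have hSg : S ^ ((4 - t) / (4 * t)) ≤ (u⁻¹) ^ ((2 - t) / t) := by
      have h1 : S ≤ (u⁻¹) ^ (4 * ((2 - t) / (4 - t))) := by
        rw [Real.inv_rpow hu.le, ← one_div, le_div_iff₀ (Real.rpow_pos_of_pos hu _)]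
        exact hSu
      refine (Real.rpow_le_rpow hSpos.le h1 (by positivity)).trans (le_of_eq ?_)
      rw [← Real.rpow_mul (by positivity)]
      congr 1; field_simp
    have huinv : u⁻¹ ≤ (1 + T) / cI := by
      rw [inv_eq_one_div, div_le_div_iff₀ hu hcI]
      nlinarith
    have h1 : S ^ ((4 - t) / (4 * t)) ≤ (1 + T ^ ((2 - t) / t)) / cI := by
      refine hSg.trans ((Real.rpow_le_rpow (by positivity) huinv he0).trans ?_)
      rw [Real.div_rpow (by linarith) hcI.le]
      have h2 : cI ≤ cI ^ ((2 - t) / t) := by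
        simpa using Real.rpow_le_rpow_of_exponent_ge hcI hcI1 he1
      have h3 : (1 + T) ^ ((2 - t) / t) ≤ 1 + T ^ ((2 - t) / t) := by
        have := Real.rpow_add_le_add_rpow zero_le_one hT he0 he1
        simpa using this
      have h4 : 0 ≤ T ^ ((2 - t) / t) := Real.rpow_nonneg hT _
      gcongr
    rw [le_div_iff₀ hcI] at h1
    linarith

end Lower

/-! ### Assembly of the lower bound -/

section Lower

variable {E : Type*} [MeasurableSpace E] [Countable E] [MeasurableSingletonClass E]
  {N n : ℕ} {ν : (Fin N → ℝ) → Measure E} {Θ : Set (Fin N → ℝ)} {X : E → Fin N → ℕ}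

/-- The rate is a lower bound on the separation radius, up to a constant, in any count model in
which the parametric rate is a lower bound and which has enough orthogonal perturbations. -/
theorem CountModel.rate_le_sepRadius (hM : CountModel ν Θ X) (hn : 0 < n) {p : Fin N → ℝ}
    (hp : p ∈ Θ) (hanti : Antitone p) {d : (Fin N → ℝ) → ℝ} {η t cI : ℝ} (hη : 0 < η)
    (hη1 : η < 1) (ht1 : 1 ≤ t) (ht2 : t ≤ 2) (hcI : 0 < cI) (hcI1 : cI ≤ (1 - η) / 32)
    (hne : ∃ ρ, 0 < ρ ∧ minimaxRisk (fun q => Measure.pi fun _ : Fin n => ν q) Θ d p ρ ≤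
      ENNReal.ofReal η)
    (hpar : (1 - η) / 16 ≤ n * sepRadius (fun q => Measure.pi fun _ : Fin n => ν q) Θ d p η)
    (S : Finset (Fin N)) (hS : S ⊆ tailSet N (cutoff cI n p))
    (hTS : ∑ j ∈ tailSet N (cutoff cI n p), n * p j ≤ ∑ j ∈ S, n * p j + 1 / 4)
    (hΘS : ∀ q : Fin N → ℝ, (∀ j, 0 ≤ q j) → ∑ j, q j = ∑ j, p j → q ∈ Θ)
    (hdS : ∀ x, (∑ j ∈ S, |x j| ^ t) ^ (1 / t) ≤ d x)
    (B K : Finset (Fin N)) (hKI : ∀ j ∈ K, (j : ℕ) + 1 ≤ cutoff cI n p)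
    (hBK : ∑ j ∈ B, (n * p j) ^ (2 * t / (4 - t)) ≤ 2 * ∑ j ∈ K, (n * p j) ^ (2 * t / (4 - t)))
    (e : Fin N → Fin N → ℝ) (horth : ∀ j ∈ K, ∀ k ∈ K, j ≠ k → ∀ l, e j l * e k l = 0)
    (hsupp : ∀ j ∈ K, 0 < p j → ∀ l, p l = 0 → e j l = 0)
    (hsq : ∀ j ∈ K, 0 < p j → ∑ l, e j l ^ 2 / p l ≤ 2 / p j)
    (hΘ : ∀ g : Fin N → ℝ, (∀ j ∈ K, |g j| ≤ p j) → (fun l => p l + ∑ j ∈ K, g j * e j l) ∈ Θ ∧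
      (∑ j ∈ K, |g j| ^ t) ^ (1 / t) ≤ d (p - fun l => p l + ∑ j ∈ K, g j * e j l)) :
    (1 - η) / 96 * cI * rate t n (restrict B p) (restrict (tailSet N (cutoff cI n p)) p) ≤
      sepRadius (fun q => Measure.pi fun _ : Fin n => ν q) Θ d p η := by
  have hnR : (0 : ℝ) < n := by exact_mod_cast hn
  have ht0 : 0 < t := by linarith
  have hnn := hM.nonneg p hp
  have hrate := natCast_mul_rate_restrict hn ht1 ht2 hnn B (tailSet N (cutoff cI n p))
  have hy0 : ∀ j, 0 ≤ (n : ℝ) * p j := fun j => mul_nonneg hnR.le (hnn j)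
  have hcI1' : cI ≤ 1 := by linarith
  set ρ := sepRadius (fun q => Measure.pi fun _ : Fin n => ν q) Θ d p η with hρ
  set T := ∑ j ∈ tailSet N (cutoff cI n p), (n : ℝ) * p j with hT
  set SB := ∑ j ∈ B, (n * p j) ^ (2 * t / (4 - t)) with hSB
  set SK := ∑ j ∈ K, (n * p j) ^ (2 * t / (4 - t)) with hSK
  have hT0 : 0 ≤ T := Finset.sum_nonneg fun j _ => hy0 j
  have hSB0 : 0 ≤ SB := Finset.sum_nonneg fun j _ => Real.rpow_nonneg (hy0 j) _
  have hSK0 : 0 ≤ SK := Finset.sum_nonneg fun j _ => Real.rpow_nonneg (hy0 j) _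
  have he0 : 0 ≤ (2 - t) / t := div_nonneg (by linarith) ht0.le
  have hTe0 : 0 ≤ T ^ ((2 - t) / t) := Real.rpow_nonneg hT0 _
  have htail : (1 - η) / 16 * T ^ ((2 - t) / t) ≤ n * ρ := by
    -- For T ≤ 1 the tail term is at most 1 and the parametric bound covers it.
    rcases le_total T 1 with hT1 | hT1
    · have h1 : T ^ ((2 - t) / t) ≤ 1 := Real.rpow_le_one hT0 hT1 he0
      refine le_trans (mul_le_of_le_one_right (by linarith) h1) hpar
    · exact hM.le_sepRadius_tail hn hp hη hη1 ht1 hcI1 hne S hT1 hTS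
        (Finset.sum_le_sum_of_subset_of_nonneg hS fun j _ _ => hy0 j)
        ((Finset.sum_le_sum_of_subset_of_nonneg hS fun j _ _ => sq_nonneg _).trans
          (sum_tail_scaled_sq_le hn hcI.le)) hΘS hdS
  have hg0 : 0 < (4 - t) / (4 * t) := div_pos (by linarith) (by linarith)
  have hg1 : (4 - t) / (4 * t) ≤ 1 := by rw [div_le_one (by linarith)]; linarith
  have hBK' : SB ^ ((4 - t) / (4 * t)) ≤ 2 * SK ^ ((4 - t) / (4 * t)) := by
    refine (Real.rpow_le_rpow hSB0 hBK hg0.le).trans ?_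
    rw [Real.mul_rpow zero_le_two hSK0]
    refine mul_le_mul_of_nonneg_right ?_ (Real.rpow_nonneg hSK0 _)
    simpa using Real.rpow_le_rpow_of_exponent_le one_le_two hg1
  have hSBg : 0 ≤ SB ^ ((4 - t) / (4 * t)) := Real.rpow_nonneg hSB0 _
  have hbulk : (1 - η) / 16 * cI * SB ^ ((4 - t) / (4 * t)) ≤ 4 * (n * ρ) := by
    rcases K.eq_empty_or_nonempty with hKe | hKne
    · have hz : SK = 0 := by rw [hSK, hKe, Finset.sum_empty]
      rw [hz, Real.zero_rpow hg0.ne', mul_zero] at hBK'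
      have : SB ^ ((4 - t) / (4 * t)) = 0 := le_antisymm hBK' hSBg
      rw [this, mul_zero]
      linarith
    · obtain ⟨j, hj⟩ := hKne
      obtain ⟨u, hu, hyu, huT⟩ := exists_bulk_bound hn hcI hnn hanti (by
        have := hKI j hj; omega)
      have hpos : ∀ j ∈ K, 0 < p j := fun j hj =>
        pos_of_mul_pos_right (hu.trans_le (hyu j (hKI j hj))) hnR.le
      rcases hM.le_sepRadius_bulk hn hp hη hη1 ht1 ht2 hcI hcI1' hne K ⟨j, hj⟩ hu
        (fun j hj => hyu j (hKI j hj)) hT0 huT e horth (fun j hj => hsupp j hj (hpos j hj))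
        (fun j hj => hsq j hj (hpos j hj)) hΘ with h | h
      · have h1 : (1 - η) / 16 * SB ^ ((4 - t) / (4 * t)) ≤ n * ρ := by
          have := mul_le_mul_of_nonneg_left hBK' (by linarith : 0 ≤ (1 - η) / 16)
          nlinarith [Real.rpow_nonneg hSK0 ((4 - t) / (4 * t))]
        have h2 := mul_nonneg (by linarith : 0 ≤ (1 - η) / 16) hSBg
        nlinarith
      · have h1 : cI * SB ^ ((4 - t) / (4 * t)) ≤ 2 * (1 + T ^ ((2 - t) / t)) := by
          have := mul_le_mul_of_nonneg_left hBK' hcI.le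
          linarith
        have h2 := mul_le_mul_of_nonneg_left h1 (by linarith : 0 ≤ (1 - η) / 16)
        linarith
  -- After scaling by cI (1 - η)/16, bulk, tail and constant terms are at most 4, 1 and 1 times n ρ,
  -- whence 96 = 6 · 16.
  have hfin : n * ((1 - η) / 96 * cI * rate t n (restrict B p)
      (restrict (tailSet N (cutoff cI n p)) p)) ≤ n * ρ := by
    have h1 : n * ((1 - η) / 96 * cI * rate t n (restrict B p)
      (restrict (tailSet N (cutoff cI n p)) p)) = (1 - η) / 96 * cI *
      (SB ^ ((4 - t) / (4 * t)) + T ^ ((2 - t) / t) + 1) := by rw [← hrate]; ring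
    rw [h1]
    have h2 : cI * ((1 - η) / 16) ≤ (1 - η) / 16 := mul_le_of_le_one_left (by linarith) hcI1'
    have h3 : cI * ((1 - η) / 16 * T ^ ((2 - t) / t)) ≤ (1 - η) / 16 * T ^ ((2 - t) / t) :=
      mul_le_of_le_one_left (mul_nonneg (by linarith) hTe0) hcI1'
    linarith
  exact le_of_mul_le_mul_left hfin hnR

end Lower

/-! ### Norms as sums over index sets -/

theorem rpow_sum_le_add {ι : Type*} [DecidableEq ι] {U B S : Finset ι} (hU : U ⊆ B ∪ S)
    (x : ι → ℝ) {t : ℝ} (ht : 1 ≤ t) :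
    (∑ j ∈ U, |x j| ^ t) ^ (1 / t) ≤
      (∑ j ∈ B, |x j| ^ t) ^ (1 / t) + (∑ j ∈ S, |x j| ^ t) ^ (1 / t) := by
  have h0 : ∀ W : Finset ι, 0 ≤ ∑ j ∈ W, |x j| ^ t := fun W =>
    Finset.sum_nonneg fun j _ => Real.rpow_nonneg (abs_nonneg _) _
  have ht0 : 0 < t := by linarith
  refine le_trans (Real.rpow_le_rpow (h0 U) ?_ (by positivity))
    (Real.rpow_add_le_add_rpow (h0 B) (h0 S) (by positivity) ((div_le_one ht0).2 ht))
  refine (Finset.sum_le_sum_of_subset_of_nonneg hU fun j _ _ =>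
    Real.rpow_nonneg (abs_nonneg _) _).trans ?_
  rw [← Finset.sum_union_inter]
  exact le_add_of_nonneg_right (h0 _)

theorem multNorm_eq {N : ℕ} (t : ℝ) (x : Fin N → ℝ) :
    multNorm t x = (∑ j ∈ Finset.univ.filter (fun j : Fin N => (j : ℕ) ≠ 0), |x j| ^ t) ^ (1 / t) := by
  unfold multNorm
  congr 1
  rw [Finset.sum_filter]
  exact Finset.sum_congr rfl fun j _ => by split_ifs <;> simp_all

theorem rpow_sum_mono {ι : Type*} {U V : Finset ι} (hU : U ⊆ V) (x : ι → ℝ) {t : ℝ} (ht : 1 ≤ t) :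
    (∑ j ∈ U, |x j| ^ t) ^ (1 / t) ≤ (∑ j ∈ V, |x j| ^ t) ^ (1 / t) :=
  Real.rpow_le_rpow (Finset.sum_nonneg fun j _ => Real.rpow_nonneg (abs_nonneg _) _)
    (Finset.sum_le_sum_of_subset_of_nonneg hU fun j _ _ => Real.rpow_nonneg (abs_nonneg _) _)
    (by positivity)

theorem abs_le_rpow_sum {ι : Type*} {U : Finset ι} {i : ι} (hi : i ∈ U) (x : ι → ℝ) {t : ℝ}
    (ht : 1 ≤ t) : |x i| ≤ (∑ j ∈ U, |x j| ^ t) ^ (1 / t) := by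
  have ht0 : 0 < t := by linarith
  have := rpow_sum_mono (Finset.singleton_subset_iff.2 hi) x ht
  rwa [Finset.sum_singleton, ← Real.rpow_mul (abs_nonneg _), mul_one_div_cancel ht0.ne',
    Real.rpow_one] at this

/-- The coordinates up to `u`. -/
def headSet (N u : ℕ) : Finset (Fin N) := Finset.univ.filter fun j => (j : ℕ) + 1 ≤ u

theorem head_eq_restrict {N : ℕ} (p : Fin N → ℝ) (u : ℕ) :
    head p u = restrict (headSet N u) p := by
  ext j; simp [head, restrict, headSet]

theorem head_dropFirst_eq_restrict {N : ℕ} (p : Fin N → ℝ) (u : ℕ) :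
    head (dropFirst p) u = restrict ((headSet N u).filter fun j => (j : ℕ) ≠ 0) p := by
  ext j
  by_cases h : (j : ℕ) = 0 <;> simp [head, dropFirst, restrict, headSet, h]

theorem rate_pos {N n : ℕ} (hn : 0 < n) (t : ℝ) (v w : Fin N → ℝ) : 0 < rate t n v w := by
  have hn' : (0 : ℝ) < n := by exact_mod_cast hn
  unfold rate lpNorm
  positivity

/-! ### The Poisson model -/

section Models

variable {N n : ℕ} {η t cI : ℝ} {p : Fin N → ℝ}

theorem rhoPoi_bounds (hη : 0 < η) (hη1 : η < 1) (ht1 : 1 ≤ t) (ht2 : t ≤ 2) (hcI : 0 < cI)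
    (hcI1 : cI ≤ (1 - η) / 32) (hn : 2 ≤ n) (hN : 2 ≤ N) (hanti : Antitone p)
    (hp : ∀ j, 0 ≤ p j) :
    (1 - η) / 96 * cI * rate t n (head p (cutoff cI n p)) (tail p (cutoff cI n p)) ≤
      rhoPoi n p t η ∧
    rhoPoi n p t η ≤
      upperConst η cI * rate t n (head p (cutoff cI n p)) (tail p (cutoff cI n p)) := by
  classical
  have hn0 : 0 < n := by omega
  have hnR : (0 : ℝ) < n := by exact_mod_cast hn0
  have hn2 : (2 : ℝ) ≤ n := by exact_mod_cast hn
  have hM := countModel_poissonVec N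
  have hup := hM.minimaxRisk_le hn hη hη1 hcI (by linarith) ht1 ht2 (p := p) hp
    (headSet N (cutoff cI n p)) (tailSet N (cutoff cI n p)) (d := lpNorm t)
    (fun x => rpow_sum_le_add (fun j _ => by
      simp only [headSet, tailSet, Finset.mem_union, Finset.mem_filter, Finset.mem_univ, true_and]
      omega) x ht1)
    (sum_tail_scaled_sq_le hn0 hcI.le)
    (fun ⟨j, hj⟩ => by
      have hj' : (j : ℕ) + 1 ≤ cutoff cI n p := (Finset.mem_filter.1 hj).2
      obtain ⟨u, hu, hyu, huT⟩ := exists_bulk_bound hn0 hcI hp hanti (by omega)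
      exact ⟨u, hu, fun j hj => hyu j (Finset.mem_filter.1 hj).2, huT⟩)
  have hpos : 0 < upperConst η cI * rate t n (restrict (headSet N (cutoff cI n p)) p)
      (restrict (tailSet N (cutoff cI n p)) p) :=
    mul_pos (upperConst_pos hη hcI) (rate_pos hn0 _ _ _)
  have hne : ∃ ρ, 0 < ρ ∧ minimaxRisk (fun q => Measure.pi fun _ : Fin n => poissonVec q)
      {q : Fin N → ℝ | ∀ j, 0 ≤ q j} (lpNorm t) p ρ ≤ ENNReal.ofReal η := ⟨_, hpos, hup⟩
  rw [head_eq_restrict, tail_eq_restrict]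
  refine ⟨?_, sepRadius_le hpos hup⟩
  have hsingle : ∀ (K : Finset (Fin N)) (g : Fin N → ℝ) l,
      ∑ j ∈ K, g j * (Pi.single j 1 : Fin N → ℝ) l = if l ∈ K then g l else 0 := by
    intro K g l
    simp [Pi.single_apply]
  refine hM.rate_le_sepRadius hn0 hp hanti hη hη1 ht1 ht2 hcI hcI1 hne ?_
    (tailSet N (cutoff cI n p)) le_rfl (by linarith) (fun q hq _ => hq)
    (fun x => rpow_sum_mono (Finset.subset_univ _) x ht1)
    (headSet N (cutoff cI n p)) (headSet N (cutoff cI n p))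
    (fun j hj => (Finset.mem_filter.1 hj).2) ?_ (fun j => Pi.single j 1) ?_ ?_ ?_ ?_
  · -- the parametric rate
    let i : Fin N := ⟨0, by omega⟩
    -- n δ is half of 1 - η. Raising one intensity by δ multiplies the density by at least exp(-δ) ≥
    -- 1 - δ.
    set δ := (1 - η) / (2 * n) with hδ
    have hδ0 : 0 < δ := div_pos (by linarith) (by positivity)
    have hnδ : n * δ = (1 - η) / 2 := by rw [hδ]; field_simp
    have hδ1 : δ ≤ 1 := by nlinarith
    have hsum : ∑ j, (p j + if j = i then δ else 0) = ∑ j, p j + δ := by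
      rw [Finset.sum_add_distrib]; simp
    have hq : ∀ j, 0 ≤ p j + if j = i then δ else 0 := fun j => by
      have := hp j; split_ifs <;> linarith
    have := hM.le_sepRadius_of_dominated (p := p) (q := fun j => p j + if j = i then δ else 0)
      hp hq hη hne hδ0.le hδ1 (by rw [hnδ]; linarith) (s := δ)
      (by
        refine le_trans (le_of_eq ?_)
          (abs_le_rpow_sum (Finset.mem_univ i) (p - fun j => p j + if j = i then δ else 0) ht1)
        simp [abs_of_pos hδ0])
      (fun x => by
        rw [poissonVec_singleton hp, poissonVec_singleton hq, ← ENNReal.ofReal_mul (by linarith),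
          hsum]
        refine ENNReal.ofReal_le_ofReal ?_
        rw [neg_add, Real.exp_add, mul_comm (Real.exp (-∑ j, p j)) (Real.exp (-δ)), mul_assoc,
          mul_assoc, mul_assoc]
        have h1 : 1 - δ ≤ Real.exp (-δ) := by
          have := Real.add_one_le_exp (-δ); linarith
        have h2 : ∏ j, p j ^ x j ≤ ∏ j, (p j + if j = i then δ else 0) ^ x j :=
          Finset.prod_le_prod (fun j _ => pow_nonneg (hp j) _) fun j _ =>
            pow_le_pow_left₀ (hp j) (by split_ifs <;> linarith) _
        have h3 : 0 ≤ ∏ j, p j ^ x j := Finset.prod_nonneg fun j _ => pow_nonneg (hp j) _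
        gcongr)
    have h2 := mul_le_mul_of_nonneg_left this hnR.le
    rw [hnδ] at h2
    linarith
  · have : 0 ≤ ∑ j ∈ headSet N (cutoff cI n p), (n * p j) ^ (2 * t / (4 - t)) :=
      Finset.sum_nonneg fun j _ => Real.rpow_nonneg (mul_nonneg hnR.le (hp j)) _
    linarith
  · intro j _ k _ hjk l
    simp only [Pi.single_apply]
    split_ifs with h1 h2 <;> simp
    exact hjk (h1.symm.trans h2)
  · intro j _ hj l hl
    rw [Pi.single_apply, if_neg]
    rintro rfl
    linarith
  · intro j _ hj
    rw [Finset.sum_eq_single j]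
    · simp only [Pi.single_eq_same, one_pow]
      gcongr
      norm_num
    · intro l _ hl; simp [hl]
    · simp
  · intro g hg
    simp_rw [hsingle]
    refine ⟨fun l => ?_, ?_⟩
    · beta_reduce
      split_ifs with hl
      · linarith [(abs_le.1 (hg l hl)).1]
      · simpa using hp l
    · refine le_trans (le_of_eq ?_) (rpow_sum_mono (U := headSet N (cutoff cI n p)) (Finset.subset_univ _) _ ht1)
      congr 1
      refine Finset.sum_congr rfl fun j hj => ?_
      simp [hj]

end Models

/-! ### The multinomial model -/

section Multinomial

variable {N n : ℕ} {η t cI : ℝ} {p : Fin N → ℝ}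

/-- The preceding coordinate. -/
def predIdx {N : ℕ} (j : Fin N) : Fin N := ⟨(j : ℕ) - 1, by omega⟩

/-- The bulk coordinates with odd index. -/
def oddSet (N u : ℕ) : Finset (Fin N) := (headSet N u).filter fun j => (j : ℕ) % 2 = 1

/-- The direction which moves mass from the preceding coordinate to the coordinate `j`. -/
def pairDir {N : ℕ} (j : Fin N) : Fin N → ℝ := Pi.single j 1 - Pi.single (predIdx j) 1

theorem pairDir_apply (j l : Fin N) :
    pairDir j l = (if l = j then 1 else 0) - (if l = predIdx j then 1 else 0) := by
  simp [pairDir, Pi.single_apply]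

theorem sum_pairDir (j : Fin N) : ∑ l, pairDir j l = 0 := by
  simp [pairDir_apply]

theorem mem_oddSet {u : ℕ} {j : Fin N} :
    j ∈ oddSet N u ↔ (j : ℕ) + 1 ≤ u ∧ (j : ℕ) % 2 = 1 := by
  simp [oddSet, headSet]

theorem predIdx_ne {j : Fin N} (hj : (j : ℕ) % 2 = 1) : predIdx j ≠ j := by
  intro h
  have := congrArg Fin.val h
  simp only [predIdx] at this
  omega

theorem predIdx_le (j : Fin N) : predIdx j ≤ j := Fin.le_def.2 (Nat.sub_le _ _)

/-- For odd indices the pairs {j - 1, j} are disjoint. -/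
theorem pairDir_mul_eq_zero {j k : Fin N} (hj : (j : ℕ) % 2 = 1) (hk : (k : ℕ) % 2 = 1)
    (hjk : j ≠ k) (l : Fin N) : pairDir j l * pairDir k l = 0 := by
  have h : ∀ i : Fin N, l ≠ i → l ≠ predIdx i → pairDir i l = 0 := fun i h1 h2 => by
    simp [pairDir_apply, h1, h2]
  by_cases hl : l = j ∨ l = predIdx j
  · rw [h k, mul_zero]
    all_goals
      intro hlk
      apply hjk
      rcases hl with hl | hl <;>
      · have h1 := congrArg Fin.val hl
        have h2 := congrArg Fin.val hlk
        have h3 : (predIdx j : ℕ) = j - 1 := rfl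
        have h4 : (predIdx k : ℕ) = k - 1 := rfl
        exact Fin.ext (by omega)
  · push Not at hl
    rw [h j hl.1 hl.2, zero_mul]

/-- The donor j - 1 is at least as heavy as j, so the pair costs at most twice 1/p_j. -/
theorem sum_pairDir_sq_div {j : Fin N} (hj : (j : ℕ) % 2 = 1) (hanti : Antitone p)
    (hpj : 0 < p j) : ∑ l, pairDir j l ^ 2 / p l ≤ 2 / p j := by
  have hne := predIdx_ne hj
  have h1 : ∀ l, pairDir j l ^ 2 / p l =
      (if l = j then 1 / p l else 0) + (if l = predIdx j then 1 / p l else 0) := fun l => by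
    rw [pairDir_apply]
    by_cases h : l = j
    · rw [h]; simp [hne.symm]
    · by_cases h' : l = predIdx j
      · rw [h']; simp [hne]
      · simp [h, h']
  simp_rw [h1, Finset.sum_add_distrib]
  simp only [Finset.sum_ite_eq', Finset.mem_univ, if_true]
  have h2 : 1 / p (predIdx j) ≤ 1 / p j := one_div_le_one_div_of_le hpj (hanti (predIdx_le j))
  have h3 : 2 / p j = 1 / p j + 1 / p j := by ring
  linarith

/-- Coordinates of a combination of pair directions. -/
theorem sum_mul_pairDir_of_mem {u : ℕ} (g : Fin N → ℝ) {l : Fin N} (hl : l ∈ oddSet N u) :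
    ∑ j ∈ oddSet N u, g j * pairDir j l = g l := by
  have hl' := (mem_oddSet.1 hl).2
  rw [Finset.sum_eq_single l]
  · rw [pairDir_apply, if_pos rfl, if_neg (predIdx_ne hl').symm]; ring
  · intro j hj hjl
    have hj' := (mem_oddSet.1 hj).2
    rw [pairDir_apply, if_neg hjl.symm, if_neg]
    · ring
    · intro h
      have := congrArg Fin.val h
      simp only [predIdx] at this
      omega
  · exact fun h => absurd hl h

/-- A coordinate lies in at most one pair, and a donor loses at most p_j ≤ p_{j-1}. -/
theorem add_sum_mul_pairDir_nonneg {u : ℕ} {g : Fin N → ℝ} (hanti : Antitone p)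
    (hp : ∀ j, 0 ≤ p j) (hg : ∀ j ∈ oddSet N u, |g j| ≤ p j) (l : Fin N) :
    0 ≤ p l + ∑ j ∈ oddSet N u, g j * pairDir j l := by
  by_cases hl : l ∈ oddSet N u
  · rw [sum_mul_pairDir_of_mem g hl]
    linarith [(abs_le.1 (hg l hl)).1]
  by_cases hk : ∃ k ∈ oddSet N u, l = predIdx k
  · obtain ⟨k, hk, rfl⟩ := hk
    have hk' := (mem_oddSet.1 hk).2
    rw [Finset.sum_eq_single k]
    · rw [pairDir_apply, if_neg (predIdx_ne hk'), if_pos rfl]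
      have h1 := (abs_le.1 (hg k hk)).2
      have h2 := hanti (predIdx_le k)
      linarith
    · intro j hj hjk
      have hj' := (mem_oddSet.1 hj).2
      rw [pairDir_apply, if_neg, if_neg]
      · ring
      · intro h
        have h1 := congrArg Fin.val h
        simp only [predIdx] at h1
        exact hjk (Fin.ext (by omega))
      · intro h
        exact hl (h ▸ hj)
    · exact fun h => absurd hk h
  · push Not at hk
    rw [Finset.sum_eq_zero fun j hj => ?_]
    · simpa using hp l
    · rw [pairDir_apply, if_neg, if_neg (hk j hj)]
      · ring
      · intro h
        exact hl (h ▸ hj)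

/-- Each even index j ≥ 2 is charged to its odd predecessor, which lies in the bulk and has a larger
value. Perturbing only odd indices thus loses a factor 2. -/
theorem sum_headSet_le_two_mul_sum_oddSet {u : ℕ} {f : Fin N → ℝ} (hf : Antitone f)
    (hf0 : ∀ j, 0 ≤ f j) :
    ∑ j ∈ (headSet N u).filter (fun j : Fin N => (j : ℕ) ≠ 0), f j ≤ 2 * ∑ j ∈ oddSet N u, f j := by
  classical
  rw [← Finset.sum_filter_add_sum_filter_not _ (fun j : Fin N => (j : ℕ) % 2 = 1) f, two_mul]
  refine add_le_add (Finset.sum_le_sum_of_subset_of_nonneg ?_ fun j _ _ => hf0 j) ?_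
  · intro j hj
    simp only [headSet, Finset.mem_filter, Finset.mem_univ, true_and] at hj
    exact mem_oddSet.2 ⟨hj.1.1, hj.2⟩
  · refine (Finset.sum_le_sum fun j _ => hf (predIdx_le j)).trans ?_
    rw [← Finset.sum_image (f := f) (g := predIdx)]
    · refine Finset.sum_le_sum_of_subset_of_nonneg ?_ fun j _ _ => hf0 j
      intro i hi
      obtain ⟨j, hj, rfl⟩ := Finset.mem_image.1 hi
      simp only [headSet, Finset.mem_filter, Finset.mem_univ, true_and] at hj
      refine mem_oddSet.2 ?_
      simp only [predIdx]
      omega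
    · intro a ha b hb hab
      simp only [headSet, Finset.mem_filter, Finset.mem_univ, true_and, Finset.coe_filter,
        Set.mem_ofPred_eq] at ha hb
      have := congrArg Fin.val hab
      simp only [predIdx] at this
      exact Fin.ext (by omega)

/-- If the first coordinate lies in the tail, its rescaled square is at most cI ≤ 1/16, so dropping
it loses at most 1/4. -/
theorem sum_tailSet_le_add (hn : 0 < n) (hcI : 0 ≤ cI) (hcI1 : cI ≤ 1 / 16) :
    ∑ j ∈ tailSet N (cutoff cI n p), n * p j ≤
      ∑ j ∈ (tailSet N (cutoff cI n p)).filter (fun j : Fin N => (j : ℕ) ≠ 0), n * p j + 1 / 4 := by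
  rw [← Finset.sum_filter_add_sum_filter_not _ (fun j : Fin N => (j : ℕ) ≠ 0)
    (fun j => (n : ℝ) * p j)]
  refine add_le_add_right ?_ _
  set F := (tailSet N (cutoff cI n p)).filter fun j : Fin N => ¬ (j : ℕ) ≠ 0 with hF
  rcases F.eq_empty_or_nonempty with hFe | ⟨i, hi⟩
  · rw [hFe, Finset.sum_empty]; norm_num
  · have hFi : F = {i} := by
      refine Finset.eq_singleton_iff_unique_mem.2 ⟨hi, fun j hj => ?_⟩
      simp only [hF, Finset.mem_filter, not_not] at hi hj
      exact Fin.ext (by omega)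
    rw [hFi, Finset.sum_singleton]
    have h1 : (n * p i) ^ 2 ≤ cI := (Finset.single_le_sum (f := fun j => ((n : ℝ) * p j) ^ 2)
      (fun j _ => sq_nonneg _) (Finset.mem_filter.1 hi).1).trans (sum_tail_scaled_sq_le hn hcI)
    nlinarith

theorem rhoMult_bounds (hη : 0 < η) (hη1 : η < 1) (ht1 : 1 ≤ t) (ht2 : t ≤ 2) (hcI : 0 < cI)
    (hcI1 : cI ≤ (1 - η) / 32) (hn : 2 ≤ n) (hN : 2 ≤ N) (hanti : Antitone p)
    (hp : p ∈ stdSimplex ℝ (Fin N)) :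
    (1 - η) / 96 * cI * rate t n (head (dropFirst p) (cutoff cI n p)) (tail p (cutoff cI n p)) ≤
      rhoMult n p t η ∧
    rhoMult n p t η ≤
      upperConst η cI *
        rate t n (head (dropFirst p) (cutoff cI n p)) (tail p (cutoff cI n p)) := by
  classical
  have hn0 : 0 < n := by omega
  have hnR : (0 : ℝ) < n := by exact_mod_cast hn0
  have hn2 : (2 : ℝ) ≤ n := by exact_mod_cast hn
  have hnn := hp.1
  have hM := countModel_drawLaw N
  set I := cutoff cI n p with hI
  set B := (headSet N I).filter (fun j : Fin N => (j : ℕ) ≠ 0) with hB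
  have hup := hM.minimaxRisk_le hn hη hη1 hcI (by linarith) ht1 ht2 (p := p) hp
    B (tailSet N I) (d := multNorm t)
    (fun x => by
      rw [multNorm_eq]
      refine rpow_sum_le_add (fun j hj => ?_) x ht1
      simp only [hB, headSet, tailSet, Finset.mem_union, Finset.mem_filter, Finset.mem_univ,
        true_and] at hj ⊢
      omega)
    (sum_tail_scaled_sq_le hn0 hcI.le)
    (fun ⟨j, hj⟩ => by
      have hBI : ∀ j ∈ B, (j : ℕ) + 1 ≤ I := fun j hj =>
        (Finset.mem_filter.1 (Finset.mem_filter.1 hj).1).2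
      obtain ⟨u, hu, hyu, huT⟩ := exists_bulk_bound hn0 hcI hnn hanti (by
        have := hBI j hj; omega)
      exact ⟨u, hu, fun j hj => hyu j (hBI j hj), huT⟩)
  have hpos : 0 < upperConst η cI * rate t n (restrict B p) (restrict (tailSet N I) p) :=
    mul_pos (upperConst_pos hη hcI) (rate_pos hn0 _ _ _)
  have hne : ∃ ρ, 0 < ρ ∧ minimaxRisk (fun q => Measure.pi fun _ : Fin n => drawLaw q)
      (stdSimplex ℝ (Fin N)) (multNorm t) p ρ ≤ ENNReal.ofReal η := ⟨_, hpos, hup⟩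
  rw [head_dropFirst_eq_restrict, tail_eq_restrict]
  refine ⟨?_, sepRadius_le hpos hup⟩
  refine hM.rate_le_sepRadius hn0 hp hanti hη hη1 ht1 ht2 hcI hcI1 hne ?_
    ((tailSet N I).filter fun j : Fin N => (j : ℕ) ≠ 0) (Finset.filter_subset _ _)
    (sum_tailSet_le_add hn0 hcI.le (by linarith)) (fun q hq hqs => ⟨hq, hqs.trans hp.2⟩)
    (fun x => by
      rw [multNorm_eq]
      exact rpow_sum_mono (Finset.filter_subset_filter _ (Finset.subset_univ _)) x ht1)
    B (oddSet N I) (fun j hj => (mem_oddSet.1 hj).1) ?_ pairDir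
    (fun j hj k hk hjk l => pairDir_mul_eq_zero (mem_oddSet.1 hj).2 (mem_oddSet.1 hk).2 hjk l)
    ?_ (fun j hj hpj => sum_pairDir_sq_div (mem_oddSet.1 hj).2 hanti hpj) ?_
  · -- the parametric rate
    let i₀ : Fin N := ⟨0, by omega⟩
    let i : Fin N := ⟨1, by omega⟩
    have hi : i₀ ≠ i := fun h => by simpa [i₀, i] using congrArg Fin.val h
    set δ := (1 - η) / (2 * n) with hδ
    have hδ0 : 0 < δ := div_pos (by linarith) (by positivity)
    have hnδ : n * δ = (1 - η) / 2 := by rw [hδ]; field_simp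
    have hδ1 : δ ≤ 1 := by nlinarith
    -- `multNorm` ignores the first coordinate, so mass is moved to the second; p i ≤ 1/2 makes its
    -- increase δ (1 - p i) at least δ/2.
    have hpi : p i ≤ 1 / 2 := by
      have h1 : p i ≤ p i₀ := hanti (Fin.le_def.2 (by simp [i₀]))
      have h2 : ∑ j ∈ {i₀, i}, p j ≤ ∑ j, p j :=
        Finset.sum_le_sum_of_subset_of_nonneg (Finset.subset_univ _) fun j _ _ => hnn j
      rw [Finset.sum_pair hi, hp.2] at h2
      linarith
    have hq : (fun j => (1 - δ) * p j + if j = i then δ else 0) ∈ stdSimplex ℝ (Fin N) := by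
      refine ⟨fun j => ?_, ?_⟩
      · have := mul_nonneg (by linarith : 0 ≤ 1 - δ) (hnn j)
        beta_reduce
        split_ifs <;> linarith
      · rw [Finset.sum_add_distrib, ← Finset.mul_sum, hp.2]; simp
    have := hM.le_sepRadius_of_dominated hp hq hη hne hδ0.le hδ1 (by rw [hnδ]; linarith)
      (s := δ / 2)
      (by
        rw [multNorm_eq]
        refine le_trans ?_ (abs_le_rpow_sum (i := i) (by simp [i])
          (p - fun j => (1 - δ) * p j + if j = i then δ else 0) ht1)
        rw [Pi.sub_apply, if_pos rfl, abs_sub_comm]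
        refine le_trans ?_ (le_abs_self _)
        nlinarith)
      (fun x => by
        rw [drawLaw_singleton, drawLaw_singleton, ← ENNReal.ofReal_mul (by linarith)]
        refine ENNReal.ofReal_le_ofReal (le_add_of_nonneg_right ?_)
        split_ifs <;> linarith)
    have h2 := mul_le_mul_of_nonneg_left this hnR.le
    linarith
  · refine sum_headSet_le_two_mul_sum_oddSet (f := fun j => (n * p j) ^ (2 * t / (4 - t)))
      (fun a b hab => ?_) fun j => Real.rpow_nonneg (mul_nonneg hnR.le (hnn j)) _
    exact Real.rpow_le_rpow (mul_nonneg hnR.le (hnn b))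
      (mul_le_mul_of_nonneg_left (hanti hab) hnR.le) (div_nonneg (by linarith) (by linarith))
  · intro j hj hpj l hl
    rw [pairDir_apply, if_neg, if_neg]
    · ring
    · rintro rfl
      have := hanti (predIdx_le j)
      linarith
    · rintro rfl
      linarith
  · intro g hg
    refine ⟨⟨fun l => add_sum_mul_pairDir_nonneg hanti hnn hg l, ?_⟩, ?_⟩
    · rw [Finset.sum_add_distrib, hp.2, Finset.sum_comm]
      simp_rw [← Finset.mul_sum, sum_pairDir]
      simp
    · rw [multNorm_eq]
      refine le_trans (le_of_eq ?_) (rpow_sum_mono (U := oddSet N I) (fun j hj => ?_) _ ht1)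
      · congr 1
        refine Finset.sum_congr rfl fun j hj => ?_
        rw [Pi.sub_apply, sum_mul_pairDir_of_mem g hj, sub_add_cancel_left, abs_neg]
      · have := (mem_oddSet.1 hj).2
        simp only [Finset.mem_filter, Finset.mem_univ, true_and]
        omega

end Multinomial

end GoodnessOfFit

theorem mainTheorem4 (η : ℝ) (hη₀ : 0 < η) (hη₁ : η < 1) :
    ∃ c₀ : ℝ, 0 < c₀ ∧ ∀ cI : ℝ, 0 < cI → cI ≤ c₀ →
      ∃ c C : ℝ, 0 < c ∧ 0 < C ∧
        ∀ t : ℝ, 1 ≤ t → t ≤ 2 → ∀ n N : ℕ, 2 ≤ n → 2 ≤ N →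
          ∀ p : Fin N → ℝ, Antitone p →
            ((∀ j, 0 ≤ p j) →
              c * GoodnessOfFit.rate t n
                    (GoodnessOfFit.head p (GoodnessOfFit.cutoff cI n p))
                    (GoodnessOfFit.tail p (GoodnessOfFit.cutoff cI n p))
                  ≤ GoodnessOfFit.rhoPoi n p t η ∧
              GoodnessOfFit.rhoPoi n p t η ≤
                C * GoodnessOfFit.rate t n
                    (GoodnessOfFit.head p (GoodnessOfFit.cutoff cI n p))
                    (GoodnessOfFit.tail p (GoodnessOfFit.cutoff cI n p))) ∧
            (p ∈ stdSimplex ℝ (Fin N) →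
              c * GoodnessOfFit.rate t n
                    (GoodnessOfFit.head (GoodnessOfFit.dropFirst p)
                      (GoodnessOfFit.cutoff cI n p))
                    (GoodnessOfFit.tail p (GoodnessOfFit.cutoff cI n p))
                  ≤ GoodnessOfFit.rhoMult n p t η ∧
              GoodnessOfFit.rhoMult n p t η ≤
                C * GoodnessOfFit.rate t n
                    (GoodnessOfFit.head (GoodnessOfFit.dropFirst p)
                      (GoodnessOfFit.cutoff cI n p))
                    (GoodnessOfFit.tail p (GoodnessOfFit.cutoff cI n p))) := by
  -- The threshold comes from the tail prior, where coordinates too large for the blocks may carry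
  -- at most a quarter of T.
  refine ⟨(1 - η) / 32, by linarith, fun cI hcI hcI1 => ⟨(1 - η) / 96 * cI,
    GoodnessOfFit.upperConst η cI, mul_pos (by linarith) hcI,
    GoodnessOfFit.upperConst_pos hη₀ hcI, fun t ht1 ht2 n N hn hN p hanti => ⟨fun hp => ?_,
    fun hp => ?_⟩⟩⟩
  · exact GoodnessOfFit.rhoPoi_bounds hη₀ hη₁ ht1 ht2 hcI hcI1 hn hN hanti hp
  · exact GoodnessOfFit.rhoMult_bounds hη₀ hη₁ ht1 ht2 hcI hcI1 hn hN hanti hp
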